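/- All manifolds are smooth and finite-dimensional without boundary; $T^{(k)}$ is the $k$-fold iterated tangent functor, $T^kN$ is the bundle of $k$-velocities $j^k_t\gamma$ of smooth curves in $N$, and there are the usual inclusions $T^kN\subset T^{(k)}N$ and $T^{k+l}N\subset T^kT^lN\subset T^{(k+l)}N$, given by $j^{k+l}_0\gamma\mapsto j^k_{t=0}j^l_{s=0}\gamma(t+s)$. For $k\ge m$, $l\ge n$ let $\Phi^{(m,n)}\in T^mT^nN$ be the projection of $\Phi\in T^kT^lN$. Let $\sigma:E\to M$ be a vector bundle with dual $\sigma^*:E^*\to M$ and pairing $\langle\cdot,\cdot\rangle_\sigma$. Applying tangent functors gives vector bundles $T\sigma:TE\to TM$, $T^{(k)}\sigma$, $T^kT^l\sigma$, and so on. The pairing $\langle\cdot,\cdot\rangle_{T\sigma}$ of $TE^*$ with $TE$ over $TM$ is the tangent lift of $\langle\cdot,\cdot\rangle_\sigma$, that is, $\langle j^1_0\xi,j^1_0e\rangle_{T\sigma}=\frac{d}{dt}\big|_{0}\langle\xi(t),e(t)\rangle_\sigma$ for curves $\xi$, $e$ over the same curve in $M$. It is nondegenerate, and $TE^*$ is used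 as the dual of $TE$. Iterating this gives $\langle\cdot,\cdot\rangle_{T^{(k)}\sigma}$, whose restriction to $T^kE^*\times_{T^kM}T^kE$ is $\langle\cdot,\cdot\rangle_{T^k\sigma}$. The bundle of semi-holonomic vectors is $$T^{k,l}_{\rm hol}E=\{\Phi\in T^kT^lE:\ T^kT^l\sigma(\Phi)\in T^{k+l}M\subset T^kT^lM\}.$$ If $X\in T^{(k)}E$ lies over $v^k\in T^kM$, then $P_k(X)$ is the element of $T^kE$ over $v^k$ with $\langle P_k(X),\Psi\rangle_{T^k\sigma}=\langle X,\Psi\rangle_{T^{(k)}\sigma}$ for all $\Psi\in T^kE^*$ over $v^k$. For $k\ge0$ and $\Phi\in T^{k,k}_{\rm hol}E$ put, with sums taken in the vector bundle $T^{(k)}\sigma$, $$\widetilde\Phi=\sum_{j=0}^k(-1)^j\binom kj\Phi^{(j,k-j)},\qquad \Pi_{k,\sigma}(\Phi)=P_k\Big[\sum_{j=0}^{k}(-1)^j\binom{k+1}{j+1}\Phi^{(j,k-j)}\Big].$$ **Theorem.** Let $\Phi\in T^{k,k}_{\rm hol}E$ lie over $v^{2k}\in T^{2k}M$, and let $v^k\in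 T^kM$ be the projection of $v^{2k}$. For $j^k\xi\in T^kE^*$ over $v^k$ with base point $\xi\in E^*$, the value $\langle\widetilde\Phi,j^k\xi\rangle_{T^{(k)}\sigma}$ depends only on $\xi$ (and $\Phi$). Hence $$\langle\Upsilon_{k,\sigma}(\Phi),\xi\rangle_\sigma=\langle\widetilde\Phi,j^k\xi\rangle_{T^{(k)}\sigma}$$ defines a canonical smooth vector bundle morphism $\Upsilon_{k,\sigma}:T^{k,k}_{\rm hol}\sigma\to\sigma$ covering the projection $T^{2k}M\to M$. Likewise $\Pi_{k,\sigma}$ is a well-defined smooth vector bundle morphism $T^{k,k}_{\rm hol}\sigma\to T^k\sigma$ covering the projection $T^{2k}M\to T^kM$. Moreover: (a) In coordinates, $\Upsilon_{k,\sigma}(\Phi)=\big(x^a,\ \sum_{\alpha=0}^k(-1)^\alpha\binom k\alpha y^{i,(\alpha,k-\alpha)}\big)$. Here $(x^a,y^i)$ are coordinates on $E$ with $y^i$ linear on fibres, $f^{(\alpha)}(j^k_0\gamma)=\frac{d^\alpha}{dt^\alpha}\big|_0f(\gamma(t))$, and $y^{i,(\alpha,\beta)}=((y^i)^{(\beta)})^{(\alpha)}$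 on $T^kT^kE$, evaluated at $\Phi$. (b) $\Upsilon_{1,\sigma}(\Phi)=\nu_E\big[\tau_{TE}(\Phi)-T\tau_E(\Phi)\big]$ for $\Phi\in T^{1,1}_{\rm hol}E$. Here $\tau_N:TN\to N$ is the projection, the difference is taken in $T\sigma$, and $\nu_E$ is the projection to $E$ from $TE|_M\cong E\times_MTM$, with $M\subset E$ the zero section. For $k\ge1$, $\Upsilon_{k,\sigma}=\Upsilon_{1,\sigma}\circ\Upsilon_{k-1,TT\sigma}$ on $T^{k,k}_{\rm hol}E$, where $T^kT^kE\subset T^{k-1}T^{k-1}TTE$ by $j^k_tj^k_s\gamma(t,s)\mapsto j^{k-1}_tj^{k-1}_sj^1_{t'}j^1_{s'}\gamma(t+t',s+s')$. (c) $\Pi_{0,\sigma}=\mathrm{id}$. For $k\ge1$, $\Phi\in T^{k,k}_{\rm hol}E$ and $j^k\xi\in T^kE^*$ over $v^k$, $$\langle\Pi_{k,\sigma}(\Phi),j^k\xi\rangle_{T^k\sigma}=\langle\Upsilon_{k,\sigma}(\Phi),\xi\rangle_\sigma+\langle\Pi_{k-1,T\sigma}(\Phi^{(k-1,k)}),j^k\xi\rangle_{T^{(k)}\sigma},$$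 where $\Phi^{(k-1,k)}\in T^{k-1,k}_{\rm hol}E\subset T^{k-1,k-1}_{\rm hol}TE$. (d) (Integration by parts.) For $k\ge1$, $\Phi\in T^{k,k}_{\rm hol}E$ and $j^k\xi\in T^kE^*$ over $v^k$, $$\langle\Phi^{(0,k)},j^k\xi\rangle_{T^{(k)}\sigma}=\langle\Upsilon_{k,\sigma}(\Phi),\xi\rangle_\sigma+\langle T\Pi_{k-1,\sigma}(\Phi^{(k,k-1)}),j^k\xi\rangle_{T^{(k)}\sigma},$$ where $\Phi^{(k,k-1)}\in T^{k,k-1}_{\rm hol}E\subset T\,T^{k-1,k-1}_{\rm hol}E$. (e) $T\Upsilon_{k,\sigma}\circ\widetilde\kappa=\Upsilon_{k,T\sigma}$ on $T^{k,k}_{\rm hol}TE$, where $\widetilde\kappa:T^{k,k}_{\rm hol}TE\to T\,T^{k,k}_{\rm hol}E$ is the canonical flip $j^k_tj^k_sj^1_r\gamma(t,s,r)\mapsto j^1_rj^k_tj^k_s\gamma(t,s,r)$. (f) $T\Pi_{k,\sigma}\circ\widetilde\kappa=\kappa_k\circ\Pi_{k,T\sigma}$ on $T^{k,k}_{\rm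 hol}TE$, where $\kappa_k:T^kTE\to TT^kE$ is the canonical flip $j^k_tj^1_s\gamma(t,s)\mapsto j^1_sj^k_t\gamma(t,s)$. -/

import Mathlib

open Set Bundle
open scoped Manifold ContDiff

universe u

noncomputable section

/-! ## Manifolds, iterated tangent bundles and curves -/

/-- A smooth (`C^∞`) real manifold together with its model, bundled so that the tangent functor can
be iterated. -/
structure Mfd : Type (u + 1) where
  V : Type u
  [nacg : NormedAddCommGroup V]
  [nsp : NormedSpace ℝ V]
  H : Type u
  [topH : TopologicalSpace H]
  I : ModelWithCorners ℝ V H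
  carrier : Type u
  [top : TopologicalSpace carrier]
  [charted : ChartedSpace H carrier]
  [smooth : IsManifold I ∞ carrier]

attribute [instance] Mfd.nacg Mfd.nsp Mfd.topH Mfd.top Mfd.charted Mfd.smooth

instance : CoeSort Mfd.{u} (Type u) := ⟨Mfd.carrier⟩

/-- The tangent bundle `T N`, with Mathlib's manifold structure. -/
def Mfd.T (N : Mfd.{u}) : Mfd.{u} where
  V := N.V × N.V
  H := ModelProd N.H N.V
  I := N.I.tangent
  carrier := TangentBundle N.I N

/-- The iterated tangent bundle `T^{(k)} N = T (T (⋯ N))`. -/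
def iterT : ℕ → Mfd.{u} → Mfd.{u}
  | 0, N => N
  | k + 1, N => (iterT k N).T

theorem iterT_iterT {m n k : ℕ} (N : Mfd.{u}) (h : m + n = k) :
    iterT m (iterT n N) = iterT k N := by
  subst h
  induction m with
  | zero => rw [Nat.zero_add]; rfl
  | succ m ih =>
    rw [Nat.succ_add]
    exact congrArg Mfd.T ih

/-- Transport along an equality of manifolds. -/
def Mfd.cast {A B : Mfd.{u}} (h : A = B) (x : A) : B :=
  _root_.cast (congrArg Mfd.carrier h) x

/-- The identification `T^{(m)} T^{(n)} N = T^{(m+n)} N`. -/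
def merge {m n k : ℕ} {N : Mfd.{u}} (h : m + n = k) (x : iterT m (iterT n N)) : iterT k N :=
  Mfd.cast (iterT_iterT N h) x

/-- `τ_N : T N → N`. -/
def Mfd.base {N : Mfd.{u}} (w : N.T) : N := Bundle.TotalSpace.proj w

/-- The tangent map `T f : T N → T N'` of a smooth map. -/
def tmap {N N' : Mfd.{u}} (f : N → N') : N.T → N'.T := tangentMap N.I N'.I f

/-- The iterated tangent map `T^{(k)} f`. -/
def iterMap : ∀ (k : ℕ) {N N' : Mfd.{u}} (_ : N → N'), iterT k N → iterT k N'
  | 0, _, _, f => f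
  | k + 1, _, _, f => tmap (iterMap k f)

/-- Smooth curves in `N`. -/
def SmoothCurve (N : Mfd.{u}) (c : ℝ → N) : Prop := ContMDiff 𝓘(ℝ, ℝ) N.I ∞ c

/-- The velocity `j¹_t c ∈ T N` of a curve. -/
def vel {N : Mfd.{u}} (c : ℝ → N) (t : ℝ) : N.T :=
  (⟨c t, mfderiv 𝓘(ℝ, ℝ) N.I c t (1 : ℝ)⟩ : TangentBundle N.I N)

/-- The `k`-velocity `j^k_t c`, as an element of `T^{(k)} N`; the inclusion is the usual one,
`j^{k+1}_t c = j¹_{t} (s ↦ j^k_s c)`. -/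
def jet {N : Mfd.{u}} : ∀ (k : ℕ) (_ : ℝ → N), ℝ → iterT k N
  | 0, c => c
  | k + 1, c => vel (jet k c)

/-- For a submanifold `S` of `N`, the higher tangent bundle `T^k S ⊂ T^{(k)} N`: all `k`-velocities
of smooth curves lying in `S`. Thus `Vel k univ` is `T^k N`, `Vel k (Vel l univ)` is `T^k T^l N`,
and `Vel 1 S` is the tangent bundle `T S`. -/
def Vel {N : Mfd.{u}} (k : ℕ) (S : Set N) : Set (iterT k N) :=
  {X | ∃ c : ℝ → N, SmoothCurve N c ∧ (∀ t, c t ∈ S) ∧ jet k c 0 = X}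

/-- `T^{k+l} N` included in `T^k T^l N`: the holonomic vectors
`j^k_{t=0} j^l_{s=0} γ(t + s)`. -/
def Holonomic (k l : ℕ) (N : Mfd.{u}) : Set (iterT k (iterT l N)) :=
  {X | ∃ c : ℝ → N, SmoothCurve N c ∧ jet k (jet l c) 0 = X}

/-- The map `T^{(k)} N → T^{(m)} N`, `m ≤ k`, iterating the bundle projection of the outermost
tangent bundle. On `T^k N` it is the canonical projection `τ^k_m : T^k N → T^m N`. -/
def trunc {N : Mfd.{u}} : ∀ (k m : ℕ) (_ : m ≤ k), iterT k N → iterT m N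
  | 0, m, h, x => Mfd.cast (congrArg (fun i => iterT i N) (Nat.le_zero.mp h).symm) x
  | k + 1, m, h, x =>
    if h' : k + 1 = m then Mfd.cast (congrArg (fun i => iterT i N) h') x
    else trunc k m (by omega) (Mfd.base (N := iterT k N) x)

/-- `Φ^{(m,n)}`: the projection `T^k T^l N → T^m T^n N`, for `m ≤ k`, `n ≤ l`. -/
def trunc₂ {N : Mfd.{u}} {k l : ℕ} (m n : ℕ) (hm : m ≤ k) (hn : n ≤ l)
    (Φ : iterT k (iterT l N)) : iterT m (iterT n N) :=
  trunc k m hm (iterMap k (trunc l n hn) Φ)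

open Classical in
/-- The tangent map `T F : T S → T N'` of a smooth map `F` defined on a submanifold `S` of `N`:
`T F (j¹_0 c) = j¹_0 (F ∘ c)` for smooth curves `c` in `S` (junk outside `T S`). -/
def tmapOn {N N' : Mfd.{u}} (S : Set N) (F : N → N') (w : N.T) : N'.T :=
  if h : ∃ c : ℝ → N, SmoothCurve N c ∧ (∀ t, c t ∈ S) ∧ vel c 0 = w then
    vel (fun t => F (h.choose t)) 0
  else tmap F w

open Classical in
/-- The lift `f^{(α)}` to `T^k S` of a real function `f` on a submanifold `S` of `N`:
`f^{(α)} (j^k_0 c) = (d/dt)^α f(c t)` at `t = 0`, for smooth curves `c` in `S`. -/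
def liftFun {N : Mfd.{u}} (S : Set N) (f : N → ℝ) (k α : ℕ) (X : iterT k N) : ℝ :=
  if h : ∃ c : ℝ → N, SmoothCurve N c ∧ (∀ t, c t ∈ S) ∧ jet k c 0 = X then
    iteratedDeriv α (fun t => f (h.choose t)) 0
  else 0

/-- `f^{(α,β)} = (f^{(β)})^{(α)}` on `T^k T^l N`. -/
def liftFun₂ {N : Mfd.{u}} (f : N → ℝ) (k l α β : ℕ) : iterT k (iterT l N) → ℝ :=
  liftFun (Vel l (univ : Set N)) (liftFun univ f l β) k α

/-- The graph of the canonical flip `κ_k : T^k T N → T T^k N`,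
`j^k_t j¹_s γ(t,s) ↦ j¹_s j^k_t γ(t,s)`. -/
def IsFlip {N : Mfd.{u}} (k : ℕ) (X : iterT k N.T) (Y : (iterT k N).T) : Prop :=
  ∃ g : ℝ → ℝ → N, ContMDiff 𝓘(ℝ, ℝ × ℝ) N.I ∞ (fun p : ℝ × ℝ => g p.1 p.2) ∧
    jet k (fun t => vel (fun s => g t s) 0) 0 = X ∧
    vel (fun s => jet k (fun t => g t s) 0) 0 = Y

/-- The graph of the canonical flip `T^k T^l T N → T T^k T^l N`,
`j^k_t j^l_s j¹_r γ(t,s,r) ↦ j¹_r j^k_t j^l_s γ(t,s,r)`. -/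
def IsFlip₂ {N : Mfd.{u}} (k l : ℕ) (X : iterT k (iterT l N.T)) (Y : (iterT k (iterT l N)).T) :
    Prop :=
  ∃ g : ℝ → ℝ → ℝ → N,
    ContMDiff 𝓘(ℝ, ℝ × ℝ × ℝ) N.I ∞ (fun p : ℝ × ℝ × ℝ => g p.1 p.2.1 p.2.2) ∧
    jet k (fun t => jet l (fun s => vel (fun r => g t s r) 0) 0) 0 = X ∧
    vel (fun r => jet k (fun t => jet l (fun s => g t s r) 0) 0) 0 = Y

/-- The graph of the canonical inclusion `T^{k+1} T^{k+1} N ⊂ T^k T^k T T N`,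
`j^{k+1}_t j^{k+1}_s γ(t,s) ↦ j^k_t j^k_s j¹_{t'} j¹_{s'} γ(t + t', s + s')`. -/
def IsSplit {N : Mfd.{u}} (k : ℕ) (X : iterT (k + 1) (iterT (k + 1) N))
    (Y : iterT k (iterT k N.T.T)) : Prop :=
  ∃ g : ℝ → ℝ → N, ContMDiff 𝓘(ℝ, ℝ × ℝ) N.I ∞ (fun p : ℝ × ℝ => g p.1 p.2) ∧
    jet (k + 1) (fun t => jet (k + 1) (fun s => g t s) 0) 0 = X ∧
    jet k (fun t => jet k (fun s =>
      vel (fun t' => vel (fun s' => g (t + t') (s + s')) 0) 0) 0) 0 = Y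

/-! ## Vector bundles, their duals, and tangent lifts -/

/-- The structure maps of a vector bundle `σ : E → M` and of a bundle `σ* : D → M` paired with it.
`add` is only meaningful for two vectors of one fibre, and `pair` on the fibre product `D ×_M E`.
Only two kinds of data are used: those of a smooth vector bundle and its dual (`VBData.ofBundle`),
and their tangent lifts (`VBData.T`). -/
structure VBData (M E D : Mfd.{u}) where
  pE : E → M
  pD : D → M
  add : E → E → E
  smul : ℝ → E → E
  pair : D → E → ℝ

variable {M E D : Mfd.{u}}

open Classical in
/-- The tangent lift: the vector bundle `T σ : T E → T M`, the bundle `T σ* : T D → T M` and the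
pairing `⟨ , ⟩_{Tσ} = ⟨ , ⟩_σ^{(1)}`. The addition of `T σ` is the tangent map of the addition
`E ×_M E → E`, i.e. `j¹_0 α + j¹_0 β = j¹_0 (α + β)` for curves with `σ ∘ α = σ ∘ β`, and the
pairing is `⟨j¹_0 ξ, j¹_0 α⟩ = (d/dt)_{t=0} ⟨ξ(t), α(t)⟩` for curves with `σ* ∘ ξ = σ ∘ α`. -/
def VBData.T (σ : VBData M E D) : VBData M.T E.T D.T where
  pE := tmap σ.pE
  pD := tmap σ.pD
  add a b :=
    if h : ∃ c : (ℝ → E) × (ℝ → E), SmoothCurve E c.1 ∧ SmoothCurve E c.2 ∧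
        (∀ t, σ.pE (c.1 t) = σ.pE (c.2 t)) ∧ vel c.1 0 = a ∧ vel c.2 0 = b then
      vel (fun t => σ.add (h.choose.1 t) (h.choose.2 t)) 0
    else a
  smul r := tmap (σ.smul r)
  pair x a :=
    if h : ∃ c : (ℝ → D) × (ℝ → E), SmoothCurve D c.1 ∧ SmoothCurve E c.2 ∧
        (∀ t, σ.pD (c.1 t) = σ.pE (c.2 t)) ∧ vel c.1 0 = x ∧ vel c.2 0 = a then
      deriv (fun t => σ.pair (h.choose.1 t) (h.choose.2 t)) 0
    else 0

/-- The iterated tangent lift `T^{(k)} σ`. -/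
def VBData.iter (σ : VBData M E D) : ∀ k : ℕ, VBData (iterT k M) (iterT k E) (iterT k D)
  | 0 => σ
  | k + 1 => (σ.iter k).T

/-- The linear combination `∑_{j=0}^n a_j e_j` of vectors of one fibre of `σ`. -/
def VBData.lin (σ : VBData M E D) : ∀ n : ℕ, (Fin (n + 1) → ℝ) → (Fin (n + 1) → E) → E
  | 0, a, e => σ.smul (a 0) (e 0)
  | n + 1, a, e =>
    σ.add (σ.lin n (fun j => a j.castSucc) (fun j => e j.castSucc))
      (σ.smul (a (Fin.last (n + 1))) (e (Fin.last (n + 1))))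

section ofBundle

variable {V : Type u} [NormedAddCommGroup V] [NormedSpace ℝ V] {H : Type u} [TopologicalSpace H]
  (I : ModelWithCorners ℝ V H) {B : Type u} [TopologicalSpace B] [ChartedSpace H B]
  [IsManifold I ∞ B]

/-- A manifold of Mathlib, bundled. -/
def Mfd.of (B : Type u) [TopologicalSpace B] [ChartedSpace H B] [IsManifold I ∞ B] : Mfd.{u} where
  V := V
  H := H
  I := I
  carrier := B

variable (F : Type u) [NormedAddCommGroup F] [NormedSpace ℝ F] (Q : B → Type u)
  [∀ x, AddCommGroup (Q x)] [∀ x, Module ℝ (Q x)] [∀ x, TopologicalSpace (Q x)]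
  [TopologicalSpace (TotalSpace F Q)] [FiberBundle F Q] [VectorBundle ℝ F Q]
  [ContMDiffVectorBundle ∞ F Q I]

/-- The total space of a smooth vector bundle, as a manifold. -/
def Mfd.total : Mfd.{u} := Mfd.of (I.prod 𝓘(ℝ, F)) (TotalSpace F Q)

/-- The total space of the dual bundle, as a manifold. -/
def Mfd.dual : Mfd.{u} :=
  Mfd.total I (F →L[ℝ] ℝ) (fun x => Q x →L[ℝ] Bundle.Trivial B ℝ x)

open Classical in
/-- The structure maps of a smooth vector bundle, of its dual bundle, and the natural pairing. -/
def VBData.ofBundle : VBData (Mfd.of I B) (Mfd.total I F Q) (Mfd.dual I F Q) where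
  pE := fun e : TotalSpace F Q => e.proj
  pD := fun x : TotalSpace (F →L[ℝ] ℝ) (fun x => Q x →L[ℝ] Bundle.Trivial B ℝ x) => x.proj
  add := fun a b : TotalSpace F Q =>
    if h : b.proj = a.proj then (⟨a.proj, a.snd + h ▸ b.snd⟩ : TotalSpace F Q) else a
  smul := fun (r : ℝ) (a : TotalSpace F Q) => (⟨a.proj, r • a.snd⟩ : TotalSpace F Q)
  pair := fun (x : TotalSpace (F →L[ℝ] ℝ) (fun x => Q x →L[ℝ] Bundle.Trivial B ℝ x))
      (a : TotalSpace F Q) =>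
    if h : a.proj = x.proj then (x.snd (h ▸ a.snd) : ℝ) else 0

end ofBundle

/-! ## Semi-holonomic vectors, the maps `Υ` and `Π` -/

/-- `T^{k,l}_{hol} E`: the elements of `T^k T^l E` which project to `T^{k+l} M ⊂ T^k T^l M`. -/
def VBData.SemiHol (σ : VBData M E D) (k l : ℕ) : Set (iterT k (iterT l E)) :=
  {Φ | Φ ∈ Vel k (Vel l (univ : Set E)) ∧ iterMap k (iterMap l σ.pE) Φ ∈ Holonomic k l M}

/-- `Φ^{(m,n)}` with `m + n = p`, as an element of `T^{(p)} E`. -/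
def part {k l : ℕ} (Φ : iterT k (iterT l E)) (m n p : ℕ) (hm : m ≤ k) (hn : n ≤ l)
    (h : m + n = p) : iterT p E :=
  merge h (trunc₂ m n hm hn Φ)

/-- The combination `∑_{j=0}^k a_j Φ^{(j,k-j)}` in the vector bundle `T^{(k)} σ`. -/
def VBData.combine (σ : VBData M E D) (k : ℕ) (a : ℕ → ℝ) (Φ : iterT k (iterT k E)) : iterT k E :=
  (σ.iter k).lin k (fun j => a j)
    (fun j => part Φ j (k - j) k (Nat.le_of_lt_succ j.isLt) (Nat.sub_le k j)
      (Nat.add_sub_cancel' (Nat.le_of_lt_succ j.isLt)))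

/-- `Φ~ = ∑_{j=0}^k (-1)^j C(k,j) Φ^{(j,k-j)}`. -/
def VBData.tilde (σ : VBData M E D) (k : ℕ) (Φ : iterT k (iterT k E)) : iterT k E :=
  σ.combine k (fun j => (-1) ^ j * (k.choose j : ℝ)) Φ

/-- `v^k = τ^{2k}_k (v^{2k})` in `T^k M`, where `v^{2k}` is the projection of `Φ` to `T^{2k} M`. -/
def VBData.baseVel (σ : VBData M E D) (k : ℕ) (Φ : iterT k (iterT k E)) : iterT k M :=
  trunc (N := iterT k M) k 0 (Nat.zero_le k) (iterMap k (iterMap k σ.pE) Φ)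

/-- `τ^{2k} (v^{2k})` in `M`. -/
def VBData.basePt (σ : VBData M E D) (k : ℕ) (Φ : iterT k (iterT k E)) : M :=
  trunc (N := M) k 0 (Nat.zero_le k) (σ.baseVel k Φ)

/-- The elements of `T^k E*` which project to `v` in `T^k M`. -/
def VBData.dualVel (σ : VBData M E D) (k : ℕ) (v : iterT k M) : Set (iterT k D) :=
  {Ψ | Ψ ∈ Vel k (univ : Set D) ∧ iterMap k σ.pD Ψ = v}

/-- The base point in `N` of an element of `T^{(k)} N`. -/
def pt {N : Mfd.{u}} (k : ℕ) (X : iterT k N) : N := trunc k 0 (Nat.zero_le k) X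

/-- `u` is the value `Υ_{k,σ}(Φ)`: it lies over `τ^{2k}(v^{2k})` and
`⟨u, ξ⟩_σ = ⟨Φ~, j^k ξ⟩_{T^{(k)}σ}` for each `j^k ξ` in `T^k E*` over `v^k`. -/
def VBData.IsUpsilon (σ : VBData M E D) (k : ℕ) (Φ : iterT k (iterT k E)) (u : E) : Prop :=
  σ.pE u = σ.basePt k Φ ∧
    ∀ Ψ ∈ σ.dualVel k (σ.baseVel k Φ), σ.pair (pt k Ψ) u = (σ.iter k).pair Ψ (σ.tilde k Φ)

open Classical in
/-- The map `Υ_{k,σ}` (with a junk value where its defining property cannot be met). -/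
def VBData.upsilon (σ : VBData M E D) (k : ℕ) (Φ : iterT k (iterT k E)) : E :=
  if h : ∃ u, σ.IsUpsilon k Φ u then h.choose else pt k (pt (N := iterT k E) k Φ)

/-- `Y = P_k(X)`, for the projection `P_k` from the semi-holonomic part of `T^{(k)} E` to `T^k E`:
`Y` lies in `T^k E` over the same `v^k` as `X`, and
`⟨Y, Ψ⟩_{T^k σ} = ⟨X, Ψ⟩_{T^{(k)} σ}` for each `Ψ` in `T^k E*` over `v^k`. -/
def VBData.IsP (σ : VBData M E D) (k : ℕ) (X Y : iterT k E) : Prop :=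
  Y ∈ Vel k (univ : Set E) ∧ iterMap k σ.pE Y = iterMap k σ.pE X ∧
    ∀ Ψ ∈ σ.dualVel k (iterMap k σ.pE X), (σ.iter k).pair Ψ Y = (σ.iter k).pair Ψ X

open Classical in
/-- The projection `P_k` (with a junk value where its defining property cannot be met). -/
def VBData.P (σ : VBData M E D) (k : ℕ) (X : iterT k E) : iterT k E :=
  if h : ∃ Y, σ.IsP k X Y then h.choose else X

/-- `∑_{j=0}^k (-1)^j C(k+1,j+1) Φ^{(j,k-j)}`. -/
def VBData.hat (σ : VBData M E D) (k : ℕ) (Φ : iterT k (iterT k E)) : iterT k E :=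
  σ.combine k (fun j => (-1) ^ j * ((k + 1).choose (j + 1) : ℝ)) Φ

/-- The momentum map `Π_{k,σ}`. -/
def VBData.momentum (σ : VBData M E D) (k : ℕ) (Φ : iterT k (iterT k E)) : iterT k E :=
  σ.P k (σ.hat k Φ)

/-- The graph of `ν_E`, the projection to `E` from `TE|_M ≅ E ×_M TM`, where `TE|_M` consists of
the vectors tangent to `E` at the zero section; the isomorphism takes `(e, v)` to the velocity at
`t = 0` of `t ↦ t · c(t)`, for any curve `c` in `E` with `c(0) = e` and `(σ ∘ c)'(0) = v`. -/
def VBData.IsNu (σ : VBData M E D) (w : E.T) (e : E) : Prop :=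
  ∃ c : ℝ → E, SmoothCurve E c ∧ c 0 = e ∧ vel (fun t => σ.smul t (c t)) 0 = w

/-- The smooth functions on `E` over `U` which are linear on the fibres, such as the fibre
coordinates `y^i` of a local linear coordinate system over `U`. -/
structure VBData.IsFibreLinear (σ : VBData M E D) (U : Set M) (y : E → ℝ) : Prop where
  smooth : ContMDiffOn E.I 𝓘(ℝ, ℝ) ∞ y (σ.pE ⁻¹' U)
  map_add : ∀ a b, σ.pE a ∈ U → σ.pE a = σ.pE b → y (σ.add a b) = y a + y b
  map_smul : ∀ (r : ℝ) (a), σ.pE a ∈ U → y (σ.smul r a) = r * y a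

/-- `F`, defined on `S ⊂ E`, is a morphism to `σ'` of the vector bundle obtained by restricting `σ`
to `S`, and it covers `f`: it is smooth on the submanifold `S`, covers `f`, and is linear on
fibres. -/
structure VBData.IsMorphismOn {M' E' D' : Mfd.{u}} (σ : VBData M E D) (S : Set E)
    (σ' : VBData M' E' D') (F : E → E') (f : M → M') : Prop where
  smooth : ContMDiffOn E.I E'.I ∞ F S
  covers : ∀ a ∈ S, σ'.pE (F a) = f (σ.pE a)
  map_add : ∀ a ∈ S, ∀ b ∈ S, σ.pE a = σ.pE b →
    σ.add a b ∈ S ∧ F (σ.add a b) = σ'.add (F a) (F b)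
  map_smul : ∀ (r : ℝ), ∀ a ∈ S, σ.smul r a ∈ S ∧ F (σ.smul r a) = σ'.smul r (F a)

end

noncomputable section

open Filter Topology

/-! The theorem is local over M, and in a trivialization it becomes calculus in two real variables.
Let Φ be semi-holonomic over a chart domain. Then Φ is the jet at the origin of a smooth family g(t,
s) lying over x(t + s) for a single curve x in M (`IsRep`, `IsRep.exists_of_mem`). A k-velocity of
E* over v^k is the jet of a curve ξ over the same x (`FibreChart.exists_jet_over`). Put P(t, s) =
⟨ξ(t + s), g(t, s)⟩. Since j^k ξ is also the jet of the family ξ(t + s) of any bidegree (j, k - j),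
its pairing with Φ^{(j,k-j)} is ∂_t^j ∂_s^{k-j} P at the origin (`VBChart.pair_part`). A combination
of the parts of Φ therefore acts on P as a homogeneous polynomial in a = ∂_t and b = ∂_s.

For Φ~ this polynomial is (b - a)^k, the k-th derivative along the antidiagonal r ↦ (-r, r). There t
+ s = 0, so ξ(t + s) is frozen at ξ(0) and only the fibre coordinates y of g are differentiated: the
value is ⟨ξ(0), (b - a)^k y⟩ (`upsCoef_dd`, `upsCoef_pairing`). This gives the independence of the
jet of ξ, the map Υ and its coordinate formula. Writing (b - a)^{k+1} as (b - a) times (b - a)^k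
gives the recurrence for Υ (`upsCoef_succ`).

For Π the polynomial is h_k = Σ_j (-1)^j C(k+1, j+1) a^j b^{k-j}, that is, a h_k = b^{k+1} - (b -
a)^{k+1}. By the Leibniz rule, any homogeneous operator of order k applied to P has the form of the
k-th derivative of a pairing ⟨ξ(t), z(t)⟩ for some curve z over x (`projCoef_pairing`). The
derivatives of z of order at most k are determined because the pairing is nondegenerate and binomial
coefficients do not vanish (`VBChart.isP_iff`). The recurrence for Π is h_{k+1} = (b - a)^{k+1} + b
h_k, and integration by parts is b^{k+1} = (b - a)^{k+1} + a h_k (`hatCoef_recurrence`,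
`hatCoef_parts`); the extra factor b or a comes from passing to the tangent lift in s or in t.

Charts lift to Tσ (`VBChart.T`), so all this also applies to Tσ and TTσ. Naturality under T holds
because the coordinate formulas are linear in the fibre coordinates, hence commute with the
derivative in a third parameter (`VBChart.exists_flip`). Splittings and flips are functions, not
just relations, because both sides carry the same partial derivatives (`isSplit_unique`,
`isFlip₂_unique`). -/

instance Mfd.boundaryless_T (N : Mfd.{u}) [N.I.Boundaryless] : N.T.I.Boundaryless :=
  inferInstanceAs (N.I.prod 𝓘(ℝ, N.V)).Boundaryless

instance Mfd.boundaryless_iterT (N : Mfd.{u}) [N.I.Boundaryless] :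
    ∀ k, (iterT k N).I.Boundaryless
  | 0 => ‹_›
  | k + 1 => @Mfd.boundaryless_T _ (Mfd.boundaryless_iterT N k)

/-! ### Tangent maps, velocities and jets of curves. -/

section TangentMap

variable {N N' N'' : Mfd.{u}}

theorem contMDiff_base : ContMDiff N.T.I N.I ∞ (Mfd.base (N := N)) := by
  have h : ContMDiff N.I.tangent N.I ∞ (Bundle.TotalSpace.proj : TangentBundle N.I N → N) :=
    Bundle.contMDiff_proj (TangentSpace N.I : N → Type u)
  exact h

theorem contMDiff_tmap {f : N → N'} (hf : ContMDiff N.I N'.I ∞ f) :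
    ContMDiff N.T.I N'.T.I ∞ (tmap f) :=
  ContMDiff.contMDiff_tangentMap hf le_rfl

theorem contMDiffOn_tmap {f : N → N'} {O : Set N} (hO : IsOpen O)
    (hf : ContMDiffOn N.I N'.I ∞ f O) :
    ContMDiffOn N.T.I N'.T.I ∞ (tmap f) (Mfd.base ⁻¹' O) := by
  have h := ContMDiffOn.contMDiffOn_tangentMapWithin (m := ∞) hf le_rfl hO.uniqueMDiffOn
  refine h.congr ?_
  intro w hw
  exact (tangentMapWithin_eq_tangentMap (hO.uniqueMDiffOn _ hw)
    ((hf.contMDiffAt (hO.mem_nhds hw)).mdifferentiableAt (by simp))).symm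

theorem tmap_comp {g : N' → N''} {f : N → N'} (w : N.T)
    (hg : MDifferentiableAt N'.I N''.I g (f (Mfd.base w)))
    (hf : MDifferentiableAt N.I N'.I f (Mfd.base w)) :
    tmap (fun n => g (f n)) w = tmap g (tmap f w) :=
  tangentMap_comp_at w hg hf

theorem tmap_congr {f g : N → N'} (w : N.T) (h : f =ᶠ[𝓝 (Mfd.base w)] g) :
    tmap f w = tmap g w := by
  have h1 := h.mfderiv_eq (I := N.I) (I' := N'.I)
  have h2 := h.eq_of_nhds
  rcases w with ⟨b, v⟩
  change (⟨f b, _⟩ : TangentBundle N'.I N') = ⟨g b, _⟩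
  change f b = g b at h2
  refine Bundle.TotalSpace.ext h2 ?_
  change HEq (mfderiv N.I N'.I f b v) (mfderiv N.I N'.I g b v)
  exact heq_of_eq (congrArg (fun A : N.V →L[ℝ] N'.V => A v) h1)

theorem tmap_id (w : N.T) : tmap (fun n : N => n) w = w := by
  have : tangentMap N.I N.I (id : N → N) = id := tangentMap_id
  exact congrFun this w

theorem vel_comp {f : N → N'} {c : ℝ → N} (t : ℝ)
    (hf : MDifferentiableAt N.I N'.I f (c t)) (hc : MDifferentiableAt 𝓘(ℝ, ℝ) N.I c t) :
    vel (fun t => f (c t)) t = tmap f (vel c t) := by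
  have := mfderiv_comp_apply (I := 𝓘(ℝ, ℝ)) (I' := N.I) (I'' := N'.I) t hf hc (1 : ℝ)
  change (⟨f (c t), mfderiv 𝓘(ℝ, ℝ) N'.I (f ∘ c) t (1 : ℝ)⟩ : TangentBundle N'.I N') = ⟨_, _⟩
  rw [this]; rfl

theorem base_vel (c : ℝ → N) (t : ℝ) : Mfd.base (vel c t) = c t := rfl

theorem vel_congr {c c' : ℝ → N} {t : ℝ} (h : c =ᶠ[𝓝 t] c') : vel c t = vel c' t := by
  have h1 := h.mfderiv_eq (I := 𝓘(ℝ, ℝ)) (I' := N.I)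
  refine Bundle.TotalSpace.ext h.eq_of_nhds ?_
  change HEq (mfderiv 𝓘(ℝ, ℝ) N.I c t (1 : ℝ)) (mfderiv 𝓘(ℝ, ℝ) N.I c' t (1 : ℝ))
  exact heq_of_eq (congrArg (fun A : ℝ →L[ℝ] N.V => A 1) h1)

/-- Precomposition of a curve with a smooth function does not need a chart. -/
theorem vel_comp_real {c : ℝ → N} {f : ℝ → ℝ} {t f' : ℝ} (hf : HasDerivAt f f' t)
    (hf' : f' = 1) (hc : MDifferentiableAt 𝓘(ℝ, ℝ) N.I c (f t)) :
    vel (fun t => c (f t)) t = vel c (f t) := by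
  subst hf'
  have := mfderiv_comp_apply (I := 𝓘(ℝ, ℝ)) (I' := 𝓘(ℝ, ℝ)) (I'' := N.I) t hc
    hf.differentiableAt.mdifferentiableAt (1 : ℝ)
  change (⟨c (f t), mfderiv 𝓘(ℝ, ℝ) N.I (c ∘ f) t (1 : ℝ)⟩ : TangentBundle N.I N) = ⟨_, _⟩
  rw [this]
  have h2 : mfderiv 𝓘(ℝ, ℝ) 𝓘(ℝ, ℝ) f t (1 : ℝ) = (1 : ℝ) := by
    rw [mfderiv_eq_fderiv]; exact hf.deriv
  refine Bundle.TotalSpace.ext rfl (heq_of_eq ?_)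
  exact congrArg (mfderiv 𝓘(ℝ, ℝ) N.I c (f t)) h2

/-- The velocity of a smooth family of curves is a smooth family. -/
theorem contMDiff_vel_family {X : Type*} [NormedAddCommGroup X] [NormedSpace ℝ X]
    {g : X → ℝ → N} (hg : ContMDiff 𝓘(ℝ, X × ℝ) N.I ∞ (fun p : X × ℝ => g p.1 p.2)) :
    ContMDiff 𝓘(ℝ, X × ℝ) N.T.I ∞ (fun p : X × ℝ => vel (g p.1) p.2) := by
  have h1 := ContMDiff.contMDiff_tangentMap (m := ∞) hg le_rfl
  -- The slice t ↦ (x, t) has velocity (0, 1), so the family of velocities is the tangent map of g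
  -- along this constant vector field.
  have h2 : ContMDiff 𝓘(ℝ, X × ℝ) 𝓘(ℝ, X × ℝ).tangent ∞
      (fun p : X × ℝ => (⟨p, ((0 : X), (1 : ℝ))⟩ : TangentBundle 𝓘(ℝ, X × ℝ) (X × ℝ))) := by
    have := (contMDiff_vectorSpace_iff_contDiff (𝕜 := ℝ) (E := X × ℝ) (n := ∞)
      (V := fun _ => ((0 : X), (1 : ℝ)))).2 contDiff_const
    exact this
  refine (h1.comp h2).congr ?_
  rintro ⟨x, t⟩
  have h3 := mfderiv_comp_apply (I := 𝓘(ℝ, ℝ)) (I' := 𝓘(ℝ, X × ℝ)) (I'' := N.I)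
    (f := fun s : ℝ => (x, s)) (g := fun p : X × ℝ => g p.1 p.2) t
    ((hg (x, t)).mdifferentiableAt (by simp))
    (by apply DifferentiableAt.mdifferentiableAt; fun_prop) (1 : ℝ)
  refine Bundle.TotalSpace.ext rfl (heq_of_eq ?_)
  refine h3.trans ?_
  have h4 : mfderiv 𝓘(ℝ, ℝ) 𝓘(ℝ, X × ℝ) (fun s : ℝ => (x, s)) t (1 : ℝ) = ((0 : X), (1 : ℝ)) := by
    rw [mfderiv_eq_fderiv]
    exact ((hasDerivAt_const t x).prodMk (hasDerivAt_id t)).deriv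
  exact congrArg (mfderiv 𝓘(ℝ, X × ℝ) N.I (fun p : X × ℝ => g p.1 p.2) (x, t)) h4

/-- A curve is a family that ignores an auxiliary real parameter, so the result for families
applies. -/
theorem SmoothCurve.vel {c : ℝ → N} (hc : SmoothCurve N c) : SmoothCurve N.T (vel c) := by
  have h : ContMDiff 𝓘(ℝ, ℝ × ℝ) N.I ∞ (fun p : ℝ × ℝ => c p.2) :=
    ContMDiff.comp hc (contDiff_snd.contMDiff)
  have h2 := contMDiff_vel_family (g := fun _ : ℝ => c) h
  exact h2.comp (f := fun t : ℝ => ((0 : ℝ), t))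
    ((contDiff_const.prodMk contDiff_id).contMDiff)

theorem SmoothCurve.mdiff {c : ℝ → N} (hc : SmoothCurve N c) (t : ℝ) :
    MDifferentiableAt 𝓘(ℝ, ℝ) N.I c t := (hc t).mdifferentiableAt (by simp)

theorem SmoothCurve.jet {c : ℝ → N} (hc : SmoothCurve N c) :
    ∀ k, SmoothCurve (iterT k N) (jet k c)
  | 0 => hc
  | k + 1 => (SmoothCurve.jet hc k).vel

theorem contMDiff_jet_family {X : Type*} [NormedAddCommGroup X] [NormedSpace ℝ X]
    {g : X → ℝ → N} (hg : ContMDiff 𝓘(ℝ, X × ℝ) N.I ∞ (fun p : X × ℝ => g p.1 p.2)) :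
    ∀ k, ContMDiff 𝓘(ℝ, X × ℝ) (iterT k N).I ∞ (fun p : X × ℝ => jet k (g p.1) p.2)
  | 0 => hg
  | k + 1 => contMDiff_vel_family (g := fun x => jet k (g x)) (contMDiff_jet_family hg k)

theorem contMDiff_jet_param {X : Type*} [NormedAddCommGroup X] [NormedSpace ℝ X]
    {g : X → ℝ → N} (hg : ContMDiff 𝓘(ℝ, X × ℝ) N.I ∞ (fun p : X × ℝ => g p.1 p.2)) (k : ℕ)
    (s : ℝ) : ContMDiff 𝓘(ℝ, X) (iterT k N).I ∞ (fun x : X => jet k (g x) s) :=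
  (contMDiff_jet_family hg k).comp (f := fun x : X => (x, s))
    ((contDiff_id.prodMk contDiff_const).contMDiff)

/-- Equality near t, and not only at t, is what allows another velocity to be taken in the
induction. -/
theorem jet_congr {c c' : ℝ → N} {t : ℝ} (k : ℕ) (h : c =ᶠ[𝓝 t] c') :
    jet k c =ᶠ[𝓝 t] jet k c' := by
  induction k with
  | zero => exact h
  | succ k ih => exact ih.eventuallyEq_nhds.mono fun s hs => vel_congr hs

theorem jet_congr_at {c c' : ℝ → N} {t : ℝ} (k : ℕ) (h : c =ᶠ[𝓝 t] c') :
    jet k c t = jet k c' t := (jet_congr k h).eq_of_nhds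

theorem jet_add {c : ℝ → N} (hc : SmoothCurve N c) (k : ℕ) (a : ℝ) :
    jet k (fun s => c (s + a)) = fun s => jet k c (s + a) := by
  induction k with
  | zero => rfl
  | succ k ih =>
    funext t
    change vel (jet k (fun s => c (s + a))) t = vel (jet k c) (t + a)
    rw [ih]
    exact vel_comp_real (f := fun s => s + a) ((hasDerivAt_id t).add_const a) rfl
      ((hc.jet k).mdiff _)

theorem contMDiff_iterMap {f : N → N'} (hf : ContMDiff N.I N'.I ∞ f) :
    ∀ k, ContMDiff (iterT k N).I (iterT k N').I ∞ (iterMap k f)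
  | 0 => hf
  | k + 1 => contMDiff_tmap (contMDiff_iterMap hf k)

/-- The chain rule `vel_comp` at each level; the induction must hold for all t because the next
level differentiates in t. -/
theorem iterMap_jet {f : N → N'} (hf : ContMDiff N.I N'.I ∞ f) {c : ℝ → N}
    (hc : SmoothCurve N c) (k : ℕ) (t : ℝ) :
    iterMap k f (jet k c t) = jet k (fun t => f (c t)) t := by
  induction k generalizing t with
  | zero => rfl
  | succ k ih =>
    change tmap (iterMap k f) (vel (jet k c) t) = vel (jet k (fun t => f (c t))) t
    rw [← funext ih]
    exact (vel_comp t ((contMDiff_iterMap hf k _).mdifferentiableAt (by simp))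
      ((hc.jet k).mdiff t)).symm

end TangentMap

/-! ### Projections and identifications of iterated tangent bundles. -/

section Casts

variable {N : Mfd.{u}}

theorem Mfd.contMDiff_cast {A B : Mfd.{u}} (h : A = B) :
    ContMDiff A.I B.I ∞ (Mfd.cast h) := by
  subst h; exact contMDiff_id

theorem Mfd.cast_jet {A B : Mfd.{u}} (h : A = B) (k : ℕ) (c : ℝ → A) (t : ℝ) :
    Mfd.cast (congrArg (iterT k) h) (jet k c t) = jet k (fun t => Mfd.cast h (c t)) t := by
  subst h; rfl

theorem Mfd.cast_vel {A B : Mfd.{u}} (h : A = B) (c : ℝ → A) (t : ℝ) :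
    Mfd.cast (congrArg Mfd.T h) (vel c t) = vel (fun t => Mfd.cast h (c t)) t := by
  subst h; rfl

theorem Mfd.cast_cast {A B C : Mfd.{u}} (h : A = B) (h' : B = C) (x : A) :
    Mfd.cast h' (Mfd.cast h x) = Mfd.cast (h.trans h') x := by
  subst h; rfl

theorem contMDiff_trunc : ∀ (k m : ℕ) (h : m ≤ k),
    ContMDiff (iterT k N).I (iterT m N).I ∞ (trunc (N := N) k m h)
  | 0, m, h => Mfd.contMDiff_cast (congrArg (fun i => iterT i N) (Nat.le_zero.mp h).symm)
  | k + 1, m, h => by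
    by_cases h' : k + 1 = m
    · have : trunc (N := N) (k + 1) m h = Mfd.cast (congrArg (fun i => iterT i N) h') := by
        funext x; rw [trunc, dif_pos h']
      rw [this]; exact Mfd.contMDiff_cast _
    · have : trunc (N := N) (k + 1) m h =
          fun x => trunc k m (by omega) (Mfd.base (N := iterT k N) x) := by
        funext x; rw [trunc, dif_neg h']
      rw [this]
      exact (contMDiff_trunc k m _).comp contMDiff_base

theorem trunc_jet (c : ℝ → N) (t : ℝ) : ∀ (k m : ℕ) (h : m ≤ k),
    trunc k m h (jet k c t) = jet m c t
  | 0, m, h => by obtain rfl : m = 0 := Nat.le_zero.mp h; rfl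
  | k + 1, m, h => by
    by_cases h' : k + 1 = m
    · subst h'; rw [trunc, dif_pos rfl]; rfl
    · rw [trunc, dif_neg h']
      exact trunc_jet c t k m _

theorem pt_jet (c : ℝ → N) (t : ℝ) (k : ℕ) : pt k (jet k c t) = c t := trunc_jet c t k 0 _

theorem contMDiff_pt (k : ℕ) : ContMDiff (iterT k N).I N.I ∞ (pt (N := N) k) :=
  contMDiff_trunc k 0 _

theorem pt_succ (k : ℕ) (x : iterT (k + 1) N) :
    pt (k + 1) x = pt k (Mfd.base (N := iterT k N) x) := by
  unfold pt; rw [trunc, dif_neg (by omega)]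

theorem pt_iterMap {N' : Mfd.{u}} (f : N → N') (k : ℕ) (x : iterT k N) :
    pt k (iterMap k f x) = f (pt k x) := by
  induction k with
  | zero => rfl
  | succ k ih => rw [pt_succ, pt_succ, ← ih]; rfl

/-- The cast passes through the outermost velocity, so the curves inside it can be identified one
level at a time. -/
theorem merge_jet {m n k : ℕ} (h : m + n = k) (c : ℝ → N) (t : ℝ) :
    merge h (jet m (jet n c) t) = jet k c t := by
  induction m generalizing k t with
  | zero =>
    obtain rfl : n = k := by omega
    rfl
  | succ m ih =>
    obtain ⟨j, rfl⟩ : ∃ j, k = j + 1 := ⟨m + n, by omega⟩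
    have h' : m + n = j := by omega
    change Mfd.cast (congrArg Mfd.T (iterT_iterT N h')) (vel (jet m (jet n c)) t) = _
    rw [Mfd.cast_vel (iterT_iterT N h')]
    exact congrArg (fun f => vel f t) (funext (ih h'))

/-- The two iterated tangent maps live on manifolds that are only propositionally equal. They are
compared by `HEq`, which the tangent functor preserves; substituting the equalities of manifolds
then makes the casts trivial. -/
theorem merge_iterMap {N' : Mfd.{u}} (f : N → N') {m n k : ℕ} (h : m + n = k)
    (X : iterT m (iterT n N)) :
    iterMap k f (merge h X) = merge h (iterMap m (iterMap n f) X) := by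
  have key : ∀ (A B : Mfd.{u}) (A' B' : Mfd.{u}) (a : A = A') (b : B = B')
      (F : A → B) (G : A' → B'), HEq F G → ∀ x, G (Mfd.cast a x) = Mfd.cast b (F x) := by
    intro A B A' B' a b F G hFG x
    subst a; subst b; cases hFG; rfl
  have keyT : ∀ (A B : Mfd.{u}) (A' B' : Mfd.{u}) (a : A = A') (b : B = B')
      (F : A → B) (G : A' → B'), HEq F G → HEq (tmap F) (tmap G) := by
    intro A B A' B' a b F G hFG
    subst a; subst b; cases hFG; rfl
  have hh : HEq (iterMap m (iterMap n f)) (iterMap k f) := by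
    clear X
    subst h
    induction m with
    | zero => rw [Nat.zero_add]; rfl
    | succ m ih =>
      rw [Nat.succ_add]
      exact keyT _ _ _ _ (iterT_iterT N rfl) (iterT_iterT N' rfl) _ _ ih
  exact key _ _ _ _ _ _ _ _ hh X

end Casts

/-! ### Mixed partial derivatives, Leibniz rule and Taylor polynomials. -/

section Calculus

variable {X W W' : Type*} [NormedAddCommGroup X] [NormedSpace ℝ X]
  [NormedAddCommGroup W] [NormedSpace ℝ W] [NormedAddCommGroup W'] [NormedSpace ℝ W']

/-- The directional derivative. -/
def dirD (v : X) (f : X → W) (x : X) : W := fderiv ℝ f x v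

theorem ContDiff.dirD {f : X → W} (hf : ContDiff ℝ ∞ f) (v : X) : ContDiff ℝ ∞ (dirD v f) :=
  (hf.fderiv_right (m := ∞) le_rfl).clm_apply contDiff_const

theorem ContDiff.dirD_iterate {f : X → W} (hf : ContDiff ℝ ∞ f) (v : X) (n : ℕ) :
    ContDiff ℝ ∞ ((_root_.dirD v)^[n] f) := by
  induction n generalizing f with
  | zero => exact hf
  | succ n ih => exact ih (hf.dirD v)

theorem dirD_comm {f : X → W} (hf : ContDiff ℝ ∞ f) (v w : X) :
    dirD v (dirD w f) = dirD w (dirD v f) := by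
  funext x
  have h1 : DifferentiableAt ℝ (fderiv ℝ f) x :=
    ((hf.fderiv_right (m := ∞) le_rfl).differentiable (by simp)) x
  have key : ∀ v w : X, dirD v (dirD w f) x = fderiv ℝ (fderiv ℝ f) x v w := by
    intro v w
    have := h1.hasFDerivAt.clm_apply (hasFDerivAt_const w x)
    change fderiv ℝ (fun x => fderiv ℝ f x w) x v = _
    rw [this.fderiv]
    simp
  rw [key, key]
  exact (hf.contDiffAt.isSymmSndFDerivAt (by simpa using (ENat.LEInfty.out : (2 : ℕ∞ω) ≤ ∞))).eq v w

theorem hasDerivAt_line {f : X → W} (hf : ContDiff ℝ ∞ f) (x v : X) (r : ℝ) :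
    HasDerivAt (fun r : ℝ => f (x + r • v)) (dirD v f (x + r • v)) r := by
  have h1 : HasDerivAt (fun r : ℝ => x + r • v) v r := by
    simpa using ((hasDerivAt_id r).smul_const v).const_add x
  exact ((hf.differentiable (by simp)) _).hasFDerivAt.comp_hasDerivAt r h1

theorem iteratedDeriv_line {f : X → W} (hf : ContDiff ℝ ∞ f) (x v : X) (n : ℕ) (r : ℝ) :
    iteratedDeriv n (fun r : ℝ => f (x + r • v)) r = (dirD v)^[n] f (x + r • v) := by
  induction n generalizing f with
  | zero => simp
  | succ n ih =>
    rw [iteratedDeriv_succ', show deriv (fun r : ℝ => f (x + r • v)) =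
      fun r => dirD v f (x + r • v) from funext fun r => (hasDerivAt_line hf x v r).deriv,
      ih (hf.dirD v)]
    rfl

theorem dirD_iterate_comm {f : X → W} (hf : ContDiff ℝ ∞ f) (v w : X) (n : ℕ) :
    dirD v ((dirD w)^[n] f) = (dirD w)^[n] (dirD v f) := by
  induction n generalizing f with
  | zero => rfl
  | succ n ih => rw [Function.iterate_succ_apply, ih (hf.dirD w), dirD_comm hf]; rfl

variable (X W) in
/-- The smooth functions `X → W`. -/
def smoothSub : Submodule ℝ (X → W) where
  carrier := {f | ContDiff ℝ ∞ f}
  add_mem' {f g} (h : ContDiff ℝ ∞ f) (h' : ContDiff ℝ ∞ g) := ContDiff.add h h'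
  zero_mem' := (contDiff_const : ContDiff ℝ ∞ fun _ : X => (0 : W))
  smul_mem' c f (h : ContDiff ℝ ∞ f) := (contDiff_const (c := c)).smul h

theorem smoothSub.contDiff (f : smoothSub X W) : ContDiff ℝ ∞ f.1 := f.2

/-- The directional derivative on smooth functions. -/
def dirEnd (v : X) : Module.End ℝ (smoothSub X W) where
  toFun f := ⟨dirD v f.1, (smoothSub.contDiff f).dirD v⟩
  map_add' f g := by
    ext x
    have := fderiv_add (((smoothSub.contDiff f).differentiable (by simp)) x)
      (((smoothSub.contDiff g).differentiable (by simp)) x)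
    exact congrArg (fun A : X →L[ℝ] W => A v) this
  map_smul' c f := by
    ext x
    have := fderiv_const_smul (((smoothSub.contDiff f).differentiable (by simp)) x) c
    exact congrArg (fun A : X →L[ℝ] W => A v) this

theorem dirEnd_pow (v : X) (n : ℕ) (f : smoothSub X W) :
    ((dirEnd v ^ n) f).1 = (dirD v)^[n] f.1 := by
  induction n generalizing f with
  | zero => rfl
  | succ n ih => rw [pow_succ, Module.End.mul_apply, ih]; rfl

/-- Directional derivatives are commuting endomorphisms of the space of smooth functions, so this is
the binomial theorem `Commute.add_pow`. -/
theorem dirD_iterate_add {f : X → W} (hf : ContDiff ℝ ∞ f) (v w : X) (ε : ℝ) (n : ℕ) (x : X) :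
    (dirD (ε • v + w))^[n] f x = ∑ m ∈ Finset.range (n + 1),
      (ε ^ m * (n.choose m : ℝ)) • (dirD v)^[m] ((dirD w)^[n - m] f) x := by
  have hc : Commute (ε • dirEnd v : Module.End ℝ (smoothSub X W)) (dirEnd w) := by
    refine Commute.smul_left ?_ ε
    ext f : 2
    exact dirD_comm f.2 v w
  have hadd : (dirEnd (ε • v + w) : Module.End ℝ (smoothSub X W)) = ε • dirEnd v + dirEnd w := by
    ext f x
    change fderiv ℝ f.1 x (ε • v + w) = ε • fderiv ℝ f.1 x v + fderiv ℝ f.1 x w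
    simp
  have h := dirEnd_pow (ε • v + w) n ⟨f, hf⟩
  rw [← h, hadd, hc.add_pow]
  -- Evaluation at x is written as a linear map, so that it passes through the sum.
  have e : ∀ g : smoothSub X W, g.1 x = (LinearMap.proj x ∘ₗ (smoothSub X W).subtype) g :=
    fun g => rfl
  rw [e, LinearMap.sum_apply, map_sum]
  refine Finset.sum_congr rfl fun m _ => ?_
  rw [← e, smul_pow, smul_mul_assoc, smul_mul_assoc, ← nsmul_eq_mul', LinearMap.smul_apply,
    LinearMap.smul_apply, mul_smul]
  change ε ^ m • (n.choose m • (((dirEnd v ^ m * dirEnd w ^ (n - m) : Module.End ℝ (smoothSub X W))) ⟨f, hf⟩).1 x) = _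
  rw [Module.End.mul_apply, dirEnd_pow, dirEnd_pow, Nat.cast_smul_eq_nsmul]

/-- The mixed partial derivative `∂_t^a ∂_s^b`. -/
def dd (a b : ℕ) (f : ℝ → ℝ → W) (t s : ℝ) : W :=
  iteratedDeriv a (fun t => iteratedDeriv b (f t) s) t

/-- Partial derivatives become powers of directional derivatives along the axes, whose smoothness
and commutation are already known. -/
theorem dd_eq {f : ℝ → ℝ → W} (hf : ContDiff ℝ ∞ (fun p : ℝ × ℝ => f p.1 p.2)) (a b : ℕ)
    (t s : ℝ) : dd a b f t s = (dirD ((1, 0) : ℝ × ℝ))^[a]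
      ((dirD ((0, 1) : ℝ × ℝ))^[b] (fun p : ℝ × ℝ => f p.1 p.2)) (t, s) := by
  have h1 : ∀ t, iteratedDeriv b (f t) s =
      (dirD ((0, 1) : ℝ × ℝ))^[b] (fun p : ℝ × ℝ => f p.1 p.2) (t, s) := by
    intro t
    simpa using iteratedDeriv_line hf (t, 0) (0, 1) b s
  unfold dd
  simp only [h1]
  simpa using iteratedDeriv_line (hf.dirD_iterate (0, 1) b) (0, s) (1, 0) a t

theorem contDiff_dd {f : ℝ → ℝ → W} (hf : ContDiff ℝ ∞ (fun p : ℝ × ℝ => f p.1 p.2)) (a b : ℕ) :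
    ContDiff ℝ ∞ (fun p : ℝ × ℝ => dd a b f p.1 p.2) := by
  simp only [dd_eq hf]
  exact (hf.dirD_iterate _ b).dirD_iterate _ a

theorem dd_zero (f : ℝ → ℝ → W) : dd 0 0 f = f := by
  funext t s; simp [dd]

theorem deriv_dd_left (a b : ℕ) (f : ℝ → ℝ → W) (t s : ℝ) :
    deriv (fun t => dd a b f t s) t = dd (a + 1) b f t s := by
  unfold dd; rw [iteratedDeriv_succ]

theorem dd_deriv_right (a b : ℕ) (f : ℝ → ℝ → W) :
    dd a b (fun t s => deriv (f t) s) = dd a (b + 1) f := by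
  funext t s; unfold dd; simp only [iteratedDeriv_succ']

theorem contDiff_slice_right {f : ℝ → ℝ → W} (hf : ContDiff ℝ ∞ (fun p : ℝ × ℝ => f p.1 p.2))
    (t : ℝ) : ContDiff ℝ ∞ (f t) :=
  hf.comp (f := fun s : ℝ => (t, s)) (by fun_prop)

theorem contDiff_slice_left {f : ℝ → ℝ → W} (hf : ContDiff ℝ ∞ (fun p : ℝ × ℝ => f p.1 p.2))
    (s : ℝ) : ContDiff ℝ ∞ (fun t => f t s) :=
  hf.comp (f := fun t : ℝ => (t, s)) (by fun_prop)

theorem contDiff_iteratedDeriv_slice {f : ℝ → ℝ → W}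
    (hf : ContDiff ℝ ∞ (fun p : ℝ × ℝ => f p.1 p.2)) (b : ℕ) (s : ℝ) :
    ContDiff ℝ ∞ (fun t => iteratedDeriv b (f t) s) := by
  have := contDiff_slice_left (contDiff_dd hf 0 b) s
  simpa [dd] using this

theorem contDiff_deriv_right {f : ℝ → ℝ → W} (hf : ContDiff ℝ ∞ (fun p : ℝ × ℝ => f p.1 p.2)) :
    ContDiff ℝ ∞ (fun p : ℝ × ℝ => deriv (f p.1) p.2) := by
  have := contDiff_dd hf 0 1
  simpa [dd] using this

theorem dirD_left_eq {f : ℝ → ℝ → W} (hf : ContDiff ℝ ∞ (fun p : ℝ × ℝ => f p.1 p.2)) (t s : ℝ) :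
    deriv (fun t => f t s) t = dirD ((1, 0) : ℝ × ℝ) (fun p : ℝ × ℝ => f p.1 p.2) (t, s) := by
  have := (hasDerivAt_line hf (0, s) (1, 0) t).deriv
  simpa using this

theorem contDiff_deriv_left {f : ℝ → ℝ → W} (hf : ContDiff ℝ ∞ (fun p : ℝ × ℝ => f p.1 p.2)) :
    ContDiff ℝ ∞ (fun p : ℝ × ℝ => deriv (fun t => f t p.2) p.1) := by
  simp only [dirD_left_eq hf]; exact hf.dirD _

theorem dd_deriv_left {f : ℝ → ℝ → W} (hf : ContDiff ℝ ∞ (fun p : ℝ × ℝ => f p.1 p.2)) (a b : ℕ) :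
    dd a b (fun t s => deriv (fun t => f t s) t) = dd (a + 1) b f := by
  funext t s
  rw [dd_eq (contDiff_deriv_left hf), dd_eq hf]
  simp only [dirD_left_eq hf]
  rw [Function.iterate_succ_apply, dirD_iterate_comm hf]

/-- The line r ↦ (εr, r) has direction ε(1, 0) + (0, 1), so the power of the corresponding
directional derivative expands binomially. The case ε = -1 yields (∂_s - ∂_t)^n, and ε = 1 yields
the Leibniz rule. -/
theorem iteratedDeriv_diag {f : ℝ → ℝ → W} (hf : ContDiff ℝ ∞ (fun p : ℝ × ℝ => f p.1 p.2))
    (ε : ℝ) (n : ℕ) (r : ℝ) : iteratedDeriv n (fun r => f (ε * r) r) r =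
      ∑ m ∈ Finset.range (n + 1), (ε ^ m * (n.choose m : ℝ)) • dd m (n - m) f (ε * r) r := by
  have h := iteratedDeriv_line hf 0 (ε • (1, 0) + (0, 1)) n r
  rw [dirD_iterate_add hf] at h
  simp only [dd_eq hf]
  simpa [mul_comm] using h

theorem dd3_eq {f : ℝ → ℝ → ℝ → W}
    (hf : ContDiff ℝ ∞ (fun p : ℝ × ℝ × ℝ => f p.1 p.2.1 p.2.2)) (a b : ℕ)
    (t s r : ℝ) : dd a b (fun t s => f t s r) t s = (dirD ((1, 0, 0) : ℝ × ℝ × ℝ))^[a]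
      ((dirD ((0, 1, 0) : ℝ × ℝ × ℝ))^[b] (fun p : ℝ × ℝ × ℝ => f p.1 p.2.1 p.2.2)) (t, s, r) := by
  have h1 : ∀ t, iteratedDeriv b (fun s => f t s r) s =
      (dirD ((0, 1, 0) : ℝ × ℝ × ℝ))^[b] (fun p : ℝ × ℝ × ℝ => f p.1 p.2.1 p.2.2) (t, s, r) := by
    intro t
    simpa using iteratedDeriv_line hf (t, 0, r) (0, 1, 0) b s
  unfold dd
  simp only [h1]
  simpa using iteratedDeriv_line (hf.dirD_iterate (0, 1, 0) b) (0, s, r) (1, 0, 0) a t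

theorem contDiff_deriv_third {f : ℝ → ℝ → ℝ → W}
    (hf : ContDiff ℝ ∞ (fun p : ℝ × ℝ × ℝ => f p.1 p.2.1 p.2.2)) :
    ContDiff ℝ ∞ (fun p : ℝ × ℝ × ℝ => deriv (f p.1 p.2.1) p.2.2) := by
  have h : ∀ t s r, deriv (f t s) r =
      dirD ((0, 0, 1) : ℝ × ℝ × ℝ) (fun p : ℝ × ℝ × ℝ => f p.1 p.2.1 p.2.2) (t, s, r) := by
    intro t s r
    simpa using (hasDerivAt_line hf (t, s, 0) (0, 0, 1) r).deriv
  simp only [h]; exact hf.dirD _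

/-- Mixed partial derivatives in two variables commute with the derivative in the third one. -/
theorem hasDerivAt_dd3 {f : ℝ → ℝ → ℝ → W}
    (hf : ContDiff ℝ ∞ (fun p : ℝ × ℝ × ℝ => f p.1 p.2.1 p.2.2)) (a b : ℕ) (t s r : ℝ) :
    HasDerivAt (fun r => dd a b (fun t s => f t s r) t s)
      (dd a b (fun t s => deriv (f t s) r) t s) r := by
  have h := hasDerivAt_line ((hf.dirD_iterate (0, 1, 0) b).dirD_iterate (1, 0, 0) a) (t, s, 0)
    (0, 0, 1) r
  have hd : ∀ t s r, deriv (f t s) r =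
      dirD ((0, 0, 1) : ℝ × ℝ × ℝ) (fun p : ℝ × ℝ × ℝ => f p.1 p.2.1 p.2.2) (t, s, r) := by
    intro t s r
    simpa using (hasDerivAt_line hf (t, s, 0) (0, 0, 1) r).deriv
  rw [dd3_eq (f := fun t s r => deriv (f t s) r) (contDiff_deriv_third hf)]
  simp only [dd3_eq hf, hd]
  rw [← dirD_iterate_comm hf, ← dirD_iterate_comm (hf.dirD_iterate _ _)]
  simpa using h

theorem ContDiff.iteratedDeriv_top {f : ℝ → W} (hf : ContDiff ℝ ∞ f) (n : ℕ) :
    ContDiff ℝ ∞ (iteratedDeriv n f) := by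
  have h : iteratedDeriv n f = (_root_.dirD (1 : ℝ))^[n] f := by
    funext r; simpa using iteratedDeriv_line hf 0 1 n r
  rw [h]; exact hf.dirD_iterate _ _

theorem iteratedDeriv_clm (A : W →L[ℝ] W') {f : ℝ → W} (hf : ContDiff ℝ ∞ f) (n : ℕ) :
    iteratedDeriv n (fun t => A (f t)) = fun t => A (iteratedDeriv n f t) := by
  induction n generalizing f with
  | zero => simp
  | succ n ih =>
    have h : deriv (fun t => A (f t)) = fun t => A (deriv f t) := by
      funext t
      exact (A.hasFDerivAt.comp_hasDerivAt t ((hf.differentiable (by simp)) t).hasDerivAt).deriv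
    rw [iteratedDeriv_succ', h, ih (by simpa using hf.iteratedDeriv_top 1), iteratedDeriv_succ']

theorem dd_clm (A : W →L[ℝ] W') {f : ℝ → ℝ → W}
    (hf : ContDiff ℝ ∞ (fun p : ℝ × ℝ => f p.1 p.2)) (a b : ℕ) (t s : ℝ) :
    dd a b (fun t s => A (f t s)) t s = A (dd a b f t s) := by
  unfold dd
  have h1 : ∀ t, iteratedDeriv b (fun s => A (f t s)) s = A (iteratedDeriv b (f t) s) := by
    intro t
    rw [iteratedDeriv_clm A (contDiff_slice_right hf t)]
  simp only [h1]
  rw [iteratedDeriv_clm A (contDiff_iteratedDeriv_slice hf b s)]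

theorem iteratedDeriv_add_exp (f : ℝ → W) (m n : ℕ) :
    iteratedDeriv m (iteratedDeriv n f) = iteratedDeriv (m + n) f := by
  simp only [iteratedDeriv_eq_iterate, Function.iterate_add_apply]

/-- The Leibniz rule for a bilinear map. -/
theorem iteratedDeriv_bilin {G F : Type*} [NormedAddCommGroup G] [NormedSpace ℝ G]
    [NormedAddCommGroup F] [NormedSpace ℝ F] (B : G →L[ℝ] F →L[ℝ] W) {u : ℝ → G} {v : ℝ → F}
    (hu : ContDiff ℝ ∞ u) (hv : ContDiff ℝ ∞ v) (n : ℕ) (r : ℝ) :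
    iteratedDeriv n (fun r => B (u r) (v r)) r = ∑ m ∈ Finset.range (n + 1),
      (n.choose m : ℝ) • B (iteratedDeriv (n - m) u r) (iteratedDeriv m v r) := by
  -- Let u and v depend on different variables and restrict to the diagonal: the binomial expansion
  -- there is already the Leibniz formula.
  have hf : ContDiff ℝ ∞ (fun p : ℝ × ℝ => B (u p.2) (v p.1)) :=
    (B.contDiff.comp (hu.comp contDiff_snd)).clm_apply (hv.comp contDiff_fst)
  have h := iteratedDeriv_diag (f := fun t s => B (u s) (v t)) hf 1 n r
  simp only [one_mul, one_pow] at h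
  rw [h]
  refine Finset.sum_congr rfl fun m _ => ?_
  congr 1
  unfold dd
  have h1 : ∀ t, iteratedDeriv (n - m) (fun s => B (u s) (v t)) r =
      B (iteratedDeriv (n - m) u r) (v t) := fun t => by
    exact congrFun (iteratedDeriv_clm (B.flip (v t)) hu (n - m)) r
  simp only [h1]
  rw [iteratedDeriv_clm _ hv]

/-- The Taylor polynomial with coefficients `c b / b!`. -/
def tpoly (k : ℕ) (c : ℕ → W) (s : ℝ) : W :=
  ∑ b ∈ Finset.range (k + 1), (s ^ b / (b.factorial : ℝ)) • c b

theorem contDiff_tpoly (k : ℕ) {c : X → ℕ → W} (hc : ∀ i ≤ k, ContDiff ℝ ∞ (fun x => c x i)) :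
    ContDiff ℝ ∞ (fun p : X × ℝ => tpoly k (c p.1) p.2) := by
  unfold tpoly
  refine ContDiff.sum fun b hb => ?_
  refine ContDiff.smul ?_ ((hc b (by simpa [Nat.lt_succ_iff] using hb)).comp contDiff_fst)
  exact (contDiff_snd.pow b).div_const _

theorem contDiff_tpoly_const (k : ℕ) (c : ℕ → W) : ContDiff ℝ ∞ (tpoly k c) := by
  have := (contDiff_tpoly (X := ℝ) k (c := fun _ => c) fun _ _ => contDiff_const).comp
    (f := fun s : ℝ => ((0 : ℝ), s)) (by fun_prop)
  exact this

theorem tpoly_zero (k : ℕ) (c : ℕ → W) : tpoly k c 0 = c 0 := by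
  unfold tpoly
  rw [Finset.sum_eq_single 0]
  · simp
  · intro b _ hb; simp [hb]
  · simp

theorem deriv_tpoly (k : ℕ) (c : ℕ → W) :
    deriv (tpoly (k + 1) c) = tpoly k (fun i => c (i + 1)) := by
  funext s
  have h : ∀ b, HasDerivAt (fun s : ℝ => (s ^ (b + 1) / ((b + 1).factorial : ℝ)) • c (b + 1))
      ((s ^ b / (b.factorial : ℝ)) • c (b + 1)) s := by
    intro b
    have h1 := ((hasDerivAt_pow (b + 1) s).div_const ((b + 1).factorial : ℝ)).smul_const (c (b + 1))
    convert h1 using 2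
    rw [Nat.factorial_succ]
    push_cast
    have : (b.factorial : ℝ) ≠ 0 := by positivity
    field_simp
  have h2 : tpoly (k + 1) c = fun s => (∑ b ∈ Finset.range (k + 1),
      (s ^ (b + 1) / ((b + 1).factorial : ℝ)) • c (b + 1)) + c 0 := by
    funext s
    unfold tpoly
    rw [Finset.sum_range_succ']
    simp
  rw [h2]
  exact ((HasDerivAt.fun_sum fun b _ => h b).add_const (c 0)).deriv

/-- Differentiation shifts the coefficients of `tpoly` and lowers its degree, so a Taylor polynomial
realizes any prescribed jet of order k. -/
theorem iteratedDeriv_tpoly (k i : ℕ) (hi : i ≤ k) (c : ℕ → W) :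
    iteratedDeriv i (tpoly k c) 0 = c i := by
  induction i generalizing k c with
  | zero => simp [tpoly_zero]
  | succ i ih =>
    obtain ⟨k, rfl⟩ : ∃ j, k = j + 1 := ⟨k - 1, by omega⟩
    rw [iteratedDeriv_succ', deriv_tpoly, ih k (by omega)]

theorem dd_tpoly (k a b : ℕ) (hb : b ≤ k) (c : ℝ → ℕ → W) (t : ℝ) :
    dd a b (fun t => tpoly k (c t)) t 0 = iteratedDeriv a (fun t => c t b) t := by
  unfold dd; simp only [iteratedDeriv_tpoly k b hb]

section Bilinear

variable {G F : Type*} [NormedAddCommGroup G] [NormedSpace ℝ G]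
    [NormedAddCommGroup F] [NormedSpace ℝ F] (B : G →L[ℝ] F →L[ℝ] W)

/-- Leibniz in s, then in t. Both ∂_t and ∂_s act on u(t + s) as the derivative of u, so only the
total order that falls on u matters. -/
theorem dd_bilin_diag {u : ℝ → G} {y : ℝ → ℝ → F}
    (hu : ContDiff ℝ ∞ u) (hy : ContDiff ℝ ∞ (fun p : ℝ × ℝ => y p.1 p.2)) (j n : ℕ) :
    dd j n (fun t s => B (u (t + s)) (y t s)) 0 0 = ∑ a ∈ Finset.range (j + 1),
      ∑ b ∈ Finset.range (n + 1), ((j.choose a : ℝ) * (n.choose b : ℝ)) •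
        B (iteratedDeriv ((j - a) + (n - b)) u 0) (dd a b y 0 0) := by
  unfold dd
  have h1 : ∀ t, iteratedDeriv n (fun s => B (u (t + s)) (y t s)) 0 =
      ∑ b ∈ Finset.range (n + 1), (n.choose b : ℝ) •
        B (iteratedDeriv (n - b) u t) (iteratedDeriv b (y t) 0) := by
    intro t
    rw [iteratedDeriv_bilin B (u := fun s => u (t + s)) (hu.comp (by fun_prop))
      (contDiff_slice_right hy t)]
    simp [iteratedDeriv_comp_const_add]
  simp only [h1]
  have h2 : ∀ b, ContDiff ℝ ∞ (fun t => iteratedDeriv b (y t) 0) := by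
    exact fun b => contDiff_iteratedDeriv_slice hy b 0
  have h3 : ∀ b, ContDiff ℝ ∞ (fun t => B (iteratedDeriv (n - b) u t) (iteratedDeriv b (y t) 0)) :=
    fun b => (B.contDiff.comp (hu.iteratedDeriv_top _)).clm_apply (h2 b)
  have h4 : ∀ b ∈ Finset.range (n + 1), ContDiffAt ℝ j (fun t => (n.choose b : ℝ) •
      B (iteratedDeriv (n - b) u t) (iteratedDeriv b (y t) 0)) 0 := fun b _ =>
    ((contDiff_const (c := (n.choose b : ℝ))).smul (h3 b)).contDiffAt.of_le
      (by exact_mod_cast le_top)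
  rw [iteratedDeriv_fun_sum h4, Finset.sum_comm]
  refine Finset.sum_congr rfl fun b _ => ?_
  rw [iteratedDeriv_fun_const_smul_field, iteratedDeriv_bilin B (hu.iteratedDeriv_top _) (h2 b),
    Finset.smul_sum]
  refine Finset.sum_congr rfl fun a _ => ?_
  rw [iteratedDeriv_add_exp, smul_smul, mul_comm]

/-- The `i`-th coefficient of the `k`-velocity dual to `∑_j c_j ∂_t^j ∂_s^{k-j}`. -/
def projCoef (k : ℕ) (c : ℕ → ℝ) (y : ℕ → ℕ → F) (i : ℕ) : F :=
  ∑ j ∈ Finset.range (k + 1), ∑ a ∈ Finset.range (j + 1), ∑ b ∈ Finset.range (k - j + 1),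
    (if a + b = i then c j * ((j.choose a : ℝ) * ((k - j).choose b : ℝ)) / (k.choose i : ℝ)
      else 0) • y a b

/-- After the Leibniz expansion of the right side, all terms with a + b = i carry the same
derivative of u, of order k - i. On the left that derivative comes with the factor C(k, i), which is
why `projCoef` divides by it. -/
theorem projCoef_pairing {u : ℝ → G} {y : ℝ → ℝ → F} {z : ℝ → F}
    (hu : ContDiff ℝ ∞ u) (hy : ContDiff ℝ ∞ (fun p : ℝ × ℝ => y p.1 p.2))
    (hz : ContDiff ℝ ∞ z) (k : ℕ) (c : ℕ → ℝ)
    (h : ∀ i ≤ k, iteratedDeriv i z 0 = projCoef k c (fun a b => dd a b y 0 0) i) :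
    iteratedDeriv k (fun t => B (u t) (z t)) 0 = ∑ j ∈ Finset.range (k + 1),
      c j • dd j (k - j) (fun t s => B (u (t + s)) (y t s)) 0 0 := by
  rw [iteratedDeriv_bilin B hu hz]
  have h1 : ∀ i ∈ Finset.range (k + 1), (k.choose i : ℝ) •
      B (iteratedDeriv (k - i) u 0) (iteratedDeriv i z 0) =
      ∑ j ∈ Finset.range (k + 1), ∑ a ∈ Finset.range (j + 1), ∑ b ∈ Finset.range (k - j + 1),
        if a + b = i then (c j * ((j.choose a : ℝ) * ((k - j).choose b : ℝ))) •
          B (iteratedDeriv (k - i) u 0) (dd a b y 0 0) else 0 := by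
    intro i hi
    have hi' : i ≤ k := by simpa [Nat.lt_succ_iff] using hi
    rw [h i hi', projCoef]
    simp only [map_sum, Finset.smul_sum]
    refine Finset.sum_congr rfl fun j _ => Finset.sum_congr rfl fun a _ =>
      Finset.sum_congr rfl fun b _ => ?_
    rw [map_smul, smul_smul]
    split_ifs
    · rw [mul_div_cancel₀]
      exact_mod_cast (Nat.choose_pos hi').ne'
    · simp
  rw [Finset.sum_congr rfl h1, Finset.sum_comm]
  refine Finset.sum_congr rfl fun j hj => ?_
  have hj' : j ≤ k := by simpa [Nat.lt_succ_iff] using hj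
  rw [dd_bilin_diag B hu hy, Finset.sum_comm, Finset.smul_sum]
  refine Finset.sum_congr rfl fun a ha => ?_
  have ha' : a ≤ j := by simpa [Nat.lt_succ_iff] using ha
  rw [Finset.sum_comm, Finset.smul_sum]
  refine Finset.sum_congr rfl fun b hb => ?_
  have hb' : b ≤ k - j := by simpa [Nat.lt_succ_iff] using hb
  -- Each pair (a, b) contributes to exactly one order i.
  rw [Finset.sum_eq_single (a + b)]
  · rw [if_pos rfl, mul_smul, show k - (a + b) = j - a + (k - j - b) by omega]
  · intro i _ hi; rw [if_neg (Ne.symm hi)]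
  · intro hn; exact absurd (Finset.mem_range.2 (by omega)) hn

end Bilinear

end Calculus

/-! ### Model spaces of iterated tangent vectors -/

/-- The model space of `k`-fold iterated tangent vectors of a normed space. -/
def JetModel.{v} : ℕ → Type v → Type v
  | 0, F => F
  | k + 1, F => JetModel k F × JetModel k F

instance JetModel.normedAddCommGroup (F : Type*) [NormedAddCommGroup F] :
    ∀ k, NormedAddCommGroup (JetModel k F)
  | 0 => ‹NormedAddCommGroup F›
  | k + 1 => @Prod.normedAddCommGroup _ _ (JetModel.normedAddCommGroup F k)
      (JetModel.normedAddCommGroup F k)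

instance JetModel.normedSpace (F : Type*) [NormedAddCommGroup F] [NormedSpace ℝ F] :
    ∀ k, NormedSpace ℝ (JetModel k F)
  | 0 => ‹NormedSpace ℝ F›
  | k + 1 => @Prod.normedSpace ℝ _ _ _ _ _ (JetModel.normedSpace F k) (JetModel.normedSpace F k)

/-- The iterated tangent vector with the given derivatives. -/
def symJet {F : Type*} : ∀ k : ℕ, (ℕ → F) → JetModel k F
  | 0, Y => Y 0
  | k + 1, Y => (symJet k Y, symJet k fun i => Y (i + 1))

/-- The `i`-th derivative contained in an iterated tangent vector. -/
def jetCoef {F : Type*} : ∀ k : ℕ, ℕ → JetModel k F → F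
  | 0, _, X => X
  | k + 1, 0, X => jetCoef k 0 X.1
  | k + 1, i + 1, X => jetCoef k i X.2

section JetModel

variable {F : Type*}

/-- `symJet` stores a coefficient in several slots, and `jetCoef` reads one of them: it takes the
second factor i times and the first factor from then on. For i > k there is no such slot. -/
theorem jetCoef_symJet (k i : ℕ) (hi : i ≤ k) (Y : ℕ → F) : jetCoef k i (symJet k Y) = Y i := by
  induction k generalizing i Y with
  | zero => obtain rfl : i = 0 := by omega
            rfl
  | succ k ih =>
    cases i with
    | zero => exact ih 0 (Nat.zero_le _) Y
    | succ i => exact ih i (by omega) fun i => Y (i + 1)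

theorem symJet_congr {k : ℕ} {Y Y' : ℕ → F} (h : ∀ i ≤ k, Y i = Y' i) :
    symJet k Y = symJet k Y' := by
  induction k generalizing Y Y' with
  | zero => exact h 0 le_rfl
  | succ k ih =>
    exact Prod.ext (ih fun i hi => h i (by omega)) (ih fun i hi => h (i + 1) (by omega))

theorem symJet_inj {k : ℕ} {Y Y' : ℕ → F} (h : symJet k Y = symJet k Y') {i : ℕ} (hi : i ≤ k) :
    Y i = Y' i := by
  rw [← jetCoef_symJet k i hi Y, h, jetCoef_symJet k i hi]

variable [NormedAddCommGroup F]

theorem symJet_add (k : ℕ) (Y Y' : ℕ → F) :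
    symJet k (fun i => Y i + Y' i) = symJet k Y + symJet k Y' := by
  induction k generalizing Y Y' with
  | zero => rfl
  | succ k ih => exact Prod.ext (ih _ _) (ih _ _)

theorem jetCoef_add (k i : ℕ) (A B : JetModel k F) :
    jetCoef k i (A + B) = jetCoef k i A + jetCoef k i B := by
  induction k generalizing i with
  | zero => rfl
  | succ k ih =>
    cases i with
    | zero => exact ih 0 A.1 B.1
    | succ i => exact ih i A.2 B.2

variable [NormedSpace ℝ F]

theorem symJet_smul (k : ℕ) (r : ℝ) (Y : ℕ → F) :
    symJet k (fun i => r • Y i) = r • symJet k Y := by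
  induction k generalizing Y with
  | zero => rfl
  | succ k ih => exact Prod.ext (ih _) (ih _)

theorem jetCoef_smul (k i : ℕ) (r : ℝ) (A : JetModel k F) :
    jetCoef k i (r • A) = r • jetCoef k i A := by
  induction k generalizing i with
  | zero => rfl
  | succ k ih =>
    cases i with
    | zero => exact ih 0 A.1
    | succ i => exact ih i A.2

theorem contDiff_jetCoef (k i : ℕ) : ContDiff ℝ ∞ (jetCoef k i : JetModel k F → F) := by
  induction k generalizing i with
  | zero => exact contDiff_id
  | succ k ih =>
    cases i with
    | zero => exact (ih 0).comp (contDiff_fst (E := JetModel k F) (F := JetModel k F))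
    | succ i => exact (ih i).comp (contDiff_snd (E := JetModel k F) (F := JetModel k F))

theorem contDiff_symJet {X : Type*} [NormedAddCommGroup X] [NormedSpace ℝ X] (k : ℕ)
    {Y : X → ℕ → F} (h : ∀ i ≤ k, ContDiff ℝ ∞ fun x => Y x i) :
    ContDiff ℝ ∞ fun x => symJet k (Y x) := by
  induction k generalizing Y with
  | zero => exact h 0 le_rfl
  | succ k ih =>
    exact (ih fun i hi => h i (by omega)).prodMk (ih fun i hi => h (i + 1) (by omega))

theorem hasDerivAt_symJet (k : ℕ) {Y : ℝ → ℕ → F} {Y' : ℕ → F} {t : ℝ}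
    (h : ∀ i ≤ k, HasDerivAt (fun t => Y t i) (Y' i) t) :
    HasDerivAt (fun t => symJet k (Y t)) (symJet k Y') t := by
  induction k generalizing Y Y' with
  | zero => exact h 0 le_rfl
  | succ k ih =>
    exact (ih fun i hi => h i (by omega)).prodMk (ih fun i hi => h (i + 1) (by omega))

theorem iteratedDeriv_symJet (l : ℕ) {Y : ℝ → ℕ → F} (h : ∀ i ≤ l, ContDiff ℝ ∞ fun t => Y t i)
    (a : ℕ) (t : ℝ) : iteratedDeriv a (fun t => symJet l (Y t)) t =
      symJet l fun i => iteratedDeriv a (fun t => Y t i) t := by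
  induction a generalizing t with
  | zero => simp
  | succ a ih =>
    rw [iteratedDeriv_succ, funext ih]
    refine (hasDerivAt_symJet l fun i hi => ?_).deriv
    have h' := ((h i hi).iteratedDeriv_top a).differentiable (by simp) t
    simpa [iteratedDeriv_succ] using h'.hasDerivAt

end JetModel

/-! ### Cut-offs -/

/-- Take θ(t) = f(t) t with a bump function f: inside the ball |θ(t)| ≤ |t|, and outside it θ
vanishes. Precomposition with θ keeps a curve inside a chart domain for all times without changing
its jets at 0. -/
theorem exists_cutoff {S : Set ℝ} (hS : S ∈ 𝓝 (0 : ℝ)) :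
    ∃ θ : ℝ → ℝ, ContDiff ℝ ∞ θ ∧ (∀ᶠ t in 𝓝 (0 : ℝ), θ t = t) ∧ ∀ t, θ t ∈ S := by
  obtain ⟨ε, hε, h⟩ := Metric.mem_nhds_iff.1 hS
  let f : ContDiffBump (0 : ℝ) := ⟨ε / 2, ε, by positivity, by linarith⟩
  refine ⟨fun t => f t * t, f.contDiff.mul contDiff_id, ?_, fun t => h ?_⟩
  · filter_upwards [f.eventuallyEq_one] with t ht
    rw [ht]; simp
  · rw [mem_ball_zero_iff]
    change ‖f t * t‖ < ε
    by_cases ht : ‖t‖ < ε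
    · rw [norm_mul]
      refine lt_of_le_of_lt (mul_le_of_le_one_left (norm_nonneg t) ?_) ht
      rw [Real.norm_of_nonneg f.nonneg]; exact f.le_one
    · rw [f.zero_of_le_dist (by simpa [f] using ht)]; simpa using hε

theorem exists_cutoff_two {S : Set (ℝ × ℝ)} (hS : S ∈ 𝓝 ((0, 0) : ℝ × ℝ)) :
    ∃ θ : ℝ → ℝ, ContDiff ℝ ∞ θ ∧ (∀ᶠ t in 𝓝 (0 : ℝ), θ t = t) ∧ ∀ t s, (θ t, θ s) ∈ S := by
  rw [nhds_prod_eq] at hS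
  obtain ⟨A, hA, B, hB, h⟩ := Filter.mem_prod_iff.1 hS
  obtain ⟨θ, h1, h2, h3⟩ := exists_cutoff (Filter.inter_mem hA hB)
  exact ⟨θ, h1, h2, fun t s => h ⟨(h3 t).1, (h3 s).2⟩⟩

theorem exists_cutoff_three {S : Set (ℝ × ℝ × ℝ)} (hS : S ∈ 𝓝 ((0, 0, 0) : ℝ × ℝ × ℝ)) :
    ∃ θ : ℝ → ℝ, ContDiff ℝ ∞ θ ∧ (∀ᶠ t in 𝓝 (0 : ℝ), θ t = t) ∧
      ∀ t s r, (θ t, θ s, θ r) ∈ S := by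
  rw [nhds_prod_eq] at hS
  obtain ⟨A, hA, B, hB, h⟩ := Filter.mem_prod_iff.1 hS
  rw [nhds_prod_eq] at hB
  obtain ⟨C, hC, D, hD, h'⟩ := Filter.mem_prod_iff.1 hB
  obtain ⟨η, g1, g2, g3⟩ := exists_cutoff (Filter.inter_mem hA (Filter.inter_mem hC hD))
  exact ⟨η, g1, g2, fun t s r => h ⟨(g3 t).1, h' ⟨(g3 s).2.1, (g3 r).2.2⟩⟩⟩

/-! ### Lifts of vector-valued functions -/

section Lift

variable {N N' : Mfd.{u}} {W : Type*} [NormedAddCommGroup W] [NormedSpace ℝ W]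

/-- The tangent lift of a function with values in a vector space. -/
def vlift (y : N → W) (w : N.T) : W × W :=
  (y (Mfd.base w), mfderiv N.I 𝓘(ℝ, W) y (Mfd.base w) (Bundle.TotalSpace.snd w))

theorem contMDiffOn_vlift {y : N → W} {O : Set N} (hO : IsOpen O)
    (hy : ContMDiffOn N.I 𝓘(ℝ, W) ∞ y O) :
    ContMDiffOn N.T.I 𝓘(ℝ, W × W) ∞ (vlift y) (Mfd.base ⁻¹' O) := by
  have h1 : ContMDiffOn N.T.I 𝓘(ℝ, W) ∞ (fun w : N.T => y (Mfd.base w)) (Mfd.base ⁻¹' O) :=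
    hy.comp contMDiff_base.contMDiffOn fun _ h => h
  have h2 : ContMDiffOn N.I.tangent 𝓘(ℝ, W).tangent ∞ (tangentMap N.I 𝓘(ℝ, W) y)
      (Bundle.TotalSpace.proj ⁻¹' O) := by
    refine (ContMDiffOn.contMDiffOn_tangentMapWithin (m := ∞) hy le_rfl hO.uniqueMDiffOn).congr ?_
    intro w hw
    exact (tangentMapWithin_eq_tangentMap (hO.uniqueMDiffOn _ hw)
      ((hy.contMDiffAt (hO.mem_nhds hw)).mdifferentiableAt (by simp))).symm
  have h3 := (contMDiff_snd_tangentBundle_modelSpace W 𝓘(ℝ, W) (n := ∞)).comp_contMDiffOn h2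
  exact h1.prodMk_space h3

theorem vlift_vel {y : N → W} {c : ℝ → N} {t : ℝ} (hy : MDifferentiableAt N.I 𝓘(ℝ, W) y (c t))
    (hc : MDifferentiableAt 𝓘(ℝ, ℝ) N.I c t) :
    vlift y (vel c t) = (y (c t), deriv (fun t => y (c t)) t) := by
  have := mfderiv_comp_apply (I := 𝓘(ℝ, ℝ)) (I' := N.I) (I'' := 𝓘(ℝ, W)) t hy hc (1 : ℝ)
  refine Prod.ext rfl (this.symm.trans ?_)
  rw [mfderiv_eq_fderiv]; rfl

theorem vlift_tmap {y : N' → W} {f : N → N'} (w : N.T)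
    (hy : MDifferentiableAt N'.I 𝓘(ℝ, W) y (f (Mfd.base w)))
    (hf : MDifferentiableAt N.I N'.I f (Mfd.base w)) :
    vlift y (tmap f w) = vlift (fun n => y (f n)) w :=
  Prod.ext rfl (mfderiv_comp_apply (I := N.I) (I' := N'.I) (I'' := 𝓘(ℝ, W)) _ hy hf _).symm

theorem vlift_congr {y y' : N → W} (w : N.T) (h : y =ᶠ[𝓝 (Mfd.base w)] y') :
    vlift y w = vlift y' w :=
  Prod.ext h.eq_of_nhds
    (congrArg (fun A : N.V →L[ℝ] W => A w.2) (h.mfderiv_eq (I := N.I) (I' := 𝓘(ℝ, W))))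

theorem mdifferentiableAt_of_smoothOn {y : N → W} {O : Set N} (hO : IsOpen O)
    (hy : ContMDiffOn N.I 𝓘(ℝ, W) ∞ y O) {n : N} (hn : n ∈ O) :
    MDifferentiableAt N.I 𝓘(ℝ, W) y n :=
  (hy.contMDiffAt (hO.mem_nhds hn)).mdifferentiableAt (by simp)

/-- The part of `T^{(k)} N` over `O`. -/
def overSet : ∀ (k : ℕ) (_ : Set N), Set (iterT k N)
  | 0, O => O
  | k + 1, O => Mfd.base ⁻¹' overSet k O

theorem isOpen_overSet {O : Set N} (hO : IsOpen O) : ∀ k, IsOpen (overSet k O)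
  | 0 => hO
  | k + 1 => (isOpen_overSet hO k).preimage contMDiff_base.continuous

theorem mem_overSet {O : Set N} {k : ℕ} {X : iterT k N} : X ∈ overSet k O ↔ pt k X ∈ O := by
  induction k with
  | zero => rfl
  | succ k ih => rw [pt_succ]; exact ih

theorem jet_mem_overSet {O : Set N} {c : ℝ → N} {t : ℝ} (k : ℕ) (h : c t ∈ O) :
    jet k c t ∈ overSet k O := by
  rw [mem_overSet, pt_jet]; exact h

/-- The iterated tangent lift of a function with values in a vector space. -/
def iterLift (y : N → W) : ∀ k : ℕ, iterT k N → JetModel k W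
  | 0 => y
  | k + 1 => vlift (iterLift y k)

theorem contMDiffOn_iterLift {y : N → W} {O : Set N} (hO : IsOpen O)
    (hy : ContMDiffOn N.I 𝓘(ℝ, W) ∞ y O) : ∀ k,
    ContMDiffOn (iterT k N).I 𝓘(ℝ, JetModel k W) ∞ (iterLift y k) (overSet k O)
  | 0 => hy
  | k + 1 => contMDiffOn_vlift (isOpen_overSet hO k) (contMDiffOn_iterLift hO hy k)

theorem SmoothCurve.contDiff_comp {y : N → W} {O : Set N}
    (hy : ContMDiffOn N.I 𝓘(ℝ, W) ∞ y O) {c : ℝ → N} (hc : SmoothCurve N c) (hcO : ∀ t, c t ∈ O) :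
    ContDiff ℝ ∞ fun t => y (c t) :=
  ((hy.comp_contMDiff hc hcO : ContMDiff 𝓘(ℝ, ℝ) 𝓘(ℝ, W) ∞ (y ∘ c))).contDiff

theorem contDiff_comp_family {X : Type*} [NormedAddCommGroup X] [NormedSpace ℝ X] {y : N → W}
    {O : Set N} (hy : ContMDiffOn N.I 𝓘(ℝ, W) ∞ y O) {c : X → N}
    (hc : ContMDiff 𝓘(ℝ, X) N.I ∞ c) (hcO : ∀ t, c t ∈ O) :
    ContDiff ℝ ∞ fun t => y (c t) :=
  ((hy.comp_contMDiff hc hcO : ContMDiff 𝓘(ℝ, X) 𝓘(ℝ, W) ∞ (y ∘ c))).contDiff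

/-- At each level the derivative of a symmetric jet is the symmetric jet of the derivatives, that
is, the jet with shifted coefficients. -/
theorem iterLift_jet {y : N → W} {O : Set N} (hO : IsOpen O)
    (hy : ContMDiffOn N.I 𝓘(ℝ, W) ∞ y O) {c : ℝ → N} (hc : SmoothCurve N c) (hcO : ∀ t, c t ∈ O)
    (k : ℕ) (t : ℝ) :
    iterLift y k (jet k c t) = symJet k fun i => iteratedDeriv i (fun t => y (c t)) t := by
  induction k generalizing t with
  | zero => simp [symJet, iterLift, jet]; rfl
  | succ k ih =>
    change vlift (iterLift y k) (vel (jet k c) t) = _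
    rw [vlift_vel (mdifferentiableAt_of_smoothOn (isOpen_overSet hO k)
      (contMDiffOn_iterLift hO hy k) (jet_mem_overSet k (hcO t))) ((hc.jet k).mdiff t)]
    refine Prod.ext (ih t) ?_
    simp only [ih]
    refine (hasDerivAt_symJet k fun i _ => ?_).deriv
    have h := ((hc.contDiff_comp hy hcO).iteratedDeriv_top i).differentiable (by simp) t
    simpa [iteratedDeriv_succ] using h.hasDerivAt

/-- `iterLift_jet` is applied in s and then in t. The jet of a family thus becomes its table of
mixed partial derivatives, on which the coordinate computations rest. -/
theorem iterLift_jet_jet {y : N → W} {O : Set N} (hO : IsOpen O)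
    (hy : ContMDiffOn N.I 𝓘(ℝ, W) ∞ y O) {g : ℝ → ℝ → N}
    (hg : ContMDiff 𝓘(ℝ, ℝ × ℝ) N.I ∞ fun p : ℝ × ℝ => g p.1 p.2) (hgO : ∀ t s, g t s ∈ O)
    (k l : ℕ) :
    iterLift (iterLift y l) k (jet k (fun t => jet l (g t) 0) 0) =
      symJet k fun a => symJet l fun b => dd a b (fun t s => y (g t s)) 0 0 := by
  have hc : SmoothCurve (iterT l N) fun t => jet l (g t) 0 := contMDiff_jet_param hg l 0
  rw [iterLift_jet (isOpen_overSet hO l) (contMDiffOn_iterLift hO hy l) hc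
    fun t => jet_mem_overSet l (hgO t 0)]
  have hgt : ∀ t, SmoothCurve N (g t) := fun t =>
    ContMDiff.comp (f := fun s : ℝ => (t, s)) hg (contDiff_const.prodMk contDiff_id).contMDiff
  simp only [fun t => iterLift_jet hO hy (hgt t) (hgO t) l 0]
  have hf : ContDiff ℝ ∞ fun p : ℝ × ℝ => y (g p.1 p.2) :=
    contDiff_comp_family hy hg fun p => hgO p.1 p.2
  refine symJet_congr fun a _ => ?_
  exact iteratedDeriv_symJet l (fun i _ => contDiff_iteratedDeriv_slice
    (f := fun t s => y (g t s)) hf i 0) a 0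

end Lift

/-! ### Charts -/

section LeftInverse

variable {N : Mfd.{u}} {W : Type u} [NormedAddCommGroup W] [NormedSpace ℝ W]

/-- `φ` is a smooth function on `O` with the smooth left inverse `s`. -/
structure SmoothLeftInv (φ : N → W) (s : W → N) (O : Set N) (R : Set W) : Prop where
  isOpen_source : IsOpen O
  isOpen_target : IsOpen R
  smooth : ContMDiffOn N.I 𝓘(ℝ, W) ∞ φ O
  smooth_inv : ContMDiffOn 𝓘(ℝ, W) N.I ∞ s R
  mapsTo : ∀ n ∈ O, φ n ∈ R
  left_inv : ∀ n ∈ O, s (φ n) = n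

/-- The vector space as a manifold. -/
abbrev Mfd.vec (W : Type u) [NormedAddCommGroup W] [NormedSpace ℝ W] : Mfd.{u} :=
  Mfd.of 𝓘(ℝ, W) W

theorem contMDiff_toTangent : ContMDiff 𝓘(ℝ, W × W) 𝓘(ℝ, W).tangent ∞
    (fun q : W × W => (⟨q.1, q.2⟩ : TangentBundle 𝓘(ℝ, W) W)) := by
  have h1 : ContMDiff 𝓘(ℝ, W × W) 𝓘(ℝ, W × W).tangent ∞
      (fun q : W × W => (⟨q, (q.2, (0 : W))⟩ : TangentBundle 𝓘(ℝ, W × W) (W × W))) :=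
    (contMDiff_vectorSpace_iff_contDiff (𝕜 := ℝ) (E := W × W) (n := ∞)
      (V := fun q => (q.2, (0 : W)))).2 (contDiff_snd.prodMk contDiff_const)
  have h2 : ContMDiff 𝓘(ℝ, W × W) 𝓘(ℝ, W) ∞ (Prod.fst : W × W → W) := contDiff_fst.contMDiff
  have h3 := ContMDiff.contMDiff_tangentMap (m := ∞) h2 le_rfl
  refine (h3.comp h1).congr fun q => ?_
  refine Bundle.TotalSpace.ext rfl (heq_of_eq ?_)
  change q.2 = mfderiv 𝓘(ℝ, W × W) 𝓘(ℝ, W) Prod.fst q (q.2, (0 : W))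
  rw [mfderiv_eq_fderiv, fderiv_fst]
  rfl

/-- Functoriality of T applied to s ∘ φ = id. A left inverse already makes the coordinates separate
points, and it survives every tangent lift. -/
theorem SmoothLeftInv.T {φ : N → W} {s : W → N} {O : Set N} {R : Set W}
    (h : SmoothLeftInv φ s O R) :
    SmoothLeftInv (vlift φ)
      (fun q => tmap (N := Mfd.vec W) s (⟨q.1, q.2⟩ : TangentBundle 𝓘(ℝ, W) W))
      (Mfd.base ⁻¹' O) (Prod.fst ⁻¹' R) where
  isOpen_source := h.isOpen_source.preimage contMDiff_base.continuous
  isOpen_target := h.isOpen_target.preimage continuous_fst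
  smooth := contMDiffOn_vlift h.isOpen_source h.smooth
  smooth_inv := by
    have h1 := contMDiffOn_tmap (N := Mfd.vec W) h.isOpen_target h.smooth_inv
    exact h1.comp contMDiff_toTangent.contMDiffOn fun q hq => hq
  mapsTo n hn := h.mapsTo _ hn
  left_inv w hw := by
    have hs : MDifferentiableAt 𝓘(ℝ, W) N.I s (φ (Mfd.base w)) :=
      (h.smooth_inv.contMDiffAt (h.isOpen_target.mem_nhds (h.mapsTo _ hw))).mdifferentiableAt
        (by simp)
    have hφ := mdifferentiableAt_of_smoothOn h.isOpen_source h.smooth hw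
    have := tmap_comp (N' := Mfd.vec W) (g := s) (f := φ) w hs hφ
    refine this.symm.trans ?_
    rw [tmap_congr (g := fun n => n) w, tmap_id]
    filter_upwards [h.isOpen_source.mem_nhds hw] with n hn using h.left_inv n hn

theorem SmoothLeftInv.iter {φ : N → W} {s : W → N} {O : Set N} {R : Set W}
    (h : SmoothLeftInv φ s O R) : ∀ k, ∃ s' R', SmoothLeftInv (iterLift φ k) s' (overSet k O) R'
  | 0 => ⟨s, R, h⟩
  | k + 1 => by
    obtain ⟨s', R', h'⟩ := h.iter k
    exact ⟨_, _, h'.T⟩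

theorem SmoothLeftInv.inj {φ : N → W} {s : W → N} {O : Set N} {R : Set W}
    (h : SmoothLeftInv φ s O R) {a b : N} (ha : a ∈ O) (hb : b ∈ O) (hab : φ a = φ b) : a = b := by
  rw [← h.left_inv a ha, hab, h.left_inv b hb]

/-- The absence of a boundary makes the target of the chart open in the model vector space. -/
theorem smoothLeftInv_extChartAt [N.I.Boundaryless] (n : N) :
    SmoothLeftInv (extChartAt N.I n) (extChartAt N.I n).symm (extChartAt N.I n).source
      (extChartAt N.I n).target where
  isOpen_source := isOpen_extChartAt_source n
  isOpen_target := isOpen_extChartAt_target n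
  smooth := by rw [extChartAt_source]; exact contMDiffOn_extChartAt
  smooth_inv := contMDiffOn_extChartAt_symm n
  mapsTo _ h := (extChartAt N.I n).map_source h
  left_inv _ h := (extChartAt N.I n).left_inv h

/-- A smooth curve of tangent vectors is, near `0`, the velocity of a smooth family of curves. -/
theorem exists_family_vel_eq [N.I.Boundaryless] {X : ℝ → N.T} (hX : SmoothCurve N.T X)
    {U : Set N} (hU : IsOpen U) (h0 : Mfd.base (X 0) ∈ U) :
    ∃ x : ℝ → ℝ → N, ContMDiff 𝓘(ℝ, ℝ × ℝ) N.I ∞ (fun p : ℝ × ℝ => x p.1 p.2) ∧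
      (∀ t r, x t r ∈ U) ∧ ∀ᶠ t in 𝓝 (0 : ℝ), vel (x t) 0 = X t := by
  set φ := extChartAt N.I (Mfd.base (X 0)) with hφ
  have hL := smoothLeftInv_extChartAt (Mfd.base (X 0))
  have hbX : Continuous fun t => Mfd.base (X t) :=
    contMDiff_base.continuous.comp (ContMDiff.continuous hX)
  have hS1 : (fun t => Mfd.base (X t)) ⁻¹' φ.source ∈ 𝓝 (0 : ℝ) :=
    hbX.continuousAt.preimage_mem_nhds (hL.isOpen_source.mem_nhds (mem_extChartAt_source _))
  -- The first cut-off keeps the base points of X in one chart domain.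
  obtain ⟨θ, θs, θid, θS⟩ := exists_cutoff hS1
  have hXθ : SmoothCurve N.T fun t => X (θ t) := ContMDiff.comp hX θs.contMDiff
  have hab := hXθ.contDiff_comp hL.T.smooth fun t => θS t
  -- In the chart, a straight line through the base point of X(t) whose direction is the vector part
  -- of X(t) has velocity X(t) at r = 0.
  let Hf : ℝ × ℝ → N.V := fun p => (vlift φ (X (θ p.1))).1 + p.2 • (vlift φ (X (θ p.1))).2
  have hH : ContDiff ℝ ∞ Hf :=
    (hab.fst.comp contDiff_fst).add (contDiff_snd.smul (hab.snd.comp contDiff_fst))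
  have hopen : IsOpen (φ.target ∩ φ.symm ⁻¹' U) :=
    hL.smooth_inv.continuousOn.isOpen_inter_preimage hL.isOpen_target hU
  have hθ0 : θ 0 = 0 := θid.self_of_nhds
  have hK : Hf ⁻¹' (φ.target ∩ φ.symm ⁻¹' U) ∈ 𝓝 ((0, 0) : ℝ × ℝ) := by
    refine (hopen.preimage hH.continuous).mem_nhds ?_
    have : Hf (0, 0) = φ (Mfd.base (X 0)) := by
      change (vlift φ (X (θ 0))).1 + (0 : ℝ) • (vlift φ (X (θ 0))).2 = _
      rw [zero_smul, add_zero, hθ0]; rfl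
    rw [mem_preimage, this]
    refine ⟨mem_extChartAt_target _, ?_⟩
    rw [mem_preimage, hφ, extChartAt_to_inv]; exact h0
  -- The second cut-off keeps these lines in the chart target and over U.
  obtain ⟨η, ηs, ηid, ηS⟩ := exists_cutoff_two hK
  refine ⟨fun t r => φ.symm (Hf (η t, η r)), ?_, fun t r => (ηS t r).2, ?_⟩
  · refine hL.smooth_inv.comp_contMDiff (f := fun p : ℝ × ℝ => Hf (η p.1, η p.2)) ?_
      fun p => (ηS p.1 p.2).1
    exact (hH.comp ((ηs.comp contDiff_fst).prodMk (ηs.comp contDiff_snd))).contMDiff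
  · filter_upwards [θid, ηid, hS1] with t ht ht' hts
    have hη0 : η 0 = 0 := ηid.self_of_nhds
    have h1 : vel (fun r => φ.symm (Hf (η t, η r))) 0 =
        vel (fun r => φ.symm (Hf (t, r))) 0 := by
      refine vel_congr ?_
      filter_upwards [ηid] with r hr
      rw [ht', hr]
    rw [h1]
    have hT : Hf (t, 0) ∈ φ.target := by simpa [ht', hη0] using (ηS t 0).1
    have hd : HasDerivAt (fun r : ℝ => Hf (t, r)) (vlift φ (X t)).2 0 := by
      have := ((hasDerivAt_id (0 : ℝ)).smul_const (vlift φ (X t)).2).const_add (vlift φ (X t)).1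
      simpa [Hf, ht] using this
    have hs : MDifferentiableAt 𝓘(ℝ, N.V) N.I φ.symm (Hf (t, 0)) :=
      (hL.smooth_inv.contMDiffAt (hL.isOpen_target.mem_nhds hT)).mdifferentiableAt (by simp)
    have h2 := vel_comp (N := Mfd.vec N.V) (N' := N) (f := φ.symm) (c := fun r => Hf (t, r)) 0 hs
      hd.differentiableAt.mdifferentiableAt
    refine h2.trans (Eq.trans ?_ (hL.T.left_inv (X t) hts))
    have h3 : vel (N := Mfd.vec N.V) (fun r => Hf (t, r)) 0 =
        (⟨(vlift φ (X t)).1, (vlift φ (X t)).2⟩ : TangentBundle 𝓘(ℝ, N.V) N.V) := by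
      have hH0 : Hf (t, 0) = (vlift φ (X t)).1 := by simp [Hf, ht]
      refine Bundle.TotalSpace.ext hH0 (heq_of_eq ?_)
      change mfderiv 𝓘(ℝ, ℝ) 𝓘(ℝ, N.V) (fun r : ℝ => Hf (t, r)) 0 (1 : ℝ) = _
      rw [mfderiv_eq_fderiv]
      exact hd.deriv
    exact congrArg (tmap (N := Mfd.vec N.V) φ.symm) h3

theorem exists_curve_vel_eq [N.I.Boundaryless] (v : N.T) {U : Set N} (hU : IsOpen U)
    (hv : Mfd.base v ∈ U) :
    ∃ x : ℝ → N, SmoothCurve N x ∧ (∀ t, x t ∈ U) ∧ vel x 0 = v := by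
  obtain ⟨x, h1, h2, h3⟩ := exists_family_vel_eq (X := fun _ => v) contMDiff_const hU hv
  exact ⟨x 0, ContMDiff.comp (f := fun s : ℝ => ((0 : ℝ), s)) h1
    (contDiff_const.prodMk contDiff_id).contMDiff, h2 0, h3.self_of_nhds⟩

end LeftInverse

/-! ### Fibre charts -/

section ProdVec

variable (M : Mfd.{u}) (F : Type u) [NormedAddCommGroup F] [NormedSpace ℝ F]

/-- The product of a manifold and a vector space. -/
abbrev Mfd.prodVec : Mfd.{u} := Mfd.of (M.I.prod 𝓘(ℝ, F)) (M × F)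

variable {M F}

/-- `TM × TF → T(M × F)`. -/
def tangentPair (v : M.T) (f : F × F) : (M.prodVec F).T :=
  (⟨(Mfd.base v, f.1), (v.2, f.2)⟩ : TangentBundle (M.I.prod 𝓘(ℝ, F)) (M × F))

theorem contMDiff_tangentPair : ContMDiff (M.T.I.prod 𝓘(ℝ, F × F)) (M.prodVec F).T.I ∞
    (fun q : M.T × (F × F) => tangentPair q.1 q.2) := by
  have h1 : ContMDiff (M.I.tangent.prod 𝓘(ℝ, F).tangent) (M.I.prod 𝓘(ℝ, F)).tangent ∞
      (equivTangentBundleProd M.I M 𝓘(ℝ, F) F).symm := contMDiff_equivTangentBundleProd_symm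
  have h2 : ContMDiff (M.I.tangent.prod 𝓘(ℝ, F × F)) (M.I.tangent.prod 𝓘(ℝ, F).tangent) ∞
      (Prod.map (id : TangentBundle M.I M → _)
        (fun q : F × F => (⟨q.1, q.2⟩ : TangentBundle 𝓘(ℝ, F) F))) :=
    contMDiff_id.prodMap contMDiff_toTangent
  exact h1.comp h2

end ProdVec

/-- A trivialization over `U`, with typical fibre `F`, of a smooth map `p : E → M`. -/
structure FibreChart {M E : Mfd.{u}} (p : E → M) (U : Set M) (F : Type u) [NormedAddCommGroup F]
    [NormedSpace ℝ F] where
  y : E → F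
  s : M → F → E
  isOpen : IsOpen U
  smooth_p : ContMDiff E.I M.I ∞ p
  smooth_y : ContMDiffOn E.I 𝓘(ℝ, F) ∞ y (p ⁻¹' U)
  smooth_s : ContMDiffOn (M.I.prod 𝓘(ℝ, F)) E.I ∞ (fun q : M × F => s q.1 q.2) (U ×ˢ univ)
  p_s : ∀ x ∈ U, ∀ f, p (s x f) = x
  y_s : ∀ x ∈ U, ∀ f, y (s x f) = f
  s_y : ∀ e, p e ∈ U → s (p e) (y e) = e

namespace FibreChart

variable {M E : Mfd.{u}} {p : E → M} {U : Set M} {F : Type u} [NormedAddCommGroup F]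
    [NormedSpace ℝ F] (h : FibreChart p U F)

include h in
theorem isOpen_total : IsOpen (p ⁻¹' U) := h.isOpen.preimage h.smooth_p.continuous

theorem ext {a b : E} (ha : p a ∈ U) (hp : p a = p b) (hy : h.y a = h.y b) : a = b := by
  rw [← h.s_y a ha, hp, hy, h.s_y b (hp ▸ ha)]

theorem mdiff_y {e : E} (he : p e ∈ U) : MDifferentiableAt E.I 𝓘(ℝ, F) h.y e :=
  mdifferentiableAt_of_smoothOn h.isOpen_total h.smooth_y he

include h in
theorem mdiff_p (e : E) : MDifferentiableAt E.I M.I p e :=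
  (h.smooth_p e).mdifferentiableAt (by simp)

theorem mdiff_s {x : M} (hx : x ∈ U) (f : F) :
    MDifferentiableAt (M.I.prod 𝓘(ℝ, F)) E.I (fun q : M × F => h.s q.1 q.2) (x, f) :=
  (h.smooth_s.contMDiffAt ((h.isOpen.prod isOpen_univ).mem_nhds ⟨hx, mem_univ _⟩)).mdifferentiableAt
    (by simp)

theorem contMDiff_s {X : Type*} [NormedAddCommGroup X] [NormedSpace ℝ X] {x : X → M} {f : X → F}
    (hx : ContMDiff 𝓘(ℝ, X) M.I ∞ x) (hxU : ∀ t, x t ∈ U) (hf : ContDiff ℝ ∞ f) :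
    ContMDiff 𝓘(ℝ, X) E.I ∞ fun t => h.s (x t) (f t) :=
  h.smooth_s.comp_contMDiff (f := fun t => (x t, f t)) (hx.prodMk hf.contMDiff)
    fun t => ⟨hxU t, mem_univ _⟩

theorem smoothCurve_s {x : ℝ → M} {f : ℝ → F} (hx : SmoothCurve M x) (hxU : ∀ t, x t ∈ U)
    (hf : ContDiff ℝ ∞ f) : SmoothCurve E fun t => h.s (x t) (f t) := h.contMDiff_s hx hxU hf

/-- The tangent lift of a trivialization. -/
def T : FibreChart (tmap p) (Mfd.base ⁻¹' U) (F × F) where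
  y := vlift h.y
  s v f := tmap (N := M.prodVec F) (fun q : M × F => h.s q.1 q.2) (tangentPair v f)
  isOpen := h.isOpen.preimage contMDiff_base.continuous
  smooth_p := contMDiff_tmap h.smooth_p
  smooth_y := contMDiffOn_vlift h.isOpen_total h.smooth_y
  smooth_s := by
    have h1 := contMDiffOn_tmap (N := M.prodVec F) (h.isOpen.prod isOpen_univ) h.smooth_s
    exact h1.comp contMDiff_tangentPair.contMDiffOn fun q hq => ⟨hq.1, mem_univ _⟩
  p_s v hv f := by
    -- Locally p ∘ s is the first projection, so its tangent map is the tangent map of that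
    -- projection.
    have h1 := tmap_comp (N := M.prodVec F) (g := p) (f := fun q : M × F => h.s q.1 q.2)
      (tangentPair v f) (h.mdiff_p _) (h.mdiff_s hv _)
    rw [← h1, tmap_congr (N := M.prodVec F) (g := fun q : M × F => q.1)]
    · exact tangentMap_prodFst
    · filter_upwards [(h.isOpen.prod isOpen_univ).mem_nhds
        (⟨hv, mem_univ _⟩ : ((Mfd.base v, f.1) : M × F) ∈ U ×ˢ univ)] with q hq
      exact h.p_s _ hq.1 _
  y_s v hv f := by
    have h1 := vlift_tmap (N := M.prodVec F) (y := h.y) (f := fun q : M × F => h.s q.1 q.2)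
      (tangentPair v f) (h.mdiff_y (by
        change p (h.s (Mfd.base v) f.1) ∈ U
        rw [h.p_s _ hv]; exact hv)) (h.mdiff_s hv _)
    rw [h1, vlift_congr (N := M.prodVec F) (y' := fun q : M × F => q.2)]
    · refine Prod.ext rfl ?_
      change mfderiv (M.I.prod 𝓘(ℝ, F)) 𝓘(ℝ, F) Prod.snd (Mfd.base v, f.1) (v.2, f.2) = f.2
      rw [mfderiv_snd]; rfl
    · filter_upwards [(h.isOpen.prod isOpen_univ).mem_nhds
        (⟨hv, mem_univ _⟩ : ((Mfd.base v, f.1) : M × F) ∈ U ×ˢ univ)] with q hq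
      exact h.y_s _ hq.1 _
  s_y w hw := by
    have h0 : MDifferentiableAt E.I (M.I.prod 𝓘(ℝ, F)) (fun e => ((p e, h.y e) : M × F))
        (Mfd.base w) := (h.mdiff_p _).prodMk (h.mdiff_y hw)
    have h1 : tangentPair (tmap p w) (vlift h.y w) =
        tmap (N' := M.prodVec F) (fun e => ((p e, h.y e) : M × F)) w := by
      refine Bundle.TotalSpace.ext rfl (heq_of_eq ?_)
      have := mfderiv_prodMk (h.mdiff_p (Mfd.base w)) (h.mdiff_y hw)
      exact (congrArg (fun A : E.V →L[ℝ] M.V × F => A w.2) this).symm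
    rw [h1, ← tmap_comp (N' := M.prodVec F) (g := fun q : M × F => h.s q.1 q.2)
      (f := fun e => ((p e, h.y e) : M × F)) w (h.mdiff_s hw _) h0,
      tmap_congr (g := fun e => e), tmap_id]
    filter_upwards [h.isOpen_total.mem_nhds hw] with e he using h.s_y e he

/-- The iterated tangent lift of a trivialization. -/
def iter : ∀ k : ℕ, FibreChart (iterMap k p) (overSet k U) (JetModel k F)
  | 0 => h
  | k + 1 => (iter k).T

theorem iter_y (k : ℕ) : (h.iter k).y = iterLift h.y k := by
  induction k with
  | zero => rfl
  | succ k ih => exact congrArg vlift ih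

include h in
/-- A tangent vector is the velocity of a curve over a given curve of the base. -/
theorem exists_curve_over {x : ℝ → M} (hx : SmoothCurve M x) (hxU : ∀ t, x t ∈ U) {a : E.T}
    (ha : tmap p a = vel x 0) :
    ∃ c : ℝ → E, SmoothCurve E c ∧ (∀ t, p (c t) = x t) ∧ vel c 0 = a := by
  obtain ⟨f, f', hf⟩ : ∃ f f', h.T.y a = (f, f') := ⟨_, _, rfl⟩
  -- The affine curve in the fibre whose value and derivative at 0 are the two fibre coordinates of
  -- a, carried along x by the chart.
  have hlin : ContDiff ℝ ∞ fun t : ℝ => f + t • f' := by fun_prop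
  have hc := h.smoothCurve_s hx hxU hlin
  have hpc : ∀ t, p (h.s (x t) (f + t • f')) = x t := fun t => h.p_s _ (hxU t) _
  refine ⟨_, hc, hpc, ?_⟩
  have hv : tmap p (vel (fun t => h.s (x t) (f + t • f')) 0) = vel x 0 := by
    rw [← vel_comp 0 (h.mdiff_p _) (hc.mdiff 0)]; simp only [hpc]
  refine h.T.ext ?_ (hv.trans ha.symm) ?_
  · rw [hv]; exact hxU 0
  · rw [hf]
    change vlift h.y _ = _
    rw [vlift_vel (h.mdiff_y (by rw [hpc]; exact hxU 0)) (hc.mdiff 0)]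
    simp only [fun t => h.y_s _ (hxU t)]
    refine Prod.ext (by simp) ?_
    have := ((hasDerivAt_id (0 : ℝ)).smul_const f').const_add f
    simpa using this.deriv

end FibreChart

/-! ### Vector bundle charts -/

variable {M E D : Mfd.{u}}

/-- The trivializations `hE`, `hD` of `σ` and `σ*` over `U` are linear on fibres and take the
pairing to `β`. -/
structure VBChart (σ : VBData M E D) {U : Set M} {F G : Type u} [NormedAddCommGroup F]
    [NormedSpace ℝ F] [NormedAddCommGroup G] [NormedSpace ℝ G] (hE : FibreChart σ.pE U F)
    (hD : FibreChart σ.pD U G) (β : G →L[ℝ] F →L[ℝ] ℝ) : Prop where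
  p_add : ∀ a b, σ.pE a ∈ U → σ.pE a = σ.pE b → σ.pE (σ.add a b) = σ.pE a
  y_add : ∀ a b, σ.pE a ∈ U → σ.pE a = σ.pE b → hE.y (σ.add a b) = hE.y a + hE.y b
  p_smul : ∀ (r : ℝ) a, σ.pE a ∈ U → σ.pE (σ.smul r a) = σ.pE a
  y_smul : ∀ (r : ℝ) a, σ.pE a ∈ U → hE.y (σ.smul r a) = r • hE.y a
  pair_eq : ∀ d a, σ.pE a ∈ U → σ.pD d = σ.pE a → σ.pair d a = β (hD.y d) (hE.y a)
  sep : ∀ f, (∀ g, β g f = 0) → f = 0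

/-- The tangent lift of a bilinear form. -/
def bilinT {F G : Type*} [NormedAddCommGroup F] [NormedSpace ℝ F] [NormedAddCommGroup G]
    [NormedSpace ℝ G] (β : G →L[ℝ] F →L[ℝ] ℝ) : (G × G) →L[ℝ] (F × F) →L[ℝ] ℝ :=
  β.bilinearComp (.snd ℝ G G) (.fst ℝ F F) + β.bilinearComp (.fst ℝ G G) (.snd ℝ F F)

theorem bilinT_apply {F G : Type*} [NormedAddCommGroup F] [NormedSpace ℝ F]
    [NormedAddCommGroup G] [NormedSpace ℝ G] (β : G →L[ℝ] F →L[ℝ] ℝ) (g : G × G) (f : F × F) :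
    bilinT β g f = β g.2 f.1 + β g.1 f.2 := rfl

/-- The iterated tangent lift of a bilinear form. -/
def bilinIter {F G : Type u} [NormedAddCommGroup F] [NormedSpace ℝ F] [NormedAddCommGroup G]
    [NormedSpace ℝ G] (β : G →L[ℝ] F →L[ℝ] ℝ) :
    ∀ k : ℕ, JetModel k G →L[ℝ] JetModel k F →L[ℝ] ℝ
  | 0 => β
  | k + 1 => bilinT (bilinIter β k)

namespace VBChart

variable {σ : VBData M E D} {U : Set M} {F G : Type u} [NormedAddCommGroup F]
    [NormedSpace ℝ F] [NormedAddCommGroup G] [NormedSpace ℝ G] {hE : FibreChart σ.pE U F}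
    {hD : FibreChart σ.pD U G} {β : G →L[ℝ] F →L[ℝ] ℝ} (c : VBChart σ hE hD β)

include c

theorem add_eq {a b : E} (ha : σ.pE a ∈ U) (hab : σ.pE a = σ.pE b) :
    σ.add a b = hE.s (σ.pE a) (hE.y a + hE.y b) :=
  hE.ext (by rw [c.p_add a b ha hab]; exact ha) (by rw [c.p_add a b ha hab, hE.p_s _ ha])
    (by rw [c.y_add a b ha hab, hE.y_s _ ha])

theorem smul_eq (r : ℝ) {a : E} (ha : σ.pE a ∈ U) :
    σ.smul r a = hE.s (σ.pE a) (r • hE.y a) :=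
  hE.ext (by rw [c.p_smul r a ha]; exact ha) (by rw [c.p_smul r a ha, hE.p_s _ ha])
    (by rw [c.y_smul r a ha, hE.y_s _ ha])

theorem contMDiffOn_smul (r : ℝ) : ContMDiffOn E.I E.I ∞ (σ.smul r) (σ.pE ⁻¹' U) := by
  have h1 : ContMDiffOn E.I (M.I.prod 𝓘(ℝ, F)) ∞ (fun a : E => (σ.pE a, r • hE.y a))
      (σ.pE ⁻¹' U) := by
    refine hE.smooth_p.contMDiffOn.prodMk ?_
    exact (contDiff_const_smul r (F := F)).contMDiff.comp_contMDiffOn hE.smooth_y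
  refine (hE.smooth_s.comp h1 fun a ha => ⟨ha, mem_univ _⟩).congr fun a ha => c.smul_eq r ha

/-- The sum of two curves over the same curve, near a point over the chart. -/
theorem vel_add {c₁ c₂ : ℝ → E} (h₁ : SmoothCurve E c₁) (h₂ : SmoothCurve E c₂)
    (h : ∀ t, σ.pE (c₁ t) = σ.pE (c₂ t)) {t : ℝ} (hU : σ.pE (c₁ t) ∈ U) :
    tmap σ.pE (vel (fun t => σ.add (c₁ t) (c₂ t)) t) = tmap σ.pE (vel c₁ t) ∧
      vlift hE.y (vel (fun t => σ.add (c₁ t) (c₂ t)) t) =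
        vlift hE.y (vel c₁ t) + vlift hE.y (vel c₂ t) := by
  have hnear : ∀ᶠ t in 𝓝 t, σ.pE (c₁ t) ∈ U :=
    (hE.smooth_p.continuous.comp (ContMDiff.continuous h₁)).continuousAt.preimage_mem_nhds
      (hE.isOpen.mem_nhds hU)
  have hU₂ : σ.pE (c₂ t) ∈ U := h t ▸ hU
  have hd1 := hE.mdiff_y hU
  have hd2 := hE.mdiff_y hU₂
  have hy1 : DifferentiableAt ℝ (fun t => hE.y (c₁ t)) t :=
    (hd1.comp t (h₁.mdiff t)).differentiableAt
  have hy2 : DifferentiableAt ℝ (fun t => hE.y (c₂ t)) t :=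
    (hd2.comp t (h₂.mdiff t)).differentiableAt
  have heq : (fun t => σ.add (c₁ t) (c₂ t)) =ᶠ[𝓝 t]
      fun t => hE.s (σ.pE (c₁ t)) (hE.y (c₁ t) + hE.y (c₂ t)) := by
    filter_upwards [hnear] with t ht using c.add_eq ht (h t)
  have hmd : MDifferentiableAt 𝓘(ℝ, ℝ) E.I (fun t => σ.add (c₁ t) (c₂ t)) t := by
    have h0 : MDifferentiableAt 𝓘(ℝ, ℝ) (M.I.prod 𝓘(ℝ, F))
        (fun t => (σ.pE (c₁ t), hE.y (c₁ t) + hE.y (c₂ t))) t :=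
      ((hE.mdiff_p _).comp t (h₁.mdiff t)).prodMk (hy1.add hy2).mdifferentiableAt
    have h1 : MDifferentiableAt 𝓘(ℝ, ℝ) E.I
        (fun t => hE.s (σ.pE (c₁ t)) (hE.y (c₁ t) + hE.y (c₂ t))) t :=
      (hE.mdiff_s hU _).comp t h0
    exact h1.congr_of_eventuallyEq heq
  have hU' : σ.pE (σ.add (c₁ t) (c₂ t)) ∈ U := by rw [c.p_add _ _ hU (h t)]; exact hU
  constructor
  · rw [← vel_comp t (hE.mdiff_p _) hmd, ← vel_comp t (hE.mdiff_p _) (h₁.mdiff t)]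
    exact vel_congr (by filter_upwards [hnear] with t ht using c.p_add _ _ ht (h t))
  · rw [vlift_vel (hE.mdiff_y hU') hmd, vlift_vel hd1 (h₁.mdiff t), vlift_vel hd2 (h₂.mdiff t)]
    refine Prod.ext (c.y_add _ _ hU (h t)) ?_
    have : (fun t => hE.y (σ.add (c₁ t) (c₂ t))) =ᶠ[𝓝 t]
        fun t => hE.y (c₁ t) + hE.y (c₂ t) := by
      filter_upwards [hnear] with t ht using c.y_add _ _ ht (h t)
    exact this.deriv_eq.trans (deriv_fun_add hy1 hy2)

/-- Near t the pairing is β of the fibre coordinates, so the product rule gives the lifted form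
`bilinT`. -/
theorem deriv_pair {ξ : ℝ → D} {e : ℝ → E} (hξ : SmoothCurve D ξ) (he : SmoothCurve E e)
    (h : ∀ t, σ.pD (ξ t) = σ.pE (e t)) {t : ℝ} (hU : σ.pE (e t) ∈ U) :
    deriv (fun t => σ.pair (ξ t) (e t)) t =
      bilinT β (vlift hD.y (vel ξ t)) (vlift hE.y (vel e t)) := by
  have hnear : ∀ᶠ t in 𝓝 t, σ.pE (e t) ∈ U :=
    (hE.smooth_p.continuous.comp (ContMDiff.continuous he)).continuousAt.preimage_mem_nhds
      (hE.isOpen.mem_nhds hU)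
  have hU₂ : σ.pD (ξ t) ∈ U := h t ▸ hU
  have hd1 := hE.mdiff_y hU
  have hd2 := hD.mdiff_y hU₂
  have hy1 : DifferentiableAt ℝ (fun t => hE.y (e t)) t :=
    (hd1.comp t (he.mdiff t)).differentiableAt
  have hy2 : DifferentiableAt ℝ (fun t => hD.y (ξ t)) t :=
    (hd2.comp t (hξ.mdiff t)).differentiableAt
  have heq : (fun t => σ.pair (ξ t) (e t)) =ᶠ[𝓝 t] fun t => β (hD.y (ξ t)) (hE.y (e t)) := by
    filter_upwards [hnear] with t ht using c.pair_eq _ _ ht (h t)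
  rw [heq.deriv_eq, vlift_vel hd1 (he.mdiff t), vlift_vel hd2 (hξ.mdiff t), bilinT_apply]
  have h3 : HasDerivAt (fun t => β (hD.y (ξ t))) (β (deriv (fun t => hD.y (ξ t)) t)) t :=
    β.hasFDerivAt.comp_hasDerivAt t hy2.hasDerivAt
  exact (h3.clm_apply hy1.hasDerivAt).deriv

/-- The tangent lift of a vector bundle chart. -/
theorem T [M.I.Boundaryless] : VBChart σ.T hE.T hD.T (bilinT β) := by
  have hadd : ∀ a b : E.T, tmap σ.pE a ∈ Mfd.base ⁻¹' U → tmap σ.pE a = tmap σ.pE b →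
      tmap σ.pE (σ.T.add a b) = tmap σ.pE a ∧
        vlift hE.y (σ.T.add a b) = vlift hE.y a + vlift hE.y b := by
    intro a b ha hab
    -- `σ.T.add` is defined by chosen curves over a common base curve. Such curves exist here, and
    -- `vel_add` expresses the result through a and b alone, so the choice does not matter. The
    -- pairing below is handled in the same way.
    obtain ⟨x, hx, hxU, hv⟩ := exists_curve_vel_eq (tmap σ.pE a) hE.isOpen ha
    obtain ⟨c₁, hc₁, hp₁, hv₁⟩ := hE.exists_curve_over hx hxU hv.symm
    obtain ⟨c₂, hc₂, hp₂, hv₂⟩ := hE.exists_curve_over hx hxU (hab.symm.trans hv.symm)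
    have hex : ∃ c : (ℝ → E) × (ℝ → E), SmoothCurve E c.1 ∧ SmoothCurve E c.2 ∧
        (∀ t, σ.pE (c.1 t) = σ.pE (c.2 t)) ∧ vel c.1 0 = a ∧ vel c.2 0 = b :=
      ⟨(c₁, c₂), hc₁, hc₂, fun t => (hp₁ t).trans (hp₂ t).symm, hv₁, hv₂⟩
    obtain ⟨g1, g2, g3, g4, g5⟩ := hex.choose_spec
    have hU : σ.pE (hex.choose.1 0) ∈ U := by
      have : σ.pE (Mfd.base (vel hex.choose.1 0)) ∈ U := by rw [g4]; exact ha
      exact this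
    have := c.vel_add g1 g2 g3 hU
    rw [g4, g5] at this
    have hdef : σ.T.add a b = vel (fun t => σ.add (hex.choose.1 t) (hex.choose.2 t)) 0 :=
      dif_pos hex
    rw [hdef]; exact this
  have hsmul : ∀ (r : ℝ) (a : E.T), tmap σ.pE a ∈ Mfd.base ⁻¹' U →
      tmap σ.pE (σ.T.smul r a) = tmap σ.pE a ∧
        vlift hE.y (σ.T.smul r a) = r • vlift hE.y a := by
    intro r a ha
    have hmd : MDifferentiableAt E.I E.I (σ.smul r) (Mfd.base a) :=
      ((c.contMDiffOn_smul r).contMDiffAt (hE.isOpen_total.mem_nhds ha)).mdifferentiableAt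
        (by simp)
    have hU : σ.pE (σ.smul r (Mfd.base a)) ∈ U := by
      rw [c.p_smul r (Mfd.base a) ha]; exact ha
    constructor
    · change tmap σ.pE (tmap (σ.smul r) a) = _
      rw [← tmap_comp a (hE.mdiff_p _) hmd]
      exact tmap_congr a (by
        filter_upwards [hE.isOpen_total.mem_nhds ha] with e he using c.p_smul r e he)
    · change vlift hE.y (tmap (σ.smul r) a) = _
      rw [vlift_tmap a (hE.mdiff_y hU) hmd,
        vlift_congr (y' := fun e => r • hE.y e) a (by
          filter_upwards [hE.isOpen_total.mem_nhds ha] with e he using c.y_smul r e he)]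
      refine Prod.ext rfl ?_
      exact congrArg (fun A : E.V →L[ℝ] F => A a.2) (const_smul_mfderiv (hE.mdiff_y ha) r)
  refine ⟨fun a b ha hab => (hadd a b ha hab).1, fun a b ha hab => (hadd a b ha hab).2,
    fun r a ha => (hsmul r a ha).1, fun r a ha => (hsmul r a ha).2, ?_, ?_⟩
  · intro d a ha hda
    obtain ⟨x, hx, hxU, hv⟩ := exists_curve_vel_eq (tmap σ.pE a) hE.isOpen ha
    obtain ⟨c₁, hc₁, hp₁, hv₁⟩ := hE.exists_curve_over hx hxU hv.symm
    obtain ⟨c₂, hc₂, hp₂, hv₂⟩ := hD.exists_curve_over hx hxU (hda.trans hv.symm)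
    have hex : ∃ c : (ℝ → D) × (ℝ → E), SmoothCurve D c.1 ∧ SmoothCurve E c.2 ∧
        (∀ t, σ.pD (c.1 t) = σ.pE (c.2 t)) ∧ vel c.1 0 = d ∧ vel c.2 0 = a :=
      ⟨(c₂, c₁), hc₂, hc₁, fun t => (hp₂ t).trans (hp₁ t).symm, hv₂, hv₁⟩
    obtain ⟨g1, g2, g3, g4, g5⟩ := hex.choose_spec
    have hU : σ.pE (hex.choose.2 0) ∈ U := by
      have : σ.pE (Mfd.base (vel hex.choose.2 0)) ∈ U := by rw [g5]; exact ha
      exact this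
    have h1 := c.deriv_pair g1 g2 g3 hU
    rw [g4, g5] at h1
    have hdef : σ.T.pair d a = deriv (fun t => σ.pair (hex.choose.1 t) (hex.choose.2 t)) 0 :=
      dif_pos hex
    rw [hdef]; exact h1
  · rintro ⟨f, f'⟩ hf
    -- Vectors (0, g) detect the first component and vectors (g, 0) the second.
    have h1 : f = 0 := c.sep f fun g => by simpa [bilinT_apply] using hf (0, g)
    have h2 : f' = 0 := c.sep f' fun g => by simpa [bilinT_apply] using hf (g, 0)
    rw [h1, h2]; rfl

end VBChart

theorem VBData.iter_pE (σ : VBData M E D) (k : ℕ) : (σ.iter k).pE = iterMap k σ.pE := by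
  induction k with
  | zero => rfl
  | succ k ih => exact congrArg tmap ih

theorem VBData.iter_pD (σ : VBData M E D) (k : ℕ) : (σ.iter k).pD = iterMap k σ.pD := by
  induction k with
  | zero => rfl
  | succ k ih => exact congrArg tmap ih

section Iter

variable {σ : VBData M E D} {U : Set M} {F G : Type u} [NormedAddCommGroup F]
    [NormedSpace ℝ F] [NormedAddCommGroup G] [NormedSpace ℝ G]

/-- The iterated tangent lift of a trivialization of `σ`. -/
def FibreChart.iterE (hE : FibreChart σ.pE U F) :
    ∀ k : ℕ, FibreChart (σ.iter k).pE (overSet k U) (JetModel k F)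
  | 0 => hE
  | k + 1 => (hE.iterE k).T

/-- The iterated tangent lift of a trivialization of `σ*`. -/
def FibreChart.iterD (hD : FibreChart σ.pD U G) :
    ∀ k : ℕ, FibreChart (σ.iter k).pD (overSet k U) (JetModel k G)
  | 0 => hD
  | k + 1 => (hD.iterD k).T

theorem FibreChart.iterE_y (hE : FibreChart σ.pE U F) (k : ℕ) :
    (hE.iterE k).y = iterLift hE.y k := by
  induction k with
  | zero => rfl
  | succ k ih => exact congrArg vlift ih

theorem VBChart.iter [M.I.Boundaryless] {hE : FibreChart σ.pE U F} {hD : FibreChart σ.pD U G}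
    {β : G →L[ℝ] F →L[ℝ] ℝ} (c : VBChart σ hE hD β) :
    ∀ k, VBChart (σ.iter k) (hE.iterE k) (hD.iterD k) (bilinIter β k)
  | 0 => c
  | k + 1 => (c.iter k).T

end Iter

/-! ### The operator (∂_s - ∂_t)^k at the origin. -/

section Ups

/-- The value at the origin of `(∂_s - ∂_t)^k`. -/
def upsCoef {F : Type*} [NormedAddCommGroup F] [NormedSpace ℝ F] (k : ℕ) (y : ℕ → ℕ → F) : F :=
  ∑ a ∈ Finset.range (k + 1), ((-1) ^ a * (k.choose a : ℝ)) • y a (k - a)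

variable {G F : Type*} [NormedAddCommGroup G] [NormedSpace ℝ G]
    [NormedAddCommGroup F] [NormedSpace ℝ F]

/-- This is `iteratedDeriv_diag` with ε = -1: the alternating binomial sum is a derivative along the
antidiagonal. -/
theorem upsCoef_dd {y : ℝ → ℝ → F} (hy : ContDiff ℝ ∞ (fun p : ℝ × ℝ => y p.1 p.2)) (k : ℕ) :
    upsCoef k (fun a b => dd a b y 0 0) = iteratedDeriv k (fun r => y (-r) r) 0 := by
  have := iteratedDeriv_diag hy (-1) k 0
  simp only [neg_mul, one_mul, neg_zero] at this
  exact this.symm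

/-- On the antidiagonal t + s = 0, so u(t + s) is the constant u(0) and the linear map B (u 0)
commutes with the derivative. This is the reason why Υ sees only the base point of a k-velocity. -/
theorem upsCoef_pairing (B : G →L[ℝ] F →L[ℝ] ℝ) {u : ℝ → G} {y : ℝ → ℝ → F}
    (hu : ContDiff ℝ ∞ u) (hy : ContDiff ℝ ∞ (fun p : ℝ × ℝ => y p.1 p.2)) (k : ℕ) :
    upsCoef k (fun a b => dd a b (fun t s => B (u (t + s)) (y t s)) 0 0) =
      B (u 0) (upsCoef k fun a b => dd a b y 0 0) := by
  have h : ContDiff ℝ ∞ (fun p : ℝ × ℝ => B (u (p.1 + p.2)) (y p.1 p.2)) :=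
    (B.contDiff.comp (hu.comp (by fun_prop))).clm_apply hy
  rw [upsCoef_dd h, upsCoef_dd hy]
  simp only [neg_add_cancel]
  have h2 : ContDiff ℝ ∞ fun r : ℝ => y (-r) r :=
    hy.comp (f := fun r : ℝ => (-r, r)) (by fun_prop)
  rw [iteratedDeriv_clm _ h2]

end Ups

/-! ### Pairings under the identification T^{(m)}T^{(n)} = T^{(m+n)}. -/

section Transport

variable {M E D : Mfd.{u}}

/-- The lifted bundle data are compared by `HEq` and transported by substitution, as in
`merge_iterMap`. -/
theorem pair_merge (σ : VBData M E D) {m n k : ℕ} (h : m + n = k) (A : iterT m (iterT n D))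
    (B : iterT m (iterT n E)) :
    (σ.iter k).pair (merge h A) (merge h B) = ((σ.iter n).iter m).pair A B := by
  have key : ∀ (A B C A' B' C' : Mfd.{u}) (_ : A = A') (b : B = B') (c : C = C')
      (σ₁ : VBData A B C) (σ₂ : VBData A' B' C'), HEq σ₁ σ₂ → ∀ x y,
      σ₂.pair (Mfd.cast c x) (Mfd.cast b y) = σ₁.pair x y := by
    intro A B C A' B' C' a b c σ₁ σ₂ h x y
    subst a; subst b; subst c; cases h; rfl
  have keyT : ∀ (A B C A' B' C' : Mfd.{u}) (_ : A = A') (_ : B = B') (_ : C = C')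
      (σ₁ : VBData A B C) (σ₂ : VBData A' B' C'), HEq σ₁ σ₂ → HEq σ₁.T σ₂.T := by
    intro A B C A' B' C' a b c σ₁ σ₂ h
    subst a; subst b; subst c; cases h; rfl
  have hh : HEq ((σ.iter n).iter m) (σ.iter k) := by
    clear A B
    subst h
    induction m with
    | zero => rw [Nat.zero_add]; rfl
    | succ m ih =>
      rw [Nat.succ_add]
      exact keyT _ _ _ _ _ _ (iterT_iterT M rfl) (iterT_iterT E rfl) (iterT_iterT D rfl) _ _ ih
  exact key _ _ _ _ _ _ (iterT_iterT M h) (iterT_iterT E h) (iterT_iterT D h) _ _ hh A B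

end Transport

/-! ### Curves and families representing velocities. -/

section Rep

variable {N : Mfd.{u}} {W : Type*} [NormedAddCommGroup W] [NormedSpace ℝ W]

theorem SmoothCurve.reparam {c : ℝ → N} (hc : SmoothCurve N c) {θ : ℝ → ℝ} (hθ : ContDiff ℝ ∞ θ) :
    SmoothCurve N fun t => c (θ t) := ContMDiff.comp hc hθ.contMDiff

theorem SmoothCurve.exists_reparam {c : ℝ → N} (hc : SmoothCurve N c) {O : Set N} (hO : IsOpen O)
    (h0 : c 0 ∈ O) : ∃ c' : ℝ → N, SmoothCurve N c' ∧ (∀ t, c' t ∈ O) ∧ c' =ᶠ[𝓝 0] c := by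
  obtain ⟨θ, h1, h2, h3⟩ := exists_cutoff
    ((ContMDiff.continuous hc).continuousAt.preimage_mem_nhds (hO.mem_nhds h0))
  exact ⟨_, hc.reparam h1, h3, h2.mono fun t ht => congrArg c ht⟩

/-- A k-velocity comes from a curve, whose coordinates form a symmetric jet. It is thus recovered
from k + 1 coefficients, which fails for general vectors of T^{(k)}N. -/
theorem iterLift_of_mem_vel {y : N → W} {O : Set N} (hO : IsOpen O)
    (hy : ContMDiffOn N.I 𝓘(ℝ, W) ∞ y O) {k : ℕ} {X : iterT k N} (hX : X ∈ Vel k (univ : Set N))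
    (hXO : X ∈ overSet k O) :
    iterLift y k X = symJet k fun i => jetCoef k i (iterLift y k X) := by
  obtain ⟨c, hc, -, rfl⟩ := hX
  rw [mem_overSet, pt_jet] at hXO
  obtain ⟨c', hc', hO', he⟩ := hc.exists_reparam hO hXO
  rw [← jet_congr_at k he, iterLift_jet hO hy hc' hO']
  exact symJet_congr fun i hi =>
    (jetCoef_symJet k i hi fun i => iteratedDeriv i (fun t => y (c' t)) 0).symm

theorem family_curve {g : ℝ → ℝ → N} (hg : ContMDiff 𝓘(ℝ, ℝ × ℝ) N.I ∞ fun p : ℝ × ℝ => g p.1 p.2)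
    (t : ℝ) : SmoothCurve N (g t) :=
  ContMDiff.comp (f := fun s : ℝ => (t, s)) hg (contDiff_const.prodMk contDiff_id).contMDiff

theorem family_curve_left {g : ℝ → ℝ → N}
    (hg : ContMDiff 𝓘(ℝ, ℝ × ℝ) N.I ∞ fun p : ℝ × ℝ => g p.1 p.2) (s : ℝ) :
    SmoothCurve N fun t => g t s :=
  ContMDiff.comp (f := fun t : ℝ => (t, s)) hg (contDiff_id.prodMk contDiff_const).contMDiff

theorem jet_shift {x : ℝ → N} (hx : SmoothCurve N x) (l : ℕ) (t : ℝ) :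
    jet l (fun s => x (t + s)) 0 = jet l x t := by
  simp only [add_comm t]
  rw [jet_add hx]; simp

theorem family_jet_smooth {g : ℝ → ℝ → N}
    (hg : ContMDiff 𝓘(ℝ, ℝ × ℝ) N.I ∞ fun p : ℝ × ℝ => g p.1 p.2) (l : ℕ) :
    SmoothCurve (iterT l N) fun t => jet l (g t) 0 := contMDiff_jet_param hg l 0

theorem jet_jet_mem_vel {g : ℝ → ℝ → N}
    (hg : ContMDiff 𝓘(ℝ, ℝ × ℝ) N.I ∞ fun p : ℝ × ℝ => g p.1 p.2) (k l : ℕ) :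
    jet k (fun t => jet l (g t) 0) 0 ∈ Vel k (Vel l (univ : Set N)) :=
  ⟨_, family_jet_smooth hg l, fun t => ⟨g t, family_curve hg t, fun _ => mem_univ _, rfl⟩, rfl⟩

theorem trunc₂_jet_jet {g : ℝ → ℝ → N}
    (hg : ContMDiff 𝓘(ℝ, ℝ × ℝ) N.I ∞ fun p : ℝ × ℝ => g p.1 p.2) {k l : ℕ} (m n : ℕ)
    (hm : m ≤ k) (hn : n ≤ l) :
    trunc₂ m n hm hn (jet k (fun t => jet l (g t) 0) 0) = jet m (fun t => jet n (g t) 0) 0 := by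
  unfold trunc₂
  rw [iterMap_jet (contMDiff_trunc l n hn) (family_jet_smooth hg l), trunc_jet]
  simp only [trunc_jet]

theorem iterMap_jet_jet {N' : Mfd.{u}} {f : N → N'} (hf : ContMDiff N.I N'.I ∞ f) {g : ℝ → ℝ → N}
    (hg : ContMDiff 𝓘(ℝ, ℝ × ℝ) N.I ∞ fun p : ℝ × ℝ => g p.1 p.2) (k l : ℕ) :
    iterMap k (iterMap l f) (jet k (fun t => jet l (g t) 0) 0) =
      jet k (fun t => jet l (fun s => f (g t s)) 0) 0 := by
  rw [iterMap_jet (contMDiff_iterMap hf l) (family_jet_smooth hg l)]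
  simp only [fun t => iterMap_jet hf (family_curve hg t) l 0]

end Rep

namespace FibreChart

variable {M E : Mfd.{u}} {p : E → M} {U : Set M} {F : Type u} [NormedAddCommGroup F]
    [NormedSpace ℝ F] (h : FibreChart p U F)

theorem jet_ext {k : ℕ} {X X' : iterT k E} (hU : iterMap k p X ∈ overSet k U)
    (hp : iterMap k p X = iterMap k p X') (hy : iterLift h.y k X = iterLift h.y k X') : X = X' :=
  (h.iter k).ext hU hp (by rw [h.iter_y]; exact hy)

theorem jet_jet_ext {k l : ℕ} {X X' : iterT k (iterT l E)}
    (hU : iterMap k (iterMap l p) X ∈ overSet k (overSet l U))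
    (hp : iterMap k (iterMap l p) X = iterMap k (iterMap l p) X')
    (hy : iterLift (iterLift h.y l) k X = iterLift (iterLift h.y l) k X') : X = X' :=
  (h.iter l).jet_ext hU hp (by rw [h.iter_y]; exact hy)

include h in
/-- A `k`-velocity over the `k`-velocity of `x` is that of a curve over `x`. -/
theorem exists_jet_over {x : ℝ → M} (hx : SmoothCurve M x) (hxU : ∀ t, x t ∈ U) {k : ℕ}
    {X : iterT k E} (hX : X ∈ Vel k (univ : Set E)) (hp : iterMap k p X = jet k x 0) :
    ∃ e : ℝ → E, SmoothCurve E e ∧ (∀ t, p (e t) = x t) ∧ jet k e 0 = X := by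
  obtain ⟨c, hc, -, rfl⟩ := hX
  have h0 : p (c 0) = x 0 := by
    have := congrArg (pt k) hp
    rwa [pt_iterMap, pt_jet, pt_jet] at this
  obtain ⟨c', hc', hO', he⟩ := hc.exists_reparam h.isOpen_total
    (show c 0 ∈ p ⁻¹' U by rw [mem_preimage, h0]; exact hxU 0)
  rw [← jet_congr_at k he] at hp ⊢
  have hyc := hc'.contDiff_comp h.smooth_y hO'
  -- The fibre coordinate of the given curve is kept and its base curve replaced by x. The two base
  -- curves have the same k-jet, so the k-velocity does not change.
  have hs := h.smoothCurve_s hx hxU hyc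
  have hps : ∀ t, p (h.s (x t) (h.y (c' t))) = x t := fun t => h.p_s _ (hxU t) _
  refine ⟨_, hs, hps, ?_⟩
  have hp2 : iterMap k p (jet k (fun t => h.s (x t) (h.y (c' t))) 0) = jet k x 0 := by
    rw [iterMap_jet h.smooth_p hs]; simp only [hps]
  refine h.jet_ext ?_ (hp2.trans hp.symm) ?_
  · rw [hp2]; exact jet_mem_overSet k (hxU 0)
  · rw [iterLift_jet h.isOpen_total h.smooth_y hs fun t => by
        rw [mem_preimage, hps]; exact hxU t,
      iterLift_jet h.isOpen_total h.smooth_y hc' hO']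
    simp only [fun t => h.y_s _ (hxU t)]

end FibreChart

/-! ### Families representing semi-holonomic vectors. -/

section IsRep

variable {M E D : Mfd.{u}}

/-- The semi-holonomic vector `Φ` is represented by the family `g` over `x (t + s)`. -/
structure IsRep (σ : VBData M E D) (U : Set M) (k l : ℕ) (Φ : iterT k (iterT l E)) (x : ℝ → M)
    (g : ℝ → ℝ → E) : Prop where
  smooth_x : SmoothCurve M x
  x_mem : ∀ t, x t ∈ U
  smooth_g : ContMDiff 𝓘(ℝ, ℝ × ℝ) E.I ∞ fun p : ℝ × ℝ => g p.1 p.2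
  pE_g : ∀ t s, σ.pE (g t s) = x (t + s)
  eq : jet k (fun t => jet l (g t) 0) 0 = Φ

variable {σ : VBData M E D} {U : Set M} {F G : Type u} [NormedAddCommGroup F]
    [NormedSpace ℝ F] [NormedAddCommGroup G] [NormedSpace ℝ G]

namespace IsRep

variable {k l : ℕ} {Φ : iterT k (iterT l E)} {x : ℝ → M} {g : ℝ → ℝ → E}

theorem base (R : IsRep σ U k l Φ x g) (hp : ContMDiff E.I M.I ∞ σ.pE) :
    iterMap k (iterMap l σ.pE) Φ = jet k (jet l x) 0 := by
  rw [← R.eq, iterMap_jet_jet hp R.smooth_g]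
  simp only [R.pE_g, jet_shift R.smooth_x]

theorem mem_semiHol (R : IsRep σ U k l Φ x g) (hp : ContMDiff E.I M.I ∞ σ.pE) :
    Φ ∈ σ.SemiHol k l := by
  refine ⟨?_, x, R.smooth_x, (R.base hp).symm⟩
  rw [← R.eq]; exact jet_jet_mem_vel R.smooth_g k l

theorem g_mem (R : IsRep σ U k l Φ x g) (t s : ℝ) : g t s ∈ σ.pE ⁻¹' U := by
  rw [mem_preimage, R.pE_g]; exact R.x_mem _

theorem contDiff_y (R : IsRep σ U k l Φ x g) (hE : FibreChart σ.pE U F) :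
    ContDiff ℝ ∞ fun p : ℝ × ℝ => hE.y (g p.1 p.2) :=
  contDiff_comp_family hE.smooth_y R.smooth_g fun p => R.g_mem p.1 p.2

theorem lift_eq (R : IsRep σ U k l Φ x g) (hE : FibreChart σ.pE U F) :
    iterLift (iterLift hE.y l) k Φ =
      symJet k fun a => symJet l fun b => dd a b (fun t s => hE.y (g t s)) 0 0 := by
  rw [← R.eq]
  exact iterLift_jet_jet hE.isOpen_total hE.smooth_y R.smooth_g R.g_mem k l

theorem coef_eq (R : IsRep σ U k l Φ x g) (hE : FibreChart σ.pE U F) {a b : ℕ} (ha : a ≤ k)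
    (hb : b ≤ l) : jetCoef l b (jetCoef k a (iterLift (iterLift hE.y l) k Φ)) =
      dd a b (fun t s => hE.y (g t s)) 0 0 := by
  rw [R.lift_eq hE, jetCoef_symJet k a ha, jetCoef_symJet l b hb]

theorem of_chart (hE : FibreChart σ.pE U F) (hx : SmoothCurve M x) (hxU : ∀ t, x t ∈ U)
    {f : ℝ → ℝ → F} (hf : ContDiff ℝ ∞ fun p : ℝ × ℝ => f p.1 p.2) (k l : ℕ) :
    IsRep σ U k l (jet k (fun t => jet l (fun s => hE.s (x (t + s)) (f t s)) 0) 0) x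
      (fun t s => hE.s (x (t + s)) (f t s)) where
  smooth_x := hx
  x_mem := hxU
  smooth_g := hE.contMDiff_s (x := fun p : ℝ × ℝ => x (p.1 + p.2))
    (ContMDiff.comp hx (by fun_prop : ContDiff ℝ ∞ fun p : ℝ × ℝ => p.1 + p.2).contMDiff)
    (fun p => hxU _) hf
  pE_g t s := hE.p_s _ (hxU _) _
  eq := rfl

/-- Φ is the jet of a curve C in T^l E, whose fibre coefficients are smooth functions of t. Taylor
polynomials in s with these coefficients give f(t, s), and the chart places it over x(t + s). The
base curve can be prescribed, so that several vectors over one base vector get representatives over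
the same curve. -/
theorem exists_over (hE : FibreChart σ.pE U F) (hΦ : Φ ∈ Vel k (Vel l (univ : Set E)))
    (hx : SmoothCurve M x) (hxU : ∀ t, x t ∈ U)
    (hb : iterMap k (iterMap l σ.pE) Φ = jet k (jet l x) 0) :
    ∃ f : ℝ → ℝ → F, ContDiff ℝ ∞ (fun p : ℝ × ℝ => f p.1 p.2) ∧
      IsRep σ U k l Φ x fun t s => hE.s (x (t + s)) (f t s) := by
  obtain ⟨C, hC, hCV, hCΦ⟩ := hΦ
  have hC0 : C 0 ∈ overSet l (σ.pE ⁻¹' U) := by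
    have h1 := congrArg (fun X => pt l (pt (N := iterT l M) k X)) hb
    simp only [pt_jet] at h1
    rw [← hCΦ, pt_iterMap, pt_iterMap, pt_jet] at h1
    rw [mem_overSet, mem_preimage, h1]; exact hxU 0
  have hO := isOpen_overSet hE.isOpen_total l
  have hyl := contMDiffOn_iterLift hE.isOpen_total hE.smooth_y l
  obtain ⟨θ, θs, θid, hθ⟩ := exists_cutoff
    ((ContMDiff.continuous hC).continuousAt.preimage_mem_nhds (hO.mem_nhds hC0))
  have hC' : SmoothCurve (iterT l E) fun t => C (θ t) := hC.reparam θs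
  have hjet : jet k (fun t => C (θ t)) 0 = Φ := by
    rw [← hCΦ]; exact jet_congr_at k (θid.mono fun t ht => congrArg C ht)
  have hyC := hC'.contDiff_comp hyl hθ
  have hcoef : ∀ b, ContDiff ℝ ∞ fun t => jetCoef l b (iterLift hE.y l (C (θ t))) :=
    fun b => (contDiff_jetCoef l b).comp hyC
  have hf := contDiff_tpoly l (c := fun t b => jetCoef l b (iterLift hE.y l (C (θ t))))
    fun b _ => hcoef b
  have R := of_chart hE hx hxU (f := fun t => tpoly l fun b =>
    jetCoef l b (iterLift hE.y l (C (θ t)))) hf k l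
  refine ⟨_, hf, { R with eq := ?_ }⟩
  refine hE.jet_jet_ext ?_ ((R.base hE.smooth_p).trans hb.symm) ?_
  · rw [R.base hE.smooth_p]
    exact jet_mem_overSet k (jet_mem_overSet l (hxU 0))
  · rw [R.lift_eq hE, ← hjet, iterLift_jet hO hyl hC' hθ]
    refine symJet_congr fun a _ => ?_
    -- Each C (θ t) belongs to T^l E, so no coordinate is lost by keeping only l + 1 coefficients.
    have h2 : ∀ t, iterLift hE.y l (C (θ t)) =
        symJet l fun b => jetCoef l b (iterLift hE.y l (C (θ t))) := fun t =>
      iterLift_of_mem_vel hE.isOpen_total hE.smooth_y (hCV _) (hθ t)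
    rw [funext h2, iteratedDeriv_symJet l fun b _ => hcoef b]
    refine symJet_congr fun b hb => ?_
    simp only [fun t s => hE.y_s _ (hxU (t + s))]
    rw [dd_tpoly l a b hb]

theorem exists_of_mem (hE : FibreChart σ.pE U F) (hΦ : Φ ∈ σ.SemiHol k l)
    (hU : σ.pE (pt l (pt (N := iterT l E) k Φ)) ∈ U) :
    ∃ x, ∃ f : ℝ → ℝ → F, ContDiff ℝ ∞ (fun p : ℝ × ℝ => f p.1 p.2) ∧
      IsRep σ U k l Φ x fun t s => hE.s (x (t + s)) (f t s) := by
  obtain ⟨x, hx, hxb⟩ := hΦ.2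
  have h0 : x 0 ∈ U := by
    have h1 := congrArg (fun X => pt l (pt (N := iterT l M) k X)) hxb
    simp only [pt_jet] at h1
    rw [pt_iterMap, pt_iterMap] at h1
    rw [h1]; exact hU
  obtain ⟨x', hx', hO', he⟩ := hx.exists_reparam hE.isOpen h0
  refine ⟨x', exists_over hE hΦ.1 hx' hO' ?_⟩
  rw [← hxb]
  exact (jet_congr_at k (jet_congr l he)).symm

end IsRep

end IsRep

/-! ### Pairings as derivatives, and the values of Υ and Π. -/

section Pairing

variable {M E D : Mfd.{u}} {σ : VBData M E D} {U : Set M} {F G : Type u} [NormedAddCommGroup F]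
    [NormedSpace ℝ F] [NormedAddCommGroup G] [NormedSpace ℝ G]

theorem part_jet_jet {g : ℝ → ℝ → E}
    (hg : ContMDiff 𝓘(ℝ, ℝ × ℝ) E.I ∞ fun p : ℝ × ℝ => g p.1 p.2) {k l : ℕ} (m n p : ℕ)
    (hm : m ≤ k) (hn : n ≤ l) (h : m + n = p) :
    part (jet k (fun t => jet l (g t) 0) 0) m n p hm hn h =
      merge h (jet m (fun t => jet n (g t) 0) 0) := by
  unfold part; rw [trunc₂_jet_jet hg]

theorem IsRep.baseVel_eq {k : ℕ} {Φ : iterT k (iterT k E)} {x : ℝ → M} {g : ℝ → ℝ → E}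
    (R : IsRep σ U k k Φ x g) (hp : ContMDiff E.I M.I ∞ σ.pE) : σ.baseVel k Φ = jet k x 0 := by
  unfold VBData.baseVel
  rw [R.base hp]; exact pt_jet _ _ _

theorem IsRep.basePt_eq {k : ℕ} {Φ : iterT k (iterT k E)} {x : ℝ → M} {g : ℝ → ℝ → E}
    (R : IsRep σ U k k Φ x g) (hp : ContMDiff E.I M.I ∞ σ.pE) : σ.basePt k Φ = x 0 := by
  unfold VBData.basePt
  rw [R.baseVel_eq hp]; exact pt_jet _ _ _

theorem jet_mem_dualVel (hp : ContMDiff D.I M.I ∞ σ.pD) {x : ℝ → M} {ξ : ℝ → D}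
    (hξ : SmoothCurve D ξ) (h : ∀ t, σ.pD (ξ t) = x t) (k : ℕ) :
    jet k ξ 0 ∈ σ.dualVel k (jet k x 0) := by
  refine ⟨⟨ξ, hξ, fun _ => mem_univ _, rfl⟩, ?_⟩
  rw [iterMap_jet hp hξ]; simp only [h]

namespace VBChart

variable {hE : FibreChart σ.pE U F} {hD : FibreChart σ.pD U G} {β : G →L[ℝ] F →L[ℝ] ℝ}
  (c : VBChart σ hE hD β)

include c

theorem lin_eq {v : M} (hv : v ∈ U) (n : ℕ) (a : Fin (n + 1) → ℝ) (e : Fin (n + 1) → E)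
    (he : ∀ j, σ.pE (e j) = v) :
    σ.pE (σ.lin n a e) = v ∧ hE.y (σ.lin n a e) = ∑ j, a j • hE.y (e j) := by
  induction n with
  | zero =>
    have h0 : σ.pE (e 0) ∈ U := by rw [he]; exact hv
    exact ⟨(c.p_smul _ _ h0).trans (he 0), (c.y_smul _ _ h0).trans (by simp)⟩
  | succ n ih =>
    obtain ⟨h1, h2⟩ := ih (fun j => a j.castSucc) (fun j => e j.castSucc) fun j => he _
    have h0 : σ.pE (e (Fin.last (n + 1))) ∈ U := by rw [he]; exact hv
    have h3 := c.p_smul (a (Fin.last (n + 1))) _ h0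
    have h4 : σ.pE (σ.lin n (fun j => a j.castSucc) fun j => e j.castSucc) ∈ U := by
      rw [h1]; exact hv
    have h5 : σ.pE (σ.lin n (fun j => a j.castSucc) fun j => e j.castSucc) =
        σ.pE (σ.smul (a (Fin.last (n + 1))) (e (Fin.last (n + 1)))) := by rw [h1, h3, he]
    refine ⟨(c.p_add _ _ h4 h5).trans h1, (c.y_add _ _ h4 h5).trans ?_⟩
    rw [h2, c.y_smul _ _ h0]
    exact (Fin.sum_univ_castSucc fun j => a j • hE.y (e j)).symm

theorem pair_lin {v : M} (hv : v ∈ U) (n : ℕ) (a : Fin (n + 1) → ℝ) (e : Fin (n + 1) → E)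
    (he : ∀ j, σ.pE (e j) = v) {d : D} (hd : σ.pD d = v) :
    σ.pair d (σ.lin n a e) = ∑ j, a j * σ.pair d (e j) := by
  obtain ⟨h1, h2⟩ := c.lin_eq hv n a e he
  rw [c.pair_eq _ _ (by rw [h1]; exact hv) (hd.trans h1.symm), h2, map_sum]
  refine Finset.sum_congr rfl fun j _ => ?_
  rw [map_smul, c.pair_eq _ _ (by rw [he]; exact hv) (hd.trans (he j).symm)]; rfl

variable [M.I.Boundaryless]

theorem pair_vel {ξ : ℝ → D} {e : ℝ → E} (hξ : SmoothCurve D ξ) (he : SmoothCurve E e)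
    (h : ∀ t, σ.pD (ξ t) = σ.pE (e t)) {t : ℝ} (hU : σ.pE (e t) ∈ U) :
    σ.T.pair (vel ξ t) (vel e t) = deriv (fun t => σ.pair (ξ t) (e t)) t := by
  rw [c.deriv_pair hξ he h hU]
  refine c.T.pair_eq _ _ hU ?_
  change tmap σ.pD _ = tmap σ.pE _
  rw [← vel_comp t (hE.mdiff_p _) (he.mdiff t), ← vel_comp t (hD.mdiff_p _) (hξ.mdiff t)]
  simp only [h]

/-- Each tangent lift of the pairing differentiates once along the pair of curves, by `pair_vel` for
the lifted chart. -/
theorem pair_jet {ξ : ℝ → D} {e : ℝ → E} (hξ : SmoothCurve D ξ) (he : SmoothCurve E e)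
    (h : ∀ t, σ.pD (ξ t) = σ.pE (e t)) (hU : ∀ t, σ.pE (e t) ∈ U) (n : ℕ) (t : ℝ) :
    (σ.iter n).pair (jet n ξ t) (jet n e t) = iteratedDeriv n (fun t => σ.pair (ξ t) (e t)) t := by
  induction n generalizing t with
  | zero => simp; rfl
  | succ n ih =>
    have h1 : ∀ t, (σ.iter n).pE (jet n e t) = jet n (fun t => σ.pE (e t)) t := fun t => by
      rw [VBData.iter_pE, iterMap_jet hE.smooth_p he]
    have h2 : ∀ t, (σ.iter n).pD (jet n ξ t) = jet n (fun t => σ.pE (e t)) t := fun t => by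
      rw [VBData.iter_pD, iterMap_jet hD.smooth_p hξ]; simp only [h]
    have := (c.iter n).pair_vel (hξ.jet n) (he.jet n) (fun t => (h2 t).trans (h1 t).symm) (t := t)
      (by rw [h1]; exact jet_mem_overSet n (hU t))
    refine this.trans ?_
    rw [funext ih, iteratedDeriv_succ]

theorem pair_jet_jet {ξ : ℝ → ℝ → D} {e : ℝ → ℝ → E}
    (hξ : ContMDiff 𝓘(ℝ, ℝ × ℝ) D.I ∞ fun p : ℝ × ℝ => ξ p.1 p.2)
    (he : ContMDiff 𝓘(ℝ, ℝ × ℝ) E.I ∞ fun p : ℝ × ℝ => e p.1 p.2)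
    (h : ∀ t s, σ.pD (ξ t s) = σ.pE (e t s)) (hU : ∀ t s, σ.pE (e t s) ∈ U) (m n : ℕ) :
    ((σ.iter n).iter m).pair (jet m (fun t => jet n (ξ t) 0) 0) (jet m (fun t => jet n (e t) 0) 0) =
      dd m n (fun t s => σ.pair (ξ t s) (e t s)) 0 0 := by
  have h1 : ∀ t, (σ.iter n).pE (jet n (e t) 0) = jet n (fun s => σ.pE (e t s)) 0 := fun t => by
    rw [VBData.iter_pE, iterMap_jet hE.smooth_p (family_curve he t)]
  have h2 : ∀ t, (σ.iter n).pD (jet n (ξ t) 0) = jet n (fun s => σ.pE (e t s)) 0 := fun t => by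
    rw [VBData.iter_pD, iterMap_jet hD.smooth_p (family_curve hξ t)]; simp only [h]
  rw [(c.iter n).pair_jet (family_jet_smooth hξ n) (family_jet_smooth he n)
    (fun t => (h2 t).trans (h1 t).symm)
    (fun t => by rw [h1]; exact jet_mem_overSet n (hU t 0))]
  unfold dd
  simp only [fun t => c.pair_jet (family_curve hξ t) (family_curve he t) (h t) (hU t) n 0]

variable {k : ℕ} {Φ : iterT k (iterT k E)} {x : ℝ → M} {g : ℝ → ℝ → E}

-- Semi-holonomy is used here: the base family is x(t + s), whose jets of all bidegrees (j, n) with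
-- j + n = k merge to j^k x. The parts of Φ therefore lie in one fibre and can be added.
omit [M.I.Boundaryless] c in
theorem part_base (hE : FibreChart σ.pE U F) (R : IsRep σ U k k Φ x g) (j n : ℕ) (hj : j ≤ k)
    (hn : n ≤ k) (h : j + n = k) : (σ.iter k).pE (part Φ j n k hj hn h) = jet k x 0 := by
  rw [VBData.iter_pE, ← R.eq, part_jet_jet R.smooth_g, merge_iterMap,
    iterMap_jet_jet hE.smooth_p R.smooth_g]
  simp only [R.pE_g, jet_shift R.smooth_x, merge_jet]

theorem pE_combine (R : IsRep σ U k k Φ x g) (a : ℕ → ℝ) :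
    (σ.iter k).pE (σ.combine k a Φ) = jet k x 0 :=
  ((c.iter k).lin_eq (jet_mem_overSet k (R.x_mem 0)) k _ _ fun _ => part_base hE R _ _ _ _ _).1

/-- j^k ξ merges from the jet of ξ(t + s) of bidegree (j, n). That family lies over the same base
family as g, so the pairing is differentiated j times in t and n times in s. -/
theorem pair_part (R : IsRep σ U k k Φ x g) {ξ : ℝ → D} (hξ : SmoothCurve D ξ)
    (h : ∀ t, σ.pD (ξ t) = x t) (j n : ℕ) (hj : j ≤ k) (hn : n ≤ k) (hk : j + n = k) :
    (σ.iter k).pair (jet k ξ 0) (part Φ j n k hj hn hk) =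
      dd j n (fun t s => σ.pair (ξ (t + s)) (g t s)) 0 0 := by
  have h1 : jet k ξ 0 = merge hk (jet j (fun t => jet n (fun s => ξ (t + s)) 0) 0) := by
    simp only [jet_shift hξ, merge_jet]
  have h2 : ContMDiff 𝓘(ℝ, ℝ × ℝ) D.I ∞ fun p : ℝ × ℝ => ξ (p.1 + p.2) :=
    ContMDiff.comp hξ (by fun_prop : ContDiff ℝ ∞ fun p : ℝ × ℝ => p.1 + p.2).contMDiff
  rw [h1, ← R.eq, part_jet_jet R.smooth_g, pair_merge,
    c.pair_jet_jet (ξ := fun t s => ξ (t + s)) h2 R.smooth_g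
      (fun t s => (h _).trans (R.pE_g t s).symm) R.g_mem]

theorem pair_combine (R : IsRep σ U k k Φ x g) {ξ : ℝ → D} (hξ : SmoothCurve D ξ)
    (h : ∀ t, σ.pD (ξ t) = x t) (a : ℕ → ℝ) :
    (σ.iter k).pair (jet k ξ 0) (σ.combine k a Φ) = ∑ j ∈ Finset.range (k + 1),
      a j * dd j (k - j) (fun t s => σ.pair (ξ (t + s)) (g t s)) 0 0 := by
  have hd : (σ.iter k).pD (jet k ξ 0) = jet k x 0 := by
    rw [VBData.iter_pD, iterMap_jet hD.smooth_p hξ]; simp only [h]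
  unfold VBData.combine
  rw [(c.iter k).pair_lin (jet_mem_overSet k (R.x_mem 0)) k _ _
    (fun _ => part_base hE R _ _ _ _ _) hd, Finset.sum_range]
  exact Finset.sum_congr rfl fun j _ => by rw [c.pair_part R hξ h]

omit [M.I.Boundaryless] in
theorem pair_family (R : IsRep σ U k k Φ x g) {ξ : ℝ → D} (h : ∀ t, σ.pD (ξ t) = x t) (t s : ℝ) :
    σ.pair (ξ (t + s)) (g t s) = β (hD.y (ξ (t + s))) (hE.y (g t s)) :=
  c.pair_eq _ _ (R.g_mem t s) ((h _).trans (R.pE_g t s).symm)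

omit [M.I.Boundaryless] c in
theorem contDiff_dual (hD : FibreChart σ.pD U G) (R : IsRep σ U k k Φ x g) {ξ : ℝ → D}
    (hξ : SmoothCurve D ξ) (h : ∀ t, σ.pD (ξ t) = x t) : ContDiff ℝ ∞ fun t => hD.y (ξ t) :=
  hξ.contDiff_comp hD.smooth_y fun t => by rw [mem_preimage, h]; exact R.x_mem t

omit [M.I.Boundaryless] c in
theorem exists_dual_jet (hE : FibreChart σ.pE U F) (hD : FibreChart σ.pD U G) (R : IsRep σ U k k Φ x g) {Ψ : iterT k D}
    (hΨ : Ψ ∈ σ.dualVel k (σ.baseVel k Φ)) :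
    ∃ ξ : ℝ → D, SmoothCurve D ξ ∧ (∀ t, σ.pD (ξ t) = x t) ∧ jet k ξ 0 = Ψ := by
  rw [R.baseVel_eq hE.smooth_p] at hΨ
  exact hD.exists_jet_over R.smooth_x R.x_mem hΨ.1 hΨ.2

/-- The value of `Υ` on a represented vector. -/
theorem isUpsilon_iff (R : IsRep σ U k k Φ x g) (w : E) :
    σ.IsUpsilon k Φ w ↔
      w = hE.s (x 0) (upsCoef k fun a b => dd a b (fun t s => hE.y (g t s)) 0 0) := by
  set z := upsCoef k fun a b => dd a b (fun t s => hE.y (g t s)) 0 0 with hz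
  have hx0 := R.x_mem 0
  have hbv := R.baseVel_eq hE.smooth_p
  have key : σ.IsUpsilon k Φ (hE.s (x 0) z) := by
    refine ⟨(hE.p_s _ hx0 _).trans (R.basePt_eq hE.smooth_p).symm, fun Ψ hΨ => ?_⟩
    obtain ⟨ξ, hξ, hp, rfl⟩ := exists_dual_jet hE hD R hΨ
    have hps : σ.pE (hE.s (x 0) z) = x 0 := hE.p_s _ hx0 _
    rw [pt_jet, c.pair_eq _ _ (by rw [hps]; exact hx0) ((hp 0).trans hps.symm), hE.y_s _ hx0]
    unfold VBData.tilde
    rw [c.pair_combine R hξ hp, hz, ← upsCoef_pairing β (contDiff_dual hD R hξ hp)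
      (R.contDiff_y hE)]
    simp only [c.pair_family R hp]
    rfl
  refine ⟨fun hw => ?_, fun h => h ▸ key⟩
  have hpw : σ.pE w = x 0 := hw.1.trans (R.basePt_eq hE.smooth_p)
  have hps : σ.pE (hE.s (x 0) z) = x 0 := hE.p_s _ hx0 _
  refine hE.ext (by rw [hpw]; exact hx0) (hpw.trans hps.symm) (sub_eq_zero.1 (c.sep _ fun v => ?_))
  -- For uniqueness, test against curves with constant dual coordinate v; β separates the fibre
  -- coordinates.
  have hξ := hD.smoothCurve_s R.smooth_x R.x_mem (contDiff_const (c := v))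
  have hp : ∀ t, σ.pD (hD.s (x t) v) = x t := fun t => hD.p_s _ (R.x_mem t) _
  have hΨ : jet k (fun t => hD.s (x t) v) 0 ∈ σ.dualVel k (σ.baseVel k Φ) := by
    rw [hbv]; exact jet_mem_dualVel hD.smooth_p hξ hp k
  have h1 := (hw.2 _ hΨ).trans (key.2 _ hΨ).symm
  rw [pt_jet, c.pair_eq _ _ (by rw [hpw]; exact hx0) ((hp 0).trans hpw.symm),
    c.pair_eq _ _ (by rw [hps]; exact hx0) ((hp 0).trans hps.symm), hD.y_s _ hx0] at h1
  rw [map_sub, h1, sub_self]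

theorem upsilon_eq (R : IsRep σ U k k Φ x g) :
    σ.upsilon k Φ =
      hE.s (x 0) (upsCoef k fun a b => dd a b (fun t s => hE.y (g t s)) 0 0) := by
  have hex : ∃ w, σ.IsUpsilon k Φ w := ⟨_, (c.isUpsilon_iff R _).2 rfl⟩
  have h : σ.upsilon k Φ = hex.choose := dif_pos hex
  rw [h]
  exact (c.isUpsilon_iff R _).1 hex.choose_spec

/-- The `k`-velocity representing `∑_j a_j Φ^{(j,k-j)}`. -/
theorem isP_iff (R : IsRep σ U k k Φ x g) (a : ℕ → ℝ) (Y : iterT k E) :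
    σ.IsP k (σ.combine k a Φ) Y ↔ Y = jet k (fun t => hE.s (x t)
      (tpoly k (projCoef k a fun a b => dd a b (fun t s => hE.y (g t s)) 0 0) t)) 0 := by
  set z := projCoef k a fun a b => dd a b (fun t s => hE.y (g t s)) 0 0 with hz
  have hbase : iterMap k σ.pE (σ.combine k a Φ) = jet k x 0 := by
    rw [← VBData.iter_pE]; exact c.pE_combine R a
  have hzs := contDiff_tpoly_const k z
  have he := hE.smoothCurve_s R.smooth_x R.x_mem hzs
  have hpe : ∀ t, σ.pE (hE.s (x t) (tpoly k z t)) = x t := fun t => hE.p_s _ (R.x_mem t) _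
  have key : σ.IsP k (σ.combine k a Φ) (jet k (fun t => hE.s (x t) (tpoly k z t)) 0) := by
    refine ⟨⟨_, he, fun _ => mem_univ _, rfl⟩, ?_, fun Ψ hΨ => ?_⟩
    · rw [hbase, iterMap_jet hE.smooth_p he]; simp only [hpe]
    · rw [hbase, ← R.baseVel_eq hE.smooth_p] at hΨ
      obtain ⟨ξ, hξ, hp, rfl⟩ := exists_dual_jet hE hD R hΨ
      rw [c.pair_jet hξ he (fun t => (hp t).trans (hpe t).symm)
        (fun t => by rw [hpe]; exact R.x_mem t), c.pair_combine R hξ hp]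
      simp only [c.pair_family R hp]
      have h1 : ∀ t, σ.pair (ξ t) (hE.s (x t) (tpoly k z t)) = β (hD.y (ξ t)) (tpoly k z t) :=
        fun t => by
          rw [c.pair_eq _ _ (by rw [hpe]; exact R.x_mem t) ((hp t).trans (hpe t).symm),
            hE.y_s _ (R.x_mem t)]
      simp only [h1]
      exact projCoef_pairing β (contDiff_dual hD R hξ hp) (R.contDiff_y hE) hzs k a
        fun i hi => iteratedDeriv_tpoly k i hi z
  refine ⟨fun hY => ?_, fun h => h ▸ key⟩
  have hYb := hY.2.1
  rw [hbase] at hYb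
  obtain ⟨e, hes, hep, rfl⟩ := hE.exists_jet_over R.smooth_x R.x_mem hY.1 hYb
  have heU : ∀ t, σ.pE (e t) ∈ U := fun t => by rw [hep]; exact R.x_mem t
  have hye : ContDiff ℝ ∞ fun t => hE.y (e t) := hes.contDiff_comp hE.smooth_y heU
  refine hE.jet_ext (by rw [hYb]; exact jet_mem_overSet k (R.x_mem 0))
    (hYb.trans (hbase.symm.trans key.2.1.symm)) ?_
  rw [iterLift_jet hE.isOpen_total hE.smooth_y hes heU,
    iterLift_jet hE.isOpen_total hE.smooth_y he fun t => by
      rw [mem_preimage, hpe]; exact R.x_mem t]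
  refine symJet_congr fun i hi => sub_eq_zero.1 (c.sep _ fun v => ?_)
  -- A test curve whose only nonzero derivative at 0, up to order k, is the one of order k - i. By
  -- the Leibniz rule it detects exactly the i-th derivative of the fibre coordinate, with factor
  -- C(k, i).
  let q : ℕ → G := fun m => if m = k - i then v else 0
  have hqs := contDiff_tpoly_const k q
  have hξ := hD.smoothCurve_s R.smooth_x R.x_mem hqs
  have hp : ∀ t, σ.pD (hD.s (x t) (tpoly k q t)) = x t := fun t => hD.p_s _ (R.x_mem t) _
  have hΨ : jet k (fun t => hD.s (x t) (tpoly k q t)) 0 ∈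
      σ.dualVel k (iterMap k σ.pE (σ.combine k a Φ)) := by
    rw [hbase]; exact jet_mem_dualVel hD.smooth_p hξ hp k
  have hpair : ∀ e' : ℝ → E, SmoothCurve E e' → (∀ t, σ.pE (e' t) = x t) →
      (σ.iter k).pair (jet k (fun t => hD.s (x t) (tpoly k q t)) 0) (jet k e' 0) =
        (k.choose i : ℝ) * β v (iteratedDeriv i (fun t => hE.y (e' t)) 0) := by
    intro e' he' hpe'
    have hU' : ∀ t, σ.pE (e' t) ∈ U := fun t => by rw [hpe']; exact R.x_mem t
    rw [c.pair_jet hξ he' (fun t => (hp t).trans (hpe' t).symm) hU']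
    have h1 : ∀ t, σ.pair (hD.s (x t) (tpoly k q t)) (e' t) = β (tpoly k q t) (hE.y (e' t)) :=
      fun t => by
        rw [c.pair_eq _ _ (hU' t) ((hp t).trans (hpe' t).symm), hD.y_s _ (R.x_mem t)]
    simp only [h1]
    rw [iteratedDeriv_bilin β hqs (he'.contDiff_comp hE.smooth_y hU')]
    rw [Finset.sum_eq_single i]
    · rw [iteratedDeriv_tpoly k (k - i) (by omega)]; simp [q]
    · intro m hm hmi
      rw [iteratedDeriv_tpoly k (k - m) (by omega)]
      have : m < k + 1 := by simpa using hm
      have : k - m ≠ k - i := by omega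
      simp [q, this]
    · intro hn; exact absurd (Finset.mem_range.2 (by omega)) hn
  have h1 := (hY.2.2 _ hΨ).trans (key.2.2 _ hΨ).symm
  rw [hpair _ hes hep, hpair _ he hpe] at h1
  have h2 : (k.choose i : ℝ) ≠ 0 := by exact_mod_cast (Nat.choose_pos hi).ne'
  rw [map_sub, mul_left_cancel₀ h2 h1, sub_self]

/-- The coefficients of the momentum map. -/
abbrev _root_.hatCoef (k j : ℕ) : ℝ := (-1) ^ j * ((k + 1).choose (j + 1) : ℝ)

theorem isP_hat_iff (R : IsRep σ U k k Φ x g) (Y : iterT k E) :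
    σ.IsP k (σ.hat k Φ) Y ↔ Y = σ.momentum k Φ := by
  have hex : ∃ Y, σ.IsP k (σ.hat k Φ) Y := ⟨_, (c.isP_iff R (hatCoef k) _).2 rfl⟩
  have h : σ.momentum k Φ = hex.choose := dif_pos hex
  have h2 := (c.isP_iff R (hatCoef k) _).1 hex.choose_spec
  rw [h, h2]
  exact c.isP_iff R (hatCoef k) Y

theorem momentum_eq (R : IsRep σ U k k Φ x g) :
    σ.momentum k Φ = jet k (fun t => hE.s (x t)
      (tpoly k (projCoef k (hatCoef k) fun a b => dd a b (fun t s => hE.y (g t s)) 0 0) t)) 0 :=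
  ((c.isP_hat_iff R _).1 ((c.isP_iff R (hatCoef k) _).2 rfl)).symm

/-- The pairing of the momentum map with a `k`-velocity. -/
theorem pair_momentum (R : IsRep σ U k k Φ x g) {ξ : ℝ → D} (hξ : SmoothCurve D ξ)
    (h : ∀ t, σ.pD (ξ t) = x t) :
    (σ.iter k).pair (jet k ξ 0) (σ.momentum k Φ) = ∑ j ∈ Finset.range (k + 1),
      hatCoef k j * dd j (k - j) (fun t s => σ.pair (ξ (t + s)) (g t s)) 0 0 := by
  have hP := (c.isP_hat_iff R _).2 rfl
  rw [hP.2.2 (jet k ξ 0), ← c.pair_combine R hξ h]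
  · rfl
  · have : iterMap k σ.pE (σ.hat k Φ) = jet k x 0 := by
      rw [← VBData.iter_pE]; exact c.pE_combine R _
    rw [this]; exact jet_mem_dualVel hD.smooth_p hξ h k

theorem pair_upsilon (R : IsRep σ U k k Φ x g) {ξ : ℝ → D} (hξ : SmoothCurve D ξ)
    (h : ∀ t, σ.pD (ξ t) = x t) :
    σ.pair (ξ 0) (σ.upsilon k Φ) = ∑ j ∈ Finset.range (k + 1),
      (-1) ^ j * (k.choose j : ℝ) * dd j (k - j) (fun t s => σ.pair (ξ (t + s)) (g t s)) 0 0 := by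
  have hu := (c.isUpsilon_iff R _).2 (c.upsilon_eq R)
  have hΨ : jet k ξ 0 ∈ σ.dualVel k (σ.baseVel k Φ) := by
    rw [R.baseVel_eq hE.smooth_p]; exact jet_mem_dualVel hD.smooth_p hξ h k
  have := hu.2 _ hΨ
  rw [pt_jet] at this
  rw [this]
  exact c.pair_combine R hξ h _

end VBChart

end Pairing

/-! ### Smoothness and linearity -/

section Coef

variable {F : Type*} [NormedAddCommGroup F] [NormedSpace ℝ F]

theorem upsCoef_congr {k : ℕ} {y y' : ℕ → ℕ → F} (h : ∀ a ≤ k, ∀ b ≤ k, y a b = y' a b) :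
    upsCoef k y = upsCoef k y' :=
  Finset.sum_congr rfl fun a ha => by
    rw [h a (Finset.mem_range_succ_iff.1 ha) _ (Nat.sub_le k a)]

theorem upsCoef_add (k : ℕ) (y y' : ℕ → ℕ → F) :
    upsCoef k (fun a b => y a b + y' a b) = upsCoef k y + upsCoef k y' := by
  simp only [upsCoef, smul_add, Finset.sum_add_distrib]

theorem upsCoef_smul (k : ℕ) (r : ℝ) (y : ℕ → ℕ → F) :
    upsCoef k (fun a b => r • y a b) = r • upsCoef k y := by
  simp only [upsCoef, Finset.smul_sum, smul_comm r]

theorem contDiff_upsCoef {X : Type*} [NormedAddCommGroup X] [NormedSpace ℝ X] (k : ℕ)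
    {y : X → ℕ → ℕ → F} (h : ∀ a b, ContDiff ℝ ∞ fun x => y x a b) :
    ContDiff ℝ ∞ fun x => upsCoef k (y x) :=
  ContDiff.sum fun a _ => (h a (k - a)).const_smul _

theorem projCoef_congr {k : ℕ} {c : ℕ → ℝ} {y y' : ℕ → ℕ → F}
    (h : ∀ a ≤ k, ∀ b ≤ k, y a b = y' a b) (i : ℕ) : projCoef k c y i = projCoef k c y' i := by
  refine Finset.sum_congr rfl fun j hj => Finset.sum_congr rfl fun a ha =>
    Finset.sum_congr rfl fun b hb => ?_
  rw [Finset.mem_range_succ_iff] at hj ha hb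
  rw [h a (by omega) b (by omega)]

theorem projCoef_add (k : ℕ) (c : ℕ → ℝ) (y y' : ℕ → ℕ → F) (i : ℕ) :
    projCoef k c (fun a b => y a b + y' a b) i = projCoef k c y i + projCoef k c y' i := by
  simp only [projCoef, smul_add, Finset.sum_add_distrib]

theorem projCoef_smul (k : ℕ) (c : ℕ → ℝ) (r : ℝ) (y : ℕ → ℕ → F) (i : ℕ) :
    projCoef k c (fun a b => r • y a b) i = r • projCoef k c y i := by
  simp only [projCoef, Finset.smul_sum, smul_comm r]

theorem contDiff_projCoef {X : Type*} [NormedAddCommGroup X] [NormedSpace ℝ X] (k : ℕ)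
    (c : ℕ → ℝ) {y : X → ℕ → ℕ → F} (h : ∀ a b, ContDiff ℝ ∞ fun x => y x a b) (i : ℕ) :
    ContDiff ℝ ∞ fun x => projCoef k c (y x) i :=
  ContDiff.sum fun _ _ => ContDiff.sum fun a _ => ContDiff.sum fun b _ => (h a b).const_smul _

theorem dd_add {f g : ℝ → ℝ → F} (hf : ContDiff ℝ ∞ fun p : ℝ × ℝ => f p.1 p.2)
    (hg : ContDiff ℝ ∞ fun p : ℝ × ℝ => g p.1 p.2) (a b : ℕ) (t s : ℝ) :
    dd a b (fun t s => f t s + g t s) t s = dd a b f t s + dd a b g t s := by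
  have hp : ContDiff ℝ ∞ fun p : ℝ × ℝ => (f p.1 p.2, g p.1 p.2) := hf.prodMk hg
  have h1 := dd_clm (ContinuousLinearMap.fst ℝ F F) (f := fun t s => (f t s, g t s)) hp a b t s
  have h2 := dd_clm (ContinuousLinearMap.snd ℝ F F) (f := fun t s => (f t s, g t s)) hp a b t s
  have h3 := dd_clm (ContinuousLinearMap.fst ℝ F F + ContinuousLinearMap.snd ℝ F F) (f := fun t s => (f t s, g t s)) hp a b t s
  exact h3.trans (congrArg₂ (· + ·) h1.symm h2.symm)

theorem dd_smul (r : ℝ) {f : ℝ → ℝ → F} (hf : ContDiff ℝ ∞ fun p : ℝ × ℝ => f p.1 p.2)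
    (a b : ℕ) (t s : ℝ) : dd a b (fun t s => r • f t s) t s = r • dd a b f t s :=
  dd_clm (r • ContinuousLinearMap.id ℝ F) hf a b t s

end Coef

section Morphism

variable {M E D : Mfd.{u}} {σ : VBData M E D} {U : Set M} {F G : Type u} [NormedAddCommGroup F]
    [NormedSpace ℝ F] [NormedAddCommGroup G] [NormedSpace ℝ G]

/-- The coordinates `y^{(a,b)}` of an iterated tangent vector. -/
def FibreChart.coefs (hE : FibreChart σ.pE U F) (k : ℕ) (Φ : iterT k (iterT k E)) (a b : ℕ) : F :=
  jetCoef k b (jetCoef k a (iterLift (iterLift hE.y k) k Φ))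

/-- The local expression of `Υ`. -/
def FibreChart.upsLocal (hE : FibreChart σ.pE U F) (k : ℕ) (Φ : iterT k (iterT k E)) : E :=
  hE.s (σ.pE (pt k (pt (N := iterT k E) k Φ))) (upsCoef k (hE.coefs k Φ))

/-- The local expression of `Π`. -/
def FibreChart.momLocal (hE : FibreChart σ.pE U F) (k : ℕ) (Φ : iterT k (iterT k E)) :
    iterT k E :=
  (hE.iter k).s (iterMap k σ.pE (pt (N := iterT k E) k Φ))
    (symJet k (projCoef k (hatCoef k) (hE.coefs k Φ)))

namespace FibreChart

variable (hE : FibreChart σ.pE U F) (k : ℕ)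

/-- The coefficients of Φ are smooth functions of its lifted coordinates. The expression q is left
general in order to cover both `upsCoef` and the jet built from `projCoef`. -/
theorem contMDiffOn_coefs {W : Type u} [NormedAddCommGroup W] [NormedSpace ℝ W]
    (q : (ℕ → ℕ → F) → W)
    (hq : ∀ {X : Type u} [NormedAddCommGroup X] [NormedSpace ℝ X] {y : X → ℕ → ℕ → F},
      (∀ a b, ContDiff ℝ ∞ fun x => y x a b) → ContDiff ℝ ∞ fun x => q (y x)) :
    ContMDiffOn (iterT k (iterT k E)).I 𝓘(ℝ, W) ∞ (fun Φ => q (hE.coefs k Φ))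
      (overSet k (overSet k (σ.pE ⁻¹' U))) := by
  have h1 := contMDiffOn_iterLift (isOpen_overSet hE.isOpen_total k)
    (contMDiffOn_iterLift hE.isOpen_total hE.smooth_y k) k
  have h2 : ContDiff ℝ ∞ fun X : JetModel k (JetModel k F) =>
      q (fun a b => jetCoef k b (jetCoef k a X)) :=
    hq fun a b => (contDiff_jetCoef k b).comp (contDiff_jetCoef k a)
  exact h2.contMDiff.comp_contMDiffOn h1

/-- The local expression makes sense and is smooth on an open set of T^{(k)}T^{(k)}E, beyond the
semi-holonomic vectors. It serves as the ambient extension in proofs of smoothness and in the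
computation of `tmapOn`. -/
theorem contMDiffOn_upsLocal :
    ContMDiffOn (iterT k (iterT k E)).I E.I ∞ (hE.upsLocal k)
      (overSet k (overSet k (σ.pE ⁻¹' U))) := by
  have h1 : ContMDiff (iterT k (iterT k E)).I M.I ∞
      fun Φ => σ.pE (pt k (pt (N := iterT k E) k Φ)) :=
    hE.smooth_p.comp ((contMDiff_pt k).comp (contMDiff_pt k))
  refine hE.smooth_s.comp (h1.contMDiffOn.prodMk
    (hE.contMDiffOn_coefs k (upsCoef k) fun h => contDiff_upsCoef k h)) fun Φ hΦ => ?_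
  rw [mem_overSet, mem_overSet] at hΦ
  exact ⟨hΦ, mem_univ _⟩

theorem contMDiffOn_momLocal :
    ContMDiffOn (iterT k (iterT k E)).I (iterT k E).I ∞ (hE.momLocal k)
      (overSet k (overSet k (σ.pE ⁻¹' U))) := by
  have h1 : ContMDiff (iterT k (iterT k E)).I (iterT k M).I ∞
      fun Φ => iterMap k σ.pE (pt (N := iterT k E) k Φ) :=
    (contMDiff_iterMap hE.smooth_p k).comp (contMDiff_pt k)
  refine (hE.iter k).smooth_s.comp (h1.contMDiffOn.prodMk
    (hE.contMDiffOn_coefs k (fun y => symJet k (projCoef k (hatCoef k) y)) fun h =>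
      contDiff_symJet k fun i _ => contDiff_projCoef k _ h i)) fun Φ hΦ => ?_
  rw [mem_overSet, mem_overSet] at hΦ
  refine ⟨?_, mem_univ _⟩
  change iterMap k σ.pE (pt k Φ) ∈ overSet k U
  rw [mem_overSet, pt_iterMap]; exact hΦ

end FibreChart

theorem IsRep.coefs_eq {k : ℕ} {Φ : iterT k (iterT k E)} {x : ℝ → M} {g : ℝ → ℝ → E}
    (R : IsRep σ U k k Φ x g) (hE : FibreChart σ.pE U F) :
    ∀ a ≤ k, ∀ b ≤ k, dd a b (fun t s => hE.y (g t s)) 0 0 = hE.coefs k Φ a b :=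
  fun _ ha _ hb => (R.coef_eq hE ha hb).symm

theorem pE_pt_congr {k : ℕ} {Φ Ψ : iterT k (iterT k E)}
    (h : iterMap k (iterMap k σ.pE) Ψ = iterMap k (iterMap k σ.pE) Φ) :
    iterMap k σ.pE (pt (N := iterT k E) k Ψ) = iterMap k σ.pE (pt (N := iterT k E) k Φ) := by
  rw [← pt_iterMap (iterMap k σ.pE) k Ψ, h, pt_iterMap]

theorem pE_pt_pt_congr {k : ℕ} {Φ Ψ : iterT k (iterT k E)}
    (h : iterMap k (iterMap k σ.pE) Ψ = iterMap k (iterMap k σ.pE) Φ) :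
    σ.pE (pt k (pt (N := iterT k E) k Ψ)) = σ.pE (pt k (pt (N := iterT k E) k Φ)) := by
  rw [← pt_iterMap σ.pE k (pt k Ψ), pE_pt_congr h, pt_iterMap]

theorem basePt_eq_pt {k : ℕ} (Φ : iterT k (iterT k E)) :
    σ.basePt k Φ = σ.pE (pt k (pt (N := iterT k E) k Φ)) := by
  change pt k (pt k (iterMap k (iterMap k σ.pE) Φ)) = _
  rw [pt_iterMap, pt_iterMap]

theorem baseVel_eq_pt {k : ℕ} (Φ : iterT k (iterT k E)) :
    σ.baseVel k Φ = iterMap k σ.pE (pt (N := iterT k E) k Φ) := by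
  change pt k (iterMap k (iterMap k σ.pE) Φ) = _
  rw [pt_iterMap]

namespace VBChart

variable {hE : FibreChart σ.pE U F} {hD : FibreChart σ.pD U G} {β : G →L[ℝ] F →L[ℝ] ℝ}
  (c : VBChart σ hE hD β) [M.I.Boundaryless] {k : ℕ} {Φ : iterT k (iterT k E)}

include c

theorem upsilon_eq_local (hΦ : Φ ∈ σ.SemiHol k k)
    (hU : σ.pE (pt k (pt (N := iterT k E) k Φ)) ∈ U) : σ.upsilon k Φ = hE.upsLocal k Φ := by
  obtain ⟨x, f, -, R⟩ := IsRep.exists_of_mem hE hΦ hU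
  rw [c.upsilon_eq R, FibreChart.upsLocal, ← basePt_eq_pt, R.basePt_eq hE.smooth_p,
    upsCoef_congr (R.coefs_eq hE)]

theorem momentum_eq_local (hΦ : Φ ∈ σ.SemiHol k k)
    (hU : σ.pE (pt k (pt (N := iterT k E) k Φ)) ∈ U) : σ.momentum k Φ = hE.momLocal k Φ := by
  obtain ⟨x, f, -, R⟩ := IsRep.exists_of_mem hE hΦ hU
  have hz := contDiff_tpoly_const k
    (projCoef k (hatCoef k) fun a b => dd a b (fun t s => hE.y (hE.s (x (t + s)) (f t s))) 0 0)
  have he := hE.smoothCurve_s R.smooth_x R.x_mem hz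
  have hp : iterMap k σ.pE (jet k (fun t => hE.s (x t) (tpoly k (projCoef k (hatCoef k) fun a b =>
      dd a b (fun t s => hE.y (hE.s (x (t + s)) (f t s))) 0 0) t)) 0) = jet k x 0 := by
    rw [iterMap_jet hE.smooth_p he]; simp only [fun t => hE.p_s _ (R.x_mem t)]
  have hx := jet_mem_overSet k (R.x_mem 0)
  rw [c.momentum_eq R, FibreChart.momLocal, ← baseVel_eq_pt, R.baseVel_eq hE.smooth_p]
  refine (hE.iter k).ext (by rw [hp]; exact hx) (hp.trans ((hE.iter k).p_s _ hx _).symm) ?_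
  rw [(hE.iter k).y_s _ hx, hE.iter_y, iterLift_jet hE.isOpen_total hE.smooth_y he fun t => by
    rw [mem_preimage, hE.p_s _ (R.x_mem t)]; exact R.x_mem t]
  refine symJet_congr fun i hi => ?_
  rw [← projCoef_congr (R.coefs_eq hE) i]
  rw [← iteratedDeriv_tpoly k i hi (projCoef k (hatCoef k) fun a b =>
      dd a b (fun t s => hE.y (hE.s (x (t + s)) (f t s))) 0 0)]
  simp only [fun t => hE.y_s _ (R.x_mem t)]

theorem upsilon_p (hΦ : Φ ∈ σ.SemiHol k k)
    (hU : σ.pE (pt k (pt (N := iterT k E) k Φ)) ∈ U) :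
    σ.pE (σ.upsilon k Φ) = σ.pE (pt k (pt (N := iterT k E) k Φ)) := by
  rw [c.upsilon_eq_local hΦ hU]; exact hE.p_s _ hU _

theorem upsilon_y (hΦ : Φ ∈ σ.SemiHol k k)
    (hU : σ.pE (pt k (pt (N := iterT k E) k Φ)) ∈ U) :
    hE.y (σ.upsilon k Φ) = upsCoef k (hE.coefs k Φ) := by
  rw [c.upsilon_eq_local hΦ hU]; exact hE.y_s _ hU _

theorem momentum_p (hΦ : Φ ∈ σ.SemiHol k k)
    (hU : σ.pE (pt k (pt (N := iterT k E) k Φ)) ∈ U) :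
    iterMap k σ.pE (σ.momentum k Φ) = iterMap k σ.pE (pt (N := iterT k E) k Φ) := by
  rw [c.momentum_eq_local hΦ hU]
  exact (hE.iter k).p_s _ (by rw [mem_overSet, pt_iterMap]; exact hU) _

theorem momentum_y (hΦ : Φ ∈ σ.SemiHol k k)
    (hU : σ.pE (pt k (pt (N := iterT k E) k Φ)) ∈ U) :
    iterLift hE.y k (σ.momentum k Φ) = symJet k (projCoef k (hatCoef k) (hE.coefs k Φ)) := by
  rw [c.momentum_eq_local hΦ hU, ← hE.iter_y]
  exact (hE.iter k).y_s _ (by rw [mem_overSet, pt_iterMap]; exact hU) _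

omit c [M.I.Boundaryless] in
theorem iter_iter_pE (X : iterT k (iterT k E)) :
    ((σ.iter k).iter k).pE X = iterMap k (iterMap k σ.pE) X := by
  rw [VBData.iter_pE, VBData.iter_pE]

omit c [M.I.Boundaryless] in
theorem iterMap_mem (hU : σ.pE (pt k (pt (N := iterT k E) k Φ)) ∈ U) :
    iterMap k (iterMap k σ.pE) Φ ∈ overSet k (overSet k U) := by
  rw [mem_overSet, mem_overSet, pt_iterMap, pt_iterMap]; exact hU

/-- Both vectors are represented over the same base curve. Comparing coordinates, their sum is
represented by the family with added fibre coordinates, hence is semi-holonomic again. -/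
theorem add_iter {Φ' : iterT k (iterT k E)} (hΦ : Φ ∈ σ.SemiHol k k) (hΦ' : Φ' ∈ σ.SemiHol k k)
    (h : iterMap k (iterMap k σ.pE) Φ = iterMap k (iterMap k σ.pE) Φ')
    (hU : σ.pE (pt k (pt (N := iterT k E) k Φ)) ∈ U) :
    ((σ.iter k).iter k).add Φ Φ' ∈ σ.SemiHol k k ∧
      iterMap k (iterMap k σ.pE) (((σ.iter k).iter k).add Φ Φ') =
        iterMap k (iterMap k σ.pE) Φ ∧
      ∀ a b, hE.coefs k (((σ.iter k).iter k).add Φ Φ') a b =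
        hE.coefs k Φ a b + hE.coefs k Φ' a b := by
  obtain ⟨x, f, hf, R⟩ := IsRep.exists_of_mem hE hΦ hU
  obtain ⟨f', hf', R'⟩ := IsRep.exists_over hE hΦ'.1 R.smooth_x R.x_mem
    (h.symm.trans (R.base hE.smooth_p))
  have hO : ((σ.iter k).iter k).pE Φ ∈ overSet k (overSet k U) := by
    rw [iter_iter_pE]; exact iterMap_mem hU
  have hpp : ((σ.iter k).iter k).pE Φ = ((σ.iter k).iter k).pE Φ' := by
    rw [iter_iter_pE, iter_iter_pE, h]
  have hp := ((c.iter k).iter k).p_add Φ Φ' hO hpp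
  have hy := ((c.iter k).iter k).y_add Φ Φ' hO hpp
  rw [FibreChart.iterE_y, FibreChart.iterE_y] at hy
  rw [iter_iter_pE, iter_iter_pE] at hp
  refine ⟨?_, hp, fun a b => by unfold FibreChart.coefs; rw [hy, jetCoef_add, jetCoef_add]⟩
  have Rs := IsRep.of_chart hE R.smooth_x R.x_mem (f := fun t s => f t s + f' t s)
    (hf.add hf') k k
  have hs := Rs.mem_semiHol hE.smooth_p
  convert hs
  refine hE.jet_jet_ext (by rw [hp]; exact iterMap_mem hU)
    (hp.trans ((R.base hE.smooth_p).trans (Rs.base hE.smooth_p).symm)) ?_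
  rw [hy, R.lift_eq hE, R'.lift_eq hE, Rs.lift_eq hE, ← symJet_add]
  refine symJet_congr fun a _ => ?_
  rw [← symJet_add]
  refine symJet_congr fun b _ => ?_
  simp only [fun t s => hE.y_s _ (R.x_mem (t + s))]
  exact (dd_add hf hf' a b 0 0).symm

theorem smul_iter (r : ℝ) (hΦ : Φ ∈ σ.SemiHol k k)
    (hU : σ.pE (pt k (pt (N := iterT k E) k Φ)) ∈ U) :
    ((σ.iter k).iter k).smul r Φ ∈ σ.SemiHol k k ∧
      iterMap k (iterMap k σ.pE) (((σ.iter k).iter k).smul r Φ) =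
        iterMap k (iterMap k σ.pE) Φ ∧
      ∀ a b, hE.coefs k (((σ.iter k).iter k).smul r Φ) a b = r • hE.coefs k Φ a b := by
  obtain ⟨x, f, hf, R⟩ := IsRep.exists_of_mem hE hΦ hU
  have hO : ((σ.iter k).iter k).pE Φ ∈ overSet k (overSet k U) := by
    rw [iter_iter_pE]; exact iterMap_mem hU
  have hp := ((c.iter k).iter k).p_smul r Φ hO
  have hy := ((c.iter k).iter k).y_smul r Φ hO
  rw [FibreChart.iterE_y, FibreChart.iterE_y] at hy
  rw [iter_iter_pE, iter_iter_pE] at hp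
  refine ⟨?_, hp, fun a b => by unfold FibreChart.coefs; rw [hy, jetCoef_smul, jetCoef_smul]⟩
  have Rs := IsRep.of_chart hE R.smooth_x R.x_mem (f := fun t s => r • f t s)
    (hf.const_smul r) k k
  have hs := Rs.mem_semiHol hE.smooth_p
  convert hs
  refine hE.jet_jet_ext (by rw [hp]; exact iterMap_mem hU)
    (hp.trans ((R.base hE.smooth_p).trans (Rs.base hE.smooth_p).symm)) ?_
  rw [hy, R.lift_eq hE, Rs.lift_eq hE, ← symJet_smul]
  refine symJet_congr fun a _ => ?_
  rw [← symJet_smul]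
  refine symJet_congr fun b _ => ?_
  simp only [fun t s => hE.y_s _ (R.x_mem (t + s))]
  exact (dd_smul r hf a b 0 0).symm

end VBChart

variable (F G) in
/-- Each point of the base has a vector bundle chart with typical fibres `F` and `G`. -/
def VBData.HasCharts (σ : VBData M E D) : Prop :=
  ∀ x : M, ∃ U, x ∈ U ∧ ∃ (hE : FibreChart σ.pE U F) (hD : FibreChart σ.pD U G)
    (β : G →L[ℝ] F →L[ℝ] ℝ), VBChart σ hE hD β

theorem mem_nhds_over (hE : FibreChart σ.pE U F) {k : ℕ} {Φ : iterT k (iterT k E)}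
    (hU : σ.pE (pt k (pt (N := iterT k E) k Φ)) ∈ U) :
    overSet k (overSet k (σ.pE ⁻¹' U)) ∈ 𝓝 Φ :=
  (isOpen_overSet (isOpen_overSet hE.isOpen_total k) k).mem_nhds
    (by rw [mem_overSet, mem_overSet]; exact hU)

namespace VBData.HasCharts

variable (h : σ.HasCharts F G) [M.I.Boundaryless]

include h

theorem upsilon_isMorphismOn (k : ℕ) :
    ((σ.iter k).iter k).IsMorphismOn (σ.SemiHol k k) σ (σ.upsilon k)
      (fun v => pt k (pt (N := iterT k M) k v)) where
  smooth Φ hΦ := by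
    obtain ⟨U, hU, hE, hD, β, c⟩ := h (σ.pE (pt k (pt (N := iterT k E) k Φ)))
    have hn := mem_nhds_over hE hU
    refine ((hE.contMDiffOn_upsLocal k).contMDiffAt hn).contMDiffWithinAt.congr_of_eventuallyEq
      ?_ (c.upsilon_eq_local hΦ hU)
    filter_upwards [mem_nhdsWithin_of_mem_nhds hn, self_mem_nhdsWithin] with Ψ h1 h2
    rw [mem_overSet, mem_overSet] at h1
    exact c.upsilon_eq_local h2 h1
  covers Φ hΦ := by
    obtain ⟨U, hU, hE, hD, β, c⟩ := h (σ.pE (pt k (pt (N := iterT k E) k Φ)))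
    rw [c.upsilon_p hΦ hU, VBChart.iter_iter_pE, pt_iterMap, pt_iterMap]
  map_add Φ hΦ Φ' hΦ' hb := by
    obtain ⟨U, hU, hE, hD, β, c⟩ := h (σ.pE (pt k (pt (N := iterT k E) k Φ)))
    rw [VBChart.iter_iter_pE, VBChart.iter_iter_pE] at hb
    obtain ⟨hs, hp, hy⟩ := c.add_iter hΦ hΦ' hb hU
    have hpt : ∀ Ψ : iterT k (iterT k E), iterMap k (iterMap k σ.pE) Ψ =
        iterMap k (iterMap k σ.pE) Φ → σ.pE (pt k (pt (N := iterT k E) k Ψ)) =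
        σ.pE (pt k (pt (N := iterT k E) k Φ)) := fun Ψ hΨ => pE_pt_pt_congr hΨ
    have hU' := (hpt _ hb.symm).symm ▸ hU
    have hUs := (hpt _ hp).symm ▸ hU
    have hpu := c.upsilon_p hΦ hU
    have hpp := hpu.trans ((hpt _ hb.symm).symm.trans (c.upsilon_p hΦ' hU').symm)
    have hUu : σ.pE (σ.upsilon k Φ) ∈ U := by rw [hpu]; exact hU
    refine ⟨hs, hE.ext (by rw [c.upsilon_p hs hUs]; exact hUs) ?_ ?_⟩
    · rw [c.upsilon_p hs hUs, c.p_add _ _ hUu hpp, hpu, hpt _ hp]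
    · rw [c.upsilon_y hs hUs, c.y_add _ _ hUu hpp, c.upsilon_y hΦ hU, c.upsilon_y hΦ' hU',
        ← upsCoef_add]
      simp only [← hy]
  map_smul r Φ hΦ := by
    obtain ⟨U, hU, hE, hD, β, c⟩ := h (σ.pE (pt k (pt (N := iterT k E) k Φ)))
    obtain ⟨hs, hp, hy⟩ := c.smul_iter r hΦ hU
    have hpt : σ.pE (pt k (pt (N := iterT k E) k (((σ.iter k).iter k).smul r Φ))) =
        σ.pE (pt k (pt (N := iterT k E) k Φ)) := pE_pt_pt_congr hp
    have hUs := hpt.symm ▸ hU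
    have hpu := c.upsilon_p hΦ hU
    have hUu : σ.pE (σ.upsilon k Φ) ∈ U := by rw [hpu]; exact hU
    refine ⟨hs, hE.ext (by rw [c.upsilon_p hs hUs]; exact hUs) ?_ ?_⟩
    · rw [c.upsilon_p hs hUs, c.p_smul _ _ hUu, hpu, hpt]
    · rw [c.upsilon_y hs hUs, c.y_smul _ _ hUu, c.upsilon_y hΦ hU, ← upsCoef_smul]
      simp only [← hy]

theorem momentum_isMorphismOn (k : ℕ) :
    ((σ.iter k).iter k).IsMorphismOn (σ.SemiHol k k) (σ.iter k) (σ.momentum k)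
      (fun v => pt (N := iterT k M) k v) where
  smooth Φ hΦ := by
    obtain ⟨U, hU, hE, hD, β, c⟩ := h (σ.pE (pt k (pt (N := iterT k E) k Φ)))
    have hn := mem_nhds_over hE hU
    refine ((hE.contMDiffOn_momLocal k).contMDiffAt hn).contMDiffWithinAt.congr_of_eventuallyEq
      ?_ (c.momentum_eq_local hΦ hU)
    filter_upwards [mem_nhdsWithin_of_mem_nhds hn, self_mem_nhdsWithin] with Ψ h1 h2
    rw [mem_overSet, mem_overSet] at h1
    exact c.momentum_eq_local h2 h1
  covers Φ hΦ := by
    obtain ⟨U, hU, hE, hD, β, c⟩ := h (σ.pE (pt k (pt (N := iterT k E) k Φ)))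
    rw [VBData.iter_pE, c.momentum_p hΦ hU, VBChart.iter_iter_pE, pt_iterMap]
  map_add Φ hΦ Φ' hΦ' hb := by
    obtain ⟨U, hU, hE, hD, β, c⟩ := h (σ.pE (pt k (pt (N := iterT k E) k Φ)))
    rw [VBChart.iter_iter_pE, VBChart.iter_iter_pE] at hb
    obtain ⟨hs, hp, hy⟩ := c.add_iter hΦ hΦ' hb hU
    have hpt : ∀ Ψ : iterT k (iterT k E), iterMap k (iterMap k σ.pE) Ψ =
        iterMap k (iterMap k σ.pE) Φ → iterMap k σ.pE (pt (N := iterT k E) k Ψ) =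
        iterMap k σ.pE (pt (N := iterT k E) k Φ) := fun Ψ hΨ => pE_pt_congr hΨ
    have hpU : ∀ Ψ : iterT k (iterT k E), iterMap k (iterMap k σ.pE) Ψ =
        iterMap k (iterMap k σ.pE) Φ → σ.pE (pt k (pt (N := iterT k E) k Ψ)) ∈ U := fun Ψ hΨ => by
      rw [pE_pt_pt_congr hΨ]; exact hU
    have hU' := hpU _ hb.symm
    have hUs := hpU _ hp
    have hpu := c.momentum_p hΦ hU
    have hpp := hpu.trans ((hpt _ hb.symm).symm.trans (c.momentum_p hΦ' hU').symm)
    have hUu : (σ.iter k).pE (σ.momentum k Φ) ∈ overSet k U := by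
      rw [VBData.iter_pE, hpu, mem_overSet, pt_iterMap]; exact hU
    rw [← VBData.iter_pE] at hpp
    refine ⟨hs, (hE.iterE k).ext ?_ ?_ ?_⟩
    · rw [VBData.iter_pE, c.momentum_p hs hUs, mem_overSet, pt_iterMap]; exact hUs
    · rw [(c.iter k).p_add _ _ hUu hpp, VBData.iter_pE, c.momentum_p hs hUs, hpu, hpt _ hp]
    · rw [(c.iter k).y_add _ _ hUu hpp, hE.iterE_y, c.momentum_y hs hUs, c.momentum_y hΦ hU,
        c.momentum_y hΦ' hU', ← symJet_add]
      refine symJet_congr fun i _ => ?_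
      rw [← projCoef_add]
      simp only [← hy]
  map_smul r Φ hΦ := by
    obtain ⟨U, hU, hE, hD, β, c⟩ := h (σ.pE (pt k (pt (N := iterT k E) k Φ)))
    obtain ⟨hs, hp, hy⟩ := c.smul_iter r hΦ hU
    have hpt : iterMap k σ.pE (pt (N := iterT k E) k (((σ.iter k).iter k).smul r Φ)) =
        iterMap k σ.pE (pt (N := iterT k E) k Φ) := pE_pt_congr hp
    have hUs : σ.pE (pt k (pt (N := iterT k E) k (((σ.iter k).iter k).smul r Φ))) ∈ U := by
      rw [pE_pt_pt_congr hp]; exact hU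
    have hpu := c.momentum_p hΦ hU
    have hUu : (σ.iter k).pE (σ.momentum k Φ) ∈ overSet k U := by
      rw [VBData.iter_pE, hpu, mem_overSet, pt_iterMap]; exact hU
    refine ⟨hs, (hE.iterE k).ext ?_ ?_ ?_⟩
    · rw [VBData.iter_pE, c.momentum_p hs hUs, mem_overSet, pt_iterMap]; exact hUs
    · rw [(c.iter k).p_smul _ _ hUu, VBData.iter_pE, c.momentum_p hs hUs, hpu, hpt]
    · rw [(c.iter k).y_smul _ _ hUu, hE.iterE_y, c.momentum_y hs hUs, c.momentum_y hΦ hU,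
        ← symJet_smul]
      refine symJet_congr fun i _ => ?_
      rw [← projCoef_smul]
      simp only [← hy]

/-- Both sides are pairings with the value of Υ, which involve only the base point of the
k-velocity. -/
theorem tilde_pair_eq {k : ℕ} {Φ : iterT k (iterT k E)} (hΦ : Φ ∈ σ.SemiHol k k)
    {Ψ₁ Ψ₂ : iterT k D} (h₁ : Ψ₁ ∈ σ.dualVel k (σ.baseVel k Φ))
    (h₂ : Ψ₂ ∈ σ.dualVel k (σ.baseVel k Φ)) (hpt : pt k Ψ₁ = pt k Ψ₂) :
    (σ.iter k).pair Ψ₁ (σ.tilde k Φ) = (σ.iter k).pair Ψ₂ (σ.tilde k Φ) := by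
  obtain ⟨U, hU, hE, hD, β, c⟩ := h (σ.pE (pt k (pt (N := iterT k E) k Φ)))
  obtain ⟨x, f, -, R⟩ := IsRep.exists_of_mem hE hΦ hU
  have hu := (c.isUpsilon_iff R _).2 rfl
  rw [← hu.2 _ h₁, ← hu.2 _ h₂, hpt]

theorem isUpsilon_iff {k : ℕ} {Φ : iterT k (iterT k E)} (hΦ : Φ ∈ σ.SemiHol k k) (w : E) :
    σ.IsUpsilon k Φ w ↔ w = σ.upsilon k Φ := by
  obtain ⟨U, hU, hE, hD, β, c⟩ := h (σ.pE (pt k (pt (N := iterT k E) k Φ)))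
  obtain ⟨x, f, -, R⟩ := IsRep.exists_of_mem hE hΦ hU
  rw [c.upsilon_eq R]; exact c.isUpsilon_iff R w

theorem isP_iff {k : ℕ} {Φ : iterT k (iterT k E)} (hΦ : Φ ∈ σ.SemiHol k k) (Y : iterT k E) :
    σ.IsP k (σ.hat k Φ) Y ↔ Y = σ.momentum k Φ := by
  obtain ⟨U, hU, hE, hD, β, c⟩ := h (σ.pE (pt k (pt (N := iterT k E) k Φ)))
  obtain ⟨x, f, -, R⟩ := IsRep.exists_of_mem hE hΦ hU
  exact c.isP_hat_iff R Y

end VBData.HasCharts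

/-- The tangent map on a submanifold of a map with a local extension. -/
theorem tmapOn_eq {N N' : Mfd.{u}} {S : Set N} {f f' : N → N'} {C : ℝ → N} (hC : SmoothCurve N C)
    (hCS : ∀ t, C t ∈ S) (hf' : MDifferentiableAt N.I N'.I f' (C 0))
    (hloc : ∀ᶠ n in 𝓝 (C 0), n ∈ S → f n = f' n) :
    tmapOn S f (vel C 0) = vel (fun t => f (C t)) 0 := by
  -- On S the map agrees with an ambient map differentiable at the point, so its velocity along a
  -- curve in S depends only on the velocity of the curve.
  have key : ∀ B : ℝ → N, SmoothCurve N B → (∀ t, B t ∈ S) → B 0 = C 0 →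
      vel (fun t => f (B t)) 0 = tmap f' (vel B 0) := by
    intro B hB hBS h0
    rw [← h0] at hf' hloc
    rw [← vel_comp 0 hf' (hB.mdiff 0)]
    refine vel_congr ?_
    filter_upwards [(ContMDiff.continuous hB).continuousAt.eventually hloc] with t ht
    exact ht (hBS t)
  have hex : ∃ c : ℝ → N, SmoothCurve N c ∧ (∀ t, c t ∈ S) ∧ vel c 0 = vel C 0 :=
    ⟨C, hC, hCS, rfl⟩
  obtain ⟨h1, h2, h3⟩ := hex.choose_spec
  refine (dif_pos hex).trans ?_
  rw [key _ h1 h2 (congrArg Mfd.base h3), h3, ← key C hC hCS rfl]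

namespace VBChart

variable {hE : FibreChart σ.pE U F} {hD : FibreChart σ.pD U G} {β : G →L[ℝ] F →L[ℝ] ℝ}
  (c : VBChart σ hE hD β) [M.I.Boundaryless] {k : ℕ} {C : ℝ → iterT k (iterT k E)}

include c

theorem tmapOn_upsilon (hC : SmoothCurve _ C) (hCS : ∀ t, C t ∈ σ.SemiHol k k)
    (hU : σ.pE (pt k (pt (N := iterT k E) k (C 0))) ∈ U) :
    tmapOn (σ.SemiHol k k) (σ.upsilon k) (vel C 0) = vel (fun t => σ.upsilon k (C t)) 0 := by
  have hn := mem_nhds_over hE hU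
  refine tmapOn_eq hC hCS (((hE.contMDiffOn_upsLocal k).contMDiffAt hn).mdifferentiableAt
    (by simp)) ?_
  filter_upwards [hn] with Ψ h1 h2
  rw [mem_overSet, mem_overSet] at h1
  exact c.upsilon_eq_local h2 h1

theorem tmapOn_momentum (hC : SmoothCurve _ C) (hCS : ∀ t, C t ∈ σ.SemiHol k k)
    (hU : σ.pE (pt k (pt (N := iterT k E) k (C 0))) ∈ U) :
    tmapOn (σ.SemiHol k k) (σ.momentum k) (vel C 0) = vel (fun t => σ.momentum k (C t)) 0 := by
  have hn := mem_nhds_over hE hU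
  refine tmapOn_eq hC hCS (((hE.contMDiffOn_momLocal k).contMDiffAt hn).mdifferentiableAt
    (by simp)) ?_
  filter_upwards [hn] with Ψ h1 h2
  rw [mem_overSet, mem_overSet] at h1
  exact c.momentum_eq_local h2 h1

end VBChart

end Morphism

/-! ### Coordinate formula -/

section LiftFun

variable {N : Mfd.{u}}

/-- The curve chosen in the definition can be cut off into O without changing its jet. The lift is
then read off from the jet, so the choice is immaterial. -/
theorem liftFun_eq {y : N → ℝ} {O : Set N} (hO : IsOpen O) (hy : ContMDiffOn N.I 𝓘(ℝ, ℝ) ∞ y O)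
    {l b : ℕ} (hb : b ≤ l) {X : iterT l N} (hX : X ∈ Vel l (univ : Set N))
    (hXO : X ∈ overSet l O) : liftFun univ y l b X = jetCoef l b (iterLift y l X) := by
  have hX' : ∃ c : ℝ → N, SmoothCurve N c ∧ (∀ t, c t ∈ (univ : Set N)) ∧ jet l c 0 = X := hX
  refine (dif_pos hX').trans ?_
  obtain ⟨hc, -, hX⟩ := hX'.choose_spec
  set C := hX'.choose
  rw [mem_overSet, ← hX, pt_jet] at hXO
  obtain ⟨c', hc', hO', he⟩ := hc.exists_reparam hO hXO
  rw [← hX, ← jet_congr_at l he, iterLift_jet hO hy hc' hO', jetCoef_symJet l b hb]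
  exact (Filter.EventuallyEq.iteratedDeriv_eq b (he.fun_comp y)).symm

theorem liftFun₂_eq {y : N → ℝ} {O : Set N} (hO : IsOpen O) (hy : ContMDiffOn N.I 𝓘(ℝ, ℝ) ∞ y O)
    {k l a b : ℕ} (ha : a ≤ k) (hb : b ≤ l) {X : iterT k (iterT l N)}
    (hX : X ∈ Vel k (Vel l (univ : Set N))) (hXO : X ∈ overSet k (overSet l O)) :
    liftFun₂ y k l a b X = jetCoef l b (jetCoef k a (iterLift (iterLift y l) k X)) := by
  have hX' : ∃ c : ℝ → iterT l N, SmoothCurve (iterT l N) c ∧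
      (∀ t, c t ∈ Vel l (univ : Set N)) ∧ jet k c 0 = X := hX
  refine (dif_pos hX').trans ?_
  obtain ⟨hc, hcV, hX⟩ := hX'.choose_spec
  set C := hX'.choose
  have hOl := isOpen_overSet hO l
  have hyl := contMDiffOn_iterLift hO hy l
  rw [mem_overSet, ← hX, pt_jet] at hXO
  obtain ⟨θ, θs, θid, hθ⟩ := exists_cutoff
    ((ContMDiff.continuous hc).continuousAt.preimage_mem_nhds (hOl.mem_nhds hXO))
  have hc' : SmoothCurve (iterT l N) fun t => C (θ t) := hc.reparam θs
  have he : (fun t => C (θ t)) =ᶠ[𝓝 0] C := θid.mono fun t ht => congrArg C ht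
  have hyC := hc'.contDiff_comp hyl hθ
  have h1 : ∀ t, liftFun univ y l b (C (θ t)) = jetCoef l b (iterLift y l (C (θ t))) :=
    fun t => liftFun_eq hO hy hb (hcV _) (hθ t)
  rw [← hX, ← jet_congr_at k he, iterLift_jet hOl hyl hc' hθ, jetCoef_symJet k a ha]
  have h2 : ∀ t, iterLift y l (C (θ t)) =
      symJet l fun b => jetCoef l b (iterLift y l (C (θ t))) := fun t =>
    iterLift_of_mem_vel hO hy (hcV _) (hθ t)
  have hcoef : ∀ b, ContDiff ℝ ∞ fun t => jetCoef l b (iterLift y l (C (θ t))) :=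
    fun b => (contDiff_jetCoef l b).comp hyC
  rw [funext h2, iteratedDeriv_symJet l fun b _ => hcoef b,
    jetCoef_symJet l b hb, ← funext h1]
  exact (Filter.EventuallyEq.iteratedDeriv_eq a (he.fun_comp (liftFun univ y l b))).symm

end LiftFun

section Formulas

variable {M E D : Mfd.{u}} {σ : VBData M E D} {U : Set M} {F G : Type u} [NormedAddCommGroup F]
    [NormedSpace ℝ F] [NormedAddCommGroup G] [NormedSpace ℝ G]

/-- The base curve is shrunk to stay also in O, where a given coordinate function is linear on
fibres. -/
theorem IsRep.exists_of_mem_inter {k l : ℕ} {Φ : iterT k (iterT l E)} (hE : FibreChart σ.pE U F)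
    {O : Set M} (hO : IsOpen O) (hΦ : Φ ∈ σ.SemiHol k l)
    (hU : σ.pE (pt l (pt (N := iterT l E) k Φ)) ∈ U)
    (hU' : σ.pE (pt l (pt (N := iterT l E) k Φ)) ∈ O) :
    ∃ x, (∀ t, x t ∈ O) ∧ ∃ f : ℝ → ℝ → F, ContDiff ℝ ∞ (fun p : ℝ × ℝ => f p.1 p.2) ∧
      IsRep σ U k l Φ x fun t s => hE.s (x (t + s)) (f t s) := by
  obtain ⟨x, f, -, R⟩ := exists_of_mem hE hΦ hU
  have h0 : σ.pE (pt l (pt (N := iterT l E) k Φ)) = x 0 := by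
    rw [← pt_iterMap σ.pE l (pt k Φ), ← pt_iterMap (iterMap l σ.pE) k Φ, R.base hE.smooth_p, pt_jet, pt_jet]
  rw [h0] at hU'
  obtain ⟨x', hx', hO', he'⟩ := R.smooth_x.exists_reparam (hO.inter hE.isOpen) ⟨hU', R.x_mem 0⟩
  exact ⟨x', fun t => (hO' t).1, exists_over hE hΦ.1 hx' (fun t => (hO' t).2)
    ((R.base hE.smooth_p).trans (jet_congr_at k (jet_congr l he')).symm)⟩

/-- Along the antidiagonal the representing family stays in the single fibre over x(0), on which y
is a continuous linear functional ℓ of the chart coordinate. The k-th derivative commutes with ℓ, so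
the way y varies with the base point is irrelevant. -/
theorem VBChart.upsilon_coord {hE : FibreChart σ.pE U F} {hD : FibreChart σ.pD U G}
    {β : G →L[ℝ] F →L[ℝ] ℝ} (c : VBChart σ hE hD β) [M.I.Boundaryless] {O : Set M} {y : E → ℝ}
    (hO : IsOpen O) (hy : σ.IsFibreLinear O y) {k : ℕ} {Φ : iterT k (iterT k E)}
    (hΦ : Φ ∈ σ.SemiHol k k) (hU : σ.pE (pt k (pt (N := iterT k E) k Φ)) ∈ U)
    (hU' : σ.pE (pt k (pt (N := iterT k E) k Φ)) ∈ O) :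
    y (σ.upsilon k Φ) = ∑ α ∈ Finset.range (k + 1),
      (-1) ^ α * (k.choose α : ℝ) * liftFun₂ y k k α (k - α) Φ := by
  obtain ⟨x, hxO, f, hf, R⟩ := IsRep.exists_of_mem_inter hE hO hΦ hU hU'
  have hx0 := R.x_mem 0
  have hpx : ∀ v, σ.pE (hE.s (x 0) v) = x 0 := fun v => hE.p_s _ hx0 v
  have hadd : ∀ v w, σ.add (hE.s (x 0) v) (hE.s (x 0) w) = hE.s (x 0) (v + w) := fun v w => by
    rw [c.add_eq (by rw [hpx]; exact hx0) (by rw [hpx, hpx]), hpx, hE.y_s _ hx0, hE.y_s _ hx0]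
  have hsmul : ∀ (r : ℝ) v, σ.smul r (hE.s (x 0) v) = hE.s (x 0) (r • v) := fun r v => by
    rw [c.smul_eq _ (by rw [hpx]; exact hx0), hpx, hE.y_s _ hx0]
  have hcont : ContDiff ℝ ∞ fun v => y (hE.s (x 0) v) :=
    contDiff_comp_family hy.smooth (hE.contMDiff_s (x := fun _ : F => x 0) contMDiff_const
      (fun _ => hx0) contDiff_id) fun v => by rw [mem_preimage, hpx]; exact hxO 0
  let ℓ : F →L[ℝ] ℝ :=
    { toFun := fun v => y (hE.s (x 0) v)
      map_add' := fun v w => by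
        rw [← hadd, hy.map_add _ _ (by rw [hpx]; exact hxO 0) (by rw [hpx, hpx])]
      map_smul' := fun r v => by
        rw [← hsmul, hy.map_smul _ _ (by rw [hpx]; exact hxO 0)]; rfl
      cont := hcont.continuous }
  have hOt : IsOpen (σ.pE ⁻¹' O) := hO.preimage hE.smooth_p.continuous
  have hgO : ∀ t s, hE.s (x (t + s)) (f t s) ∈ σ.pE ⁻¹' O := fun t s => by
    rw [mem_preimage, hE.p_s _ (R.x_mem _)]; exact hxO _
  have hyg : ContDiff ℝ ∞ fun p : ℝ × ℝ => y (hE.s (x (p.1 + p.2)) (f p.1 p.2)) :=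
    contDiff_comp_family hy.smooth R.smooth_g fun p => hgO p.1 p.2
  have hlift : ∀ a ≤ k, liftFun₂ y k k a (k - a) Φ =
      dd a (k - a) (fun t s => y (hE.s (x (t + s)) (f t s))) 0 0 := fun a ha => by
    rw [liftFun₂_eq hOt hy.smooth ha (Nat.sub_le k a) hΦ.1
      (by rw [mem_overSet, mem_overSet]; exact hU'), ← R.eq,
      iterLift_jet_jet hOt hy.smooth R.smooth_g hgO, jetCoef_symJet k a ha,
      jetCoef_symJet k _ (Nat.sub_le k a)]
  have h1 : ∑ α ∈ Finset.range (k + 1), (-1) ^ α * (k.choose α : ℝ) *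
      liftFun₂ y k k α (k - α) Φ =
      upsCoef k fun a b => dd a b (fun t s => y (hE.s (x (t + s)) (f t s))) 0 0 :=
    Finset.sum_congr rfl fun a ha => by
      rw [hlift a (Finset.mem_range_succ_iff.1 ha)]; rfl
  have h2 : ContDiff ℝ ∞ fun r : ℝ => f (-r) r :=
    hf.comp (f := fun r : ℝ => (-r, r)) (by fun_prop)
  rw [h1, upsCoef_dd hyg, c.upsilon_eq R]
  simp only [neg_add_cancel, fun t s => hE.y_s _ (R.x_mem (t + s))]
  rw [upsCoef_dd hf]
  exact (congrFun (iteratedDeriv_clm ℓ h2 k) 0).symm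

/-! ### The first-order case -/

/-- The velocities ∂_s g and ∂_t g at the origin lie over the same vector x'(0) and have the same
base point. Their difference has fibre coordinates (0, z) with z = ∂_s f - ∂_t f, and so has the
velocity at 0 of t · c(t), where c has constant fibre coordinate z over x. -/
theorem VBChart.isNu_upsilon {hE : FibreChart σ.pE U F} {hD : FibreChart σ.pD U G}
    {β : G →L[ℝ] F →L[ℝ] ℝ} (c : VBChart σ hE hD β) [M.I.Boundaryless]
    {Φ : iterT 1 (iterT 1 E)} (hΦ : Φ ∈ σ.SemiHol 1 1)
    (hU : σ.pE (pt 1 (pt (N := iterT 1 E) 1 Φ)) ∈ U) :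
    σ.IsNu (σ.T.add (Mfd.base (N := E.T) Φ) (σ.T.smul (-1) (tmap (Mfd.base (N := E)) Φ)))
      (σ.upsilon 1 Φ) := by
  obtain ⟨x, f, hf, R⟩ := IsRep.exists_of_mem hE hΦ hU
  set g : ℝ → ℝ → E := fun t s => hE.s (x (t + s)) (f t s) with hg
  have hy : ∀ t s, hE.y (g t s) = f t s := fun t s => hE.y_s _ (R.x_mem _) _
  have e1 : Mfd.base (N := E.T) Φ = vel (g 0) 0 := by rw [← R.eq]; rfl
  have e2 : tmap (Mfd.base (N := E)) Φ = vel (fun t => g t 0) 0 := by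
    rw [← R.eq]
    exact (vel_comp (N := E.T) (f := Mfd.base) (c := fun t => vel (g t) 0) 0
      ((contMDiff_base _).mdifferentiableAt (by simp))
      ((family_jet_smooth R.smooth_g 1).mdiff 0)).symm
  set z := deriv (f 0) 0 - deriv (fun t => f t 0) 0 with hz
  have hx0 := R.x_mem 0
  have e3 : σ.upsilon 1 Φ = hE.s (x 0) z := by
    rw [c.upsilon_eq R]
    simp only [hy, upsCoef, Finset.sum_range_succ, Finset.sum_range_zero, dd]
    simp [hz, sub_eq_add_neg, iteratedDeriv_one]
  have hcs : SmoothCurve E fun t => hE.s (x t) z :=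
    hE.smoothCurve_s R.smooth_x R.x_mem contDiff_const
  have hsm : (fun t => σ.smul t (hE.s (x t) z)) = fun t => hE.s (x t) (t • z) := funext fun t => by
    rw [c.smul_eq _ (by rw [hE.p_s _ (R.x_mem t)]; exact R.x_mem t), hE.p_s _ (R.x_mem t),
      hE.y_s _ (R.x_mem t)]
  have hss : SmoothCurve E fun t => hE.s (x t) (t • z) :=
    hE.smoothCurve_s R.smooth_x R.x_mem (by fun_prop)
  have hp1 : tmap σ.pE (vel (g 0) 0) = vel x 0 := by
    rw [← vel_comp 0 (hE.mdiff_p _) ((family_curve R.smooth_g 0).mdiff 0)]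
    simp only [R.pE_g, zero_add]
  have hp2 : tmap σ.pE (vel (fun t => g t 0) 0) = vel x 0 := by
    rw [← vel_comp 0 (hE.mdiff_p _) ((family_curve_left R.smooth_g 0).mdiff 0)]
    simp only [R.pE_g, add_zero]
  have hU1 : σ.T.pE (vel (g 0) 0) ∈ Mfd.base ⁻¹' U := by
    change tmap σ.pE _ ∈ _; rw [hp1]; exact hx0
  have hU2 : σ.T.pE (vel (fun t => g t 0) 0) ∈ Mfd.base ⁻¹' U := by
    change tmap σ.pE _ ∈ _; rw [hp2]; exact hx0
  have hps := c.T.p_smul (-1) _ hU2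
  have hpa := c.T.p_add _ (σ.T.smul (-1) (vel (fun t => g t 0) 0)) hU1
    (by rw [hps]; exact hp1.trans hp2.symm)
  have hya := c.T.y_add _ (σ.T.smul (-1) (vel (fun t => g t 0) 0)) hU1
    (by rw [hps]; exact hp1.trans hp2.symm)
  have hys := c.T.y_smul (-1) _ hU2
  have hpv : tmap σ.pE (vel (fun t => hE.s (x t) (t • z)) 0) = vel x 0 := by
    rw [← vel_comp 0 (hE.mdiff_p _) (hss.mdiff 0)]
    simp only [fun t => hE.p_s _ (R.x_mem t)]
  refine ⟨fun t => hE.s (x t) z, hcs, e3.symm, ?_⟩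
  rw [hsm, e1, e2]
  refine hE.T.ext ?_ (hpv.trans (hp1.symm.trans hpa.symm)) ?_
  · rw [hpv]; exact hx0
  · rw [hya, hys]
    change vlift hE.y _ = vlift hE.y _ + (-1 : ℝ) • vlift hE.y _
    have hUs : ∀ t v, σ.pE (hE.s (x t) v) ∈ U := fun t v => by
      rw [hE.p_s _ (R.x_mem t)]; exact R.x_mem t
    rw [vlift_vel (hE.mdiff_y (hUs _ _)) (hss.mdiff 0),
      vlift_vel (hE.mdiff_y (R.g_mem _ _)) ((family_curve R.smooth_g 0).mdiff 0),
      vlift_vel (c := fun t => g t 0) (hE.mdiff_y (R.g_mem 0 0)) ((family_curve_left R.smooth_g 0).mdiff 0)]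
    simp only [hy, fun t => hE.y_s _ (R.x_mem t)]
    refine Prod.ext (by simp) ?_
    have hd : deriv (fun t : ℝ => t • z) 0 = z := by
      simpa using ((hasDerivAt_id (0 : ℝ)).smul_const z).deriv
    change deriv (fun t : ℝ => t • z) 0 = deriv (f 0) 0 + (-1 : ℝ) • deriv (fun t => f t 0) 0
    rw [hd, hz, neg_one_smul, sub_eq_add_neg]

end Formulas

/-! ### Recurrence for `Π` and integration by parts -/

section Binomial

/-- Pascal's rule. With a and b for the two indices and h_k for the polynomial with coefficients
`hatCoef k`, it reads h_{k+1} = (b - a)^{k+1} + b h_k. -/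
theorem hatCoef_recurrence (k : ℕ) (D : ℕ → ℕ → ℝ) :
    ∑ j ∈ Finset.range (k + 1 + 1), hatCoef (k + 1) j * D j (k + 1 - j) =
      (∑ j ∈ Finset.range (k + 1 + 1), (-1) ^ j * ((k + 1).choose j : ℝ) * D j (k + 1 - j)) +
        ∑ j ∈ Finset.range (k + 1), hatCoef k j * D j (k - j + 1) := by
  have h1 : ∑ j ∈ Finset.range (k + 1), hatCoef k j * D j (k - j + 1) =
      ∑ j ∈ Finset.range (k + 1 + 1), hatCoef k j * D j (k + 1 - j) := by
    rw [Finset.sum_range_succ _ (k + 1)]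
    -- The binomial coefficient C(k+1, k+2) vanishes, so the sum may be extended by one term.
    have : hatCoef k (k + 1) = 0 := by simp [hatCoef]
    rw [this, zero_mul, add_zero]
    refine Finset.sum_congr rfl fun j hj => ?_
    rw [Finset.mem_range_succ_iff] at hj
    rw [Nat.sub_add_comm hj]
  rw [h1, ← Finset.sum_add_distrib]
  refine Finset.sum_congr rfl fun j _ => ?_
  simp only [hatCoef, Nat.choose_succ_succ (k + 1) j]
  push_cast
  ring

/-- In the notation of `hatCoef_recurrence`, b^{k+1} = (b - a)^{k+1} + a h_k: after the shift by a,
the second sum cancels every term of the first except j = 0. -/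
theorem hatCoef_parts (k : ℕ) (D : ℕ → ℕ → ℝ) :
    D 0 (k + 1) =
      (∑ j ∈ Finset.range (k + 1 + 1), (-1) ^ j * ((k + 1).choose j : ℝ) * D j (k + 1 - j)) +
        ∑ j ∈ Finset.range (k + 1), hatCoef k j * D (j + 1) (k - j) := by
  rw [Finset.sum_range_succ', add_right_comm, ← Finset.sum_add_distrib,
    Finset.sum_eq_zero fun j _ => ?_]
  · simp
  · rw [Nat.succ_sub_succ]; simp only [hatCoef]; ring

end Binomial

theorem dd_shift {F : Type*} [NormedAddCommGroup F] [NormedSpace ℝ F] (f : ℝ → ℝ → F) (a b : ℕ)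
    (r t s : ℝ) : dd a b (fun t s => f (t + r) s) t s = dd a b f (t + r) s :=
  congrFun (iteratedDeriv_comp_add_const a (fun t => iteratedDeriv b (f t) s) r) t

section Recurrence

variable {M E D : Mfd.{u}} {σ : VBData M E D} {U : Set M} {F G : Type u} [NormedAddCommGroup F]
    [NormedSpace ℝ F] [NormedAddCommGroup G] [NormedSpace ℝ G]

theorem vel_shift {N : Mfd.{u}} {c : ℝ → N} (hc : SmoothCurve N c) (a t : ℝ) :
    vel (fun s => c (a + s)) t = vel c (a + t) := by
  refine vel_comp_real (f := fun s => a + s) ?_ rfl (hc.mdiff _)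
  simpa using (hasDerivAt_id t).const_add a

/-- The tangent family of a representing family. -/
theorem IsRep.vel_right {k l : ℕ} {Φ : iterT k (iterT (l + 1) E)} {x : ℝ → M} {g : ℝ → ℝ → E}
    (R : IsRep σ U k (l + 1) Φ x g) (hp : ContMDiff E.I M.I ∞ σ.pE) :
    IsRep σ.T (Mfd.base ⁻¹' U) k l (jet k (fun t => jet l (fun s => vel (g t) s) 0) 0) (vel x)
      (fun t s => vel (g t) s) where
  smooth_x := R.smooth_x.vel
  x_mem t := R.x_mem t
  smooth_g := contMDiff_vel_family R.smooth_g
  pE_g t s := by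
    change tmap σ.pE _ = _
    rw [← vel_comp s ((hp _).mdifferentiableAt (by simp)) ((family_curve R.smooth_g t).mdiff s)]
    simp only [R.pE_g]
    exact vel_shift R.smooth_x t s
  eq := rfl

theorem IsRep.of_le {k l m n : ℕ} {Φ : iterT k (iterT l E)} {x : ℝ → M} {g : ℝ → ℝ → E}
    (R : IsRep σ U k l Φ x g) : IsRep σ U m n (jet m (fun t => jet n (g t) 0) 0) x g :=
  { R with eq := rfl }

/-- Moving the origin of t to r represents the whole curve of jets, so that Π can be evaluated along
it and then differentiated in r. -/
theorem IsRep.shift {k l : ℕ} {Φ : iterT k (iterT l E)} {x : ℝ → M} {g : ℝ → ℝ → E}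
    (R : IsRep σ U k l Φ x g) (m : ℕ) (r : ℝ) :
    IsRep σ U m l (jet m (fun t => jet l (g t) 0) r) (fun t => x (t + r))
      (fun t s => g (t + r) s) where
  smooth_x := R.smooth_x.reparam (by fun_prop)
  x_mem t := R.x_mem _
  smooth_g := ContMDiff.comp (f := fun p : ℝ × ℝ => (p.1 + r, p.2)) R.smooth_g
    (by fun_prop : ContDiff ℝ ∞ fun p : ℝ × ℝ => (p.1 + r, p.2)).contMDiff
  pE_g t s := by rw [R.pE_g]; congr 1; ring
  eq := by
    have := jet_add (family_jet_smooth R.smooth_g l) m r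
    simpa using congrFun this 0

/-- T^{(k+1)}N unfolds with the new T outermost, whereas the recurrence needs it innermost, as in
T^{(k)}TN. On jets of curves the cast merely rewrites j^{k+1} as j^k of the velocity. -/
theorem cast_trunc₂_jet_jet {N : Mfd.{u}} {g : ℝ → ℝ → N}
    (hg : ContMDiff 𝓘(ℝ, ℝ × ℝ) N.I ∞ fun p : ℝ × ℝ => g p.1 p.2) (k : ℕ) :
    Mfd.cast (congrArg (iterT k) (iterT_iterT (m := k) (n := 1) N rfl).symm)
      (trunc₂ k (k + 1) (Nat.le_succ k) le_rfl
        (jet (k + 1) (fun t => jet (k + 1) (g t) 0) 0)) =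
      jet k (fun t => jet k (fun s => vel (g t) s) 0) 0 := by
  rw [trunc₂_jet_jet hg, Mfd.cast_jet (iterT_iterT (m := k) (n := 1) N rfl).symm]
  refine congrArg (fun c => jet (N := iterT k N.T) k c 0) (funext fun t => ?_)
  have h := merge_jet (m := k) (n := 1) (k := k + 1) rfl (g t) 0
  rw [← h]
  exact Mfd.cast_cast _ _ _

namespace VBChart

variable {hE : FibreChart σ.pE U F} {hD : FibreChart σ.pD U G} {β : G →L[ℝ] F →L[ℝ] ℝ}
  (c : VBChart σ hE hD β) [M.I.Boundaryless] {k : ℕ}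

include c

theorem momentum_zero (Φ : E) (hU : σ.pE Φ ∈ U) : σ.momentum 0 Φ = Φ := by
  have R : IsRep σ U 0 0 Φ (fun _ => σ.pE Φ) (fun _ _ => Φ) :=
    ⟨contMDiff_const, fun _ => hU, contMDiff_const, fun _ _ => rfl, rfl⟩
  rw [c.momentum_eq R]
  refine Eq.trans ?_ (hE.s_y _ hU)
  change hE.s (σ.pE Φ) (tpoly 0 _ 0) = _
  rw [tpoly_zero]
  simp [projCoef, hatCoef, dd_zero]

variable {Φ : iterT (k + 1) (iterT (k + 1) E)} {x : ℝ → M} {g : ℝ → ℝ → E}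

/-- Φ^{(k,k+1)}, read in T^k T^k TE, is represented by ∂_s g over the velocity of x, and its pairing
with the velocity of ξ is ∂_s P. All terms are then derivatives of P at the origin, related by
`hatCoef_recurrence`. -/
theorem momentum_succ (R : IsRep σ U (k + 1) (k + 1) Φ x g) {Ψ : iterT (k + 1) D}
    (hΨ : Ψ ∈ σ.dualVel (k + 1) (σ.baseVel (k + 1) Φ)) :
    (σ.iter (k + 1)).pair Ψ (σ.momentum (k + 1) Φ) =
      σ.pair (pt (k + 1) Ψ) (σ.upsilon (k + 1) Φ) +
      (σ.iter (k + 1)).pair Ψ (merge (n := 1) (N := E) rfl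
        (σ.T.momentum k (jet k (fun t => jet k (fun s => vel (g t) s) 0) 0))) := by
  obtain ⟨ξ, hξ, hp, rfl⟩ := exists_dual_jet hE hD R hΨ
  set P : ℝ → ℝ → ℝ := fun t s => σ.pair (ξ (t + s)) (g t s) with hP
  have hξv : ∀ t, σ.T.pD (vel ξ t) = vel x t := fun t => by
    change tmap σ.pD _ = _
    rw [← vel_comp t (hD.mdiff_p _) (hξ.mdiff t)]; simp only [hp]
  have h1 : (σ.iter (k + 1)).pair (jet (k + 1) ξ 0) (merge (n := 1) (N := E) rfl
        (σ.T.momentum k (jet k (fun t => jet k (fun s => vel (g t) s) 0) 0))) =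
      ∑ j ∈ Finset.range (k + 1), hatCoef k j * dd j (k - j + 1) P 0 0 := by
    have e := (merge_jet (m := k) (n := 1) (k := k + 1) rfl ξ 0).symm
    rw [e]
    refine (pair_merge σ (n := 1) rfl (jet k (jet 1 ξ) 0)
      (σ.T.momentum k (jet k (fun t => jet k (fun s => vel (g t) s) 0) 0))).trans ?_
    have R' := (R.of_le (m := k) (n := k + 1)).vel_right hE.smooth_p
    refine ((c.T).pair_momentum R' hξ.vel hξv).trans (Finset.sum_congr rfl fun j _ => ?_)
    rw [← dd_deriv_right]
    congr 2
    funext t s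
    rw [← vel_shift hξ t s]
    exact c.pair_vel (hξ.reparam (by fun_prop)) (family_curve R.smooth_g t)
      (fun s => (hp _).trans (R.pE_g t s).symm) (R.g_mem t s)
  rw [h1, pt_jet, c.pair_momentum R hξ hp, c.pair_upsilon R hξ hp]
  exact hatCoef_recurrence k fun a b => dd a b P 0 0

/-- The curve in `T^k T^l E` with velocity a given semi-holonomic vector. -/
theorem smoothCurve_momentum (R : IsRep σ U (k + 1) (k + 1) Φ x g) :
    SmoothCurve (iterT k E) fun r => σ.momentum k (jet k (fun t => jet k (g t) 0) r) := by
  have hU : ∀ r, σ.pE (pt k (pt (N := iterT k E) k (jet k (fun t => jet k (g t) 0) r))) ∈ U :=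
    fun r => by rw [pt_jet, pt_jet]; exact R.g_mem r 0
  have h1 : SmoothCurve _ (fun r => hE.momLocal k (jet k (fun t => jet k (g t) 0) r)) :=
    (hE.contMDiffOn_momLocal k).comp_contMDiff ((family_jet_smooth R.smooth_g k).jet k)
      fun r => by rw [mem_overSet, mem_overSet]; exact hU r
  refine ContMDiff.congr h1 fun r => ?_
  exact c.momentum_eq_local ((R.of_le (m := k) (n := k)).shift k r |>.mem_semiHol hE.smooth_p) (hU r)

/-- Applying TΠ to the velocity of a curve of jets means differentiating ⟨j^k ξ, Π⟩ along this
curve. Its value at r is Σ_j h_j ∂_t^j ∂_s^{k-j} P(r, 0), so the derivative at 0 adds one ∂_t to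
each term, and `hatCoef_parts` concludes. -/
theorem integration_by_parts (R : IsRep σ U (k + 1) (k + 1) Φ x g) {Ψ : iterT (k + 1) D}
    (hΨ : Ψ ∈ σ.dualVel (k + 1) (σ.baseVel (k + 1) Φ)) :
    (σ.iter (k + 1)).pair Ψ
        (part Φ 0 (k + 1) (k + 1) (Nat.zero_le _) le_rfl (Nat.zero_add _)) =
      σ.pair (pt (k + 1) Ψ) (σ.upsilon (k + 1) Φ) +
      (σ.iter (k + 1)).pair Ψ
        (tmapOn (σ.SemiHol k k) (σ.momentum k) (vel (jet k (fun t => jet k (g t) 0)) 0)) := by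
  obtain ⟨ξ, hξ, hp, rfl⟩ := exists_dual_jet hE hD R hΨ
  set P : ℝ → ℝ → ℝ := fun t s => σ.pair (ξ (t + s)) (g t s) with hP
  have hPs : ContDiff ℝ ∞ fun p : ℝ × ℝ => P p.1 p.2 := by
    simp only [hP, c.pair_family R hp]
    exact (β.contDiff.comp ((contDiff_dual hD R hξ hp).comp (by fun_prop))).clm_apply
      (R.contDiff_y hE)
  have Rk : ∀ r, IsRep σ U k k (jet k (fun t => jet k (g t) 0) r) (fun t => x (t + r))
      (fun t s => g (t + r) s) := fun r => (R.of_le (m := k) (n := k)).shift k r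
  have hC := (family_jet_smooth R.smooth_g k).jet k
  have hU : σ.pE (pt k (pt (N := iterT k E) k (jet k (fun t => jet k (g t) 0) 0))) ∈ U := by
    rw [pt_jet, pt_jet]; exact R.g_mem 0 0
  have hmp : ∀ r, (σ.iter k).pE (σ.momentum k (jet k (fun t => jet k (g t) 0) r)) = jet k x r :=
    fun r => by
      have hUr : σ.pE (pt k (pt (N := iterT k E) k (jet k (fun t => jet k (g t) 0) r))) ∈ U := by
        rw [pt_jet, pt_jet]; exact R.g_mem r 0
      rw [VBData.iter_pE, c.momentum_p ((Rk r).mem_semiHol hE.smooth_p) hUr, pt_jet,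
        iterMap_jet hE.smooth_p (family_curve R.smooth_g r)]
      simp only [R.pE_g]
      exact jet_shift R.smooth_x k r
  have hξp : ∀ r, (σ.iter k).pD (jet k ξ r) = jet k x r := fun r => by
    rw [VBData.iter_pD, iterMap_jet hD.smooth_p hξ]; simp only [hp]
  have h1 : (σ.iter (k + 1)).pair (jet (k + 1) ξ 0)
        (tmapOn (σ.SemiHol k k) (σ.momentum k) (vel (jet k (fun t => jet k (g t) 0)) 0)) =
      ∑ j ∈ Finset.range (k + 1), hatCoef k j * dd (j + 1) (k - j) P 0 0 := by
    rw [c.tmapOn_momentum hC (fun r => (Rk r).mem_semiHol hE.smooth_p) hU]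
    refine ((c.iter k).pair_vel (hξ.jet k) (c.smoothCurve_momentum R)
      (fun r => (hξp r).trans (hmp r).symm)
      (by rw [hmp]; exact jet_mem_overSet k (R.x_mem 0))).trans ?_
    have h2 : ∀ r, (σ.iter k).pair (jet k ξ r) (σ.momentum k (jet k (fun t => jet k (g t) 0) r)) =
        ∑ j ∈ Finset.range (k + 1), hatCoef k j * dd j (k - j) P r 0 := fun r => by
      have e : jet k ξ r = jet k (fun t => ξ (t + r)) 0 := by rw [jet_add hξ]; simp
      rw [e, c.pair_momentum (Rk r) (hξ.reparam (by fun_prop)) fun t => hp _]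
      refine Finset.sum_congr rfl fun j _ => ?_
      have e2 : (fun t s => σ.pair (ξ (t + s + r)) (g (t + r) s)) = fun t s => P (t + r) s := by
        funext t s; simp only [hP]; congr 2; ring
      rw [e2, dd_shift, zero_add]
    rw [funext h2]
    have hd : ∀ j ∈ Finset.range (k + 1), HasDerivAt (fun r => hatCoef k j * dd j (k - j) P r 0)
        (hatCoef k j * dd (j + 1) (k - j) P 0 0) 0 := fun j _ => by
      rw [← deriv_dd_left]
      exact (((contDiff_slice_left (contDiff_dd hPs j (k - j)) 0).differentiable (by simp)
        0).hasDerivAt).const_mul _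
    exact (HasDerivAt.fun_sum hd).deriv
  rw [h1, c.pair_part R hξ hp, pt_jet, c.pair_upsilon R hξ hp]
  exact hatCoef_parts k fun a b => dd a b P 0 0

end VBChart

end Recurrence

/-! ### Splitting -/

section Localize

variable {N : Mfd.{u}}

theorem exists_localize₂ {g : ℝ → ℝ → N}
    (hg : ContMDiff 𝓘(ℝ, ℝ × ℝ) N.I ∞ fun p : ℝ × ℝ => g p.1 p.2) {O : Set N} (hO : IsOpen O)
    (h0 : g 0 0 ∈ O) : ∃ g' : ℝ → ℝ → N,
      ContMDiff 𝓘(ℝ, ℝ × ℝ) N.I ∞ (fun p : ℝ × ℝ => g' p.1 p.2) ∧ (∀ t s, g' t s ∈ O) ∧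
      ∃ A : Set ℝ, IsOpen A ∧ (0 : ℝ) ∈ A ∧ ∀ t ∈ A, ∀ s ∈ A, g' t s = g t s := by
  obtain ⟨θ, h1, h2, h3⟩ := exists_cutoff_two
    ((ContMDiff.continuous hg).continuousAt.preimage_mem_nhds (x := ((0, 0) : ℝ × ℝ))
      (hO.mem_nhds h0))
  obtain ⟨A, hA, hAo, hA0⟩ := eventually_nhds_iff.1 h2
  refine ⟨fun t s => g (θ t) (θ s), ?_, h3, A, hAo, hA0, fun t ht s hs => by
    simp only [hA t ht, hA s hs]⟩
  exact ContMDiff.comp (f := fun p : ℝ × ℝ => (θ p.1, θ p.2)) hg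
    ((h1.comp contDiff_fst).prodMk (h1.comp contDiff_snd)).contMDiff

theorem exists_localize₃ {g : ℝ → ℝ → ℝ → N}
    (hg : ContMDiff 𝓘(ℝ, ℝ × ℝ × ℝ) N.I ∞ fun p : ℝ × ℝ × ℝ => g p.1 p.2.1 p.2.2) {O : Set N}
    (hO : IsOpen O) (h0 : g 0 0 0 ∈ O) : ∃ g' : ℝ → ℝ → ℝ → N,
      ContMDiff 𝓘(ℝ, ℝ × ℝ × ℝ) N.I ∞ (fun p : ℝ × ℝ × ℝ => g' p.1 p.2.1 p.2.2) ∧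
      (∀ t s r, g' t s r ∈ O) ∧
      ∃ A : Set ℝ, IsOpen A ∧ (0 : ℝ) ∈ A ∧ ∀ t ∈ A, ∀ s ∈ A, ∀ r ∈ A, g' t s r = g t s r := by
  obtain ⟨θ, h1, h2, h3⟩ := exists_cutoff_three
    ((ContMDiff.continuous hg).continuousAt.preimage_mem_nhds (x := ((0, 0, 0) : ℝ × ℝ × ℝ))
      (hO.mem_nhds h0))
  obtain ⟨A, hA, hAo, hA0⟩ := eventually_nhds_iff.1 h2
  refine ⟨fun t s r => g (θ t) (θ s) (θ r), ?_, h3, A, hAo, hA0, fun t ht s hs r hr => by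
    simp only [hA t ht, hA s hs, hA r hr]⟩
  exact ContMDiff.comp (f := fun p : ℝ × ℝ × ℝ => (θ p.1, θ p.2.1, θ p.2.2)) hg
    ((h1.comp contDiff_fst).prodMk ((h1.comp (contDiff_fst.comp contDiff_snd)).prodMk
      (h1.comp (contDiff_snd.comp contDiff_snd)))).contMDiff

theorem jet_jet_congr {g g' : ℝ → ℝ → N} {A : Set ℝ} (hA : IsOpen A) (h0 : (0 : ℝ) ∈ A)
    (h : ∀ t ∈ A, ∀ s ∈ A, g' t s = g t s) (k l : ℕ) :
    jet k (fun t => jet l (g' t) 0) 0 = jet k (fun t => jet l (g t) 0) 0 := by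
  refine jet_congr_at k ?_
  filter_upwards [hA.mem_nhds h0] with t ht
  refine jet_congr_at l ?_
  filter_upwards [hA.mem_nhds h0] with s hs using h t ht s hs

/-- The second-order tangent family `∂_t ∂_s g`. -/
def velVel (g : ℝ → ℝ → N) (t s : ℝ) : N.T.T := vel (fun t => vel (g t) s) t

theorem velVel_congr {g g' : ℝ → ℝ → N} {A : Set ℝ} (hA : IsOpen A)
    (h : ∀ t ∈ A, ∀ s ∈ A, g' t s = g t s) : ∀ t ∈ A, ∀ s ∈ A, velVel g' t s = velVel g t s := by
  intro t ht s hs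
  refine vel_congr ?_
  filter_upwards [hA.mem_nhds ht] with t ht
  refine vel_congr ?_
  filter_upwards [hA.mem_nhds hs] with s hs using h t ht s hs

theorem contMDiff_velVel {g : ℝ → ℝ → N}
    (hg : ContMDiff 𝓘(ℝ, ℝ × ℝ) N.I ∞ fun p : ℝ × ℝ => g p.1 p.2) :
    ContMDiff 𝓘(ℝ, ℝ × ℝ) N.T.T.I ∞ fun p : ℝ × ℝ => velVel g p.1 p.2 := by
  have hswap : ContMDiff 𝓘(ℝ, ℝ × ℝ) 𝓘(ℝ, ℝ × ℝ) ∞ fun p : ℝ × ℝ => (p.2, p.1) :=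
    (contDiff_snd.prodMk contDiff_fst).contMDiff
  have h1 : ContMDiff 𝓘(ℝ, ℝ × ℝ) N.T.I ∞ fun p : ℝ × ℝ => vel (g p.2) p.1 :=
    (contMDiff_vel_family hg).comp hswap
  exact (contMDiff_vel_family (g := fun s t => vel (g t) s) h1).comp hswap

theorem velVel_eq {g : ℝ → ℝ → N}
    (hg : ContMDiff 𝓘(ℝ, ℝ × ℝ) N.I ∞ fun p : ℝ × ℝ => g p.1 p.2) (t s : ℝ) :
    vel (fun t' => vel (fun s' => g (t + t') (s + s')) 0) 0 = velVel g t s := by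
  have h1 : ContMDiff 𝓘(ℝ, ℝ × ℝ) N.T.I ∞ fun p : ℝ × ℝ => vel (g p.1) p.2 :=
    contMDiff_vel_family hg
  simp only [fun t' => vel_shift (family_curve hg (t + t')) s 0, add_zero]
  rw [vel_shift (family_curve_left (g := fun t s => vel (g t) s) h1 s), add_zero]
  rfl

end Localize

section Coordinates

theorem dd_prodMk {F F' : Type*} [NormedAddCommGroup F] [NormedSpace ℝ F] [NormedAddCommGroup F']
    [NormedSpace ℝ F'] {f : ℝ → ℝ → F} {g : ℝ → ℝ → F'}
    (hf : ContDiff ℝ ∞ fun p : ℝ × ℝ => f p.1 p.2)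
    (hg : ContDiff ℝ ∞ fun p : ℝ × ℝ => g p.1 p.2) (a b : ℕ) (t s : ℝ) :
    dd a b (fun t s => (f t s, g t s)) t s = (dd a b f t s, dd a b g t s) := by
  have hp : ContDiff ℝ ∞ fun p : ℝ × ℝ => (f p.1 p.2, g p.1 p.2) := hf.prodMk hg
  exact Prod.ext
    (dd_clm (ContinuousLinearMap.fst ℝ F F') (f := fun t s => (f t s, g t s)) hp a b t s).symm
    (dd_clm (ContinuousLinearMap.snd ℝ F F') (f := fun t s => (f t s, g t s)) hp a b t s).symm

theorem upsCoef_prodMk {F F' : Type*} [NormedAddCommGroup F] [NormedSpace ℝ F]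
    [NormedAddCommGroup F'] [NormedSpace ℝ F'] (k : ℕ) (y : ℕ → ℕ → F) (y' : ℕ → ℕ → F') :
    upsCoef k (fun a b => (y a b, y' a b)) = (upsCoef k y, upsCoef k y') := by
  refine Prod.ext ?_ ?_
  · simp [upsCoef, Prod.fst_sum]
  · simp [upsCoef, Prod.snd_sum]

/-- Pascal's rule in the form (b - a)^{k+1} = b (b - a)^k - a (b - a)^k. -/
theorem upsCoef_succ {F : Type*} [NormedAddCommGroup F] [NormedSpace ℝ F] (k : ℕ)
    (y : ℕ → ℕ → F) : upsCoef (k + 1) y =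
      upsCoef k (fun a b => y a (b + 1)) - upsCoef k (fun a b => y (a + 1) b) := by
  have h1 : upsCoef k (fun a b => y a (b + 1)) = ∑ a ∈ Finset.range (k + 1 + 1),
      ((-1) ^ a * (k.choose a : ℝ)) • y a (k + 1 - a) := by
    rw [Finset.sum_range_succ _ (k + 1)]
    simp only [Nat.choose_succ_self, Nat.cast_zero, mul_zero, zero_smul, add_zero]
    refine Finset.sum_congr rfl fun a ha => ?_
    rw [Nat.sub_add_comm (Finset.mem_range_succ_iff.1 ha)]
  rw [h1, upsCoef, Finset.sum_range_succ', Finset.sum_range_succ' (fun a =>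
    ((-1) ^ a * (k.choose a : ℝ)) • y a (k + 1 - a)), upsCoef, add_sub_right_comm,
    ← Finset.sum_sub_distrib]
  congr 1
  · refine Finset.sum_congr rfl fun a _ => ?_
    rw [Nat.succ_sub_succ, ← sub_smul, Nat.choose_succ_succ]
    congr 1
    push_cast
    ring
  · simp

theorem upsCoef_one {F : Type*} [NormedAddCommGroup F] [NormedSpace ℝ F] (y : ℕ → ℕ → F) :
    upsCoef 1 y = y 0 1 - y 1 0 := by
  simp [upsCoef, Finset.sum_range_succ, sub_eq_add_neg]

variable {N : Mfd.{u}} {W : Type*} [NormedAddCommGroup W] [NormedSpace ℝ W]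

theorem vlift_vlift_velVel {φ : N → W} {O : Set N} (hO : IsOpen O)
    (hφ : ContMDiffOn N.I 𝓘(ℝ, W) ∞ φ O) {g : ℝ → ℝ → N}
    (hg : ContMDiff 𝓘(ℝ, ℝ × ℝ) N.I ∞ fun p : ℝ × ℝ => g p.1 p.2) (hgO : ∀ t s, g t s ∈ O)
    (t s : ℝ) : vlift (vlift φ) (velVel g t s) =
      ((φ (g t s), deriv (fun s => φ (g t s)) s),
        (deriv (fun t => φ (g t s)) t, deriv (fun t => deriv (fun s => φ (g t s)) s) t)) := by
  have hy : ContDiff ℝ ∞ fun p : ℝ × ℝ => φ (g p.1 p.2) :=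
    contDiff_comp_family hφ hg fun p => hgO p.1 p.2
  have h1 : ContMDiff 𝓘(ℝ, ℝ × ℝ) N.T.I ∞ fun p : ℝ × ℝ => vel (g p.1) p.2 :=
    contMDiff_vel_family hg
  have h2 : ∀ t s, vlift φ (vel (g t) s) = (φ (g t s), deriv (fun s => φ (g t s)) s) :=
    fun t s => vlift_vel (mdifferentiableAt_of_smoothOn hO hφ (hgO t s))
      ((family_curve hg t).mdiff s)
  unfold velVel
  rw [vlift_vel (mdifferentiableAt_of_smoothOn (O := Mfd.base ⁻¹' O)
    (hO.preimage contMDiff_base.continuous) (contMDiffOn_vlift hO hφ) (hgO t s))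
    ((family_curve_left (g := fun t s => vel (g t) s) h1 s).mdiff t)]
  simp only [h2]
  refine Prod.ext rfl (HasDerivAt.deriv ?_)
  exact ((contDiff_slice_left (f := fun t s => φ (g t s)) hy s).differentiable (by simp)
    t).hasDerivAt.prodMk
    ((contDiff_slice_left (f := fun t s => deriv (fun s => φ (g t s)) s)
      (contDiff_deriv_right (f := fun t s => φ (g t s)) hy) s).differentiable (by simp)
    t).hasDerivAt

/-- The inner pair of coordinates records ∂_s and the outer pair ∂_t, so the four slots raise the
two orders independently by 0 or 1. -/
theorem dd_vlift_velVel {φ : N → W} {O : Set N} (hO : IsOpen O)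
    (hφ : ContMDiffOn N.I 𝓘(ℝ, W) ∞ φ O) {g : ℝ → ℝ → N}
    (hg : ContMDiff 𝓘(ℝ, ℝ × ℝ) N.I ∞ fun p : ℝ × ℝ => g p.1 p.2) (hgO : ∀ t s, g t s ∈ O)
    (a b : ℕ) (t s : ℝ) : dd a b (fun t s => vlift (vlift φ) (velVel g t s)) t s =
      ((dd a b (fun t s => φ (g t s)) t s, dd a (b + 1) (fun t s => φ (g t s)) t s),
        (dd (a + 1) b (fun t s => φ (g t s)) t s,
          dd (a + 1) (b + 1) (fun t s => φ (g t s)) t s)) := by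
  have hy : ContDiff ℝ ∞ fun p : ℝ × ℝ => φ (g p.1 p.2) :=
    contDiff_comp_family hφ hg fun p => hgO p.1 p.2
  have hs := contDiff_deriv_right (f := fun t s => φ (g t s)) hy
  have ht := contDiff_deriv_left (f := fun t s => φ (g t s)) hy
  have hts := contDiff_deriv_left (f := fun t s => deriv (fun s => φ (g t s)) s) hs
  simp only [vlift_vlift_velVel hO hφ hg hgO]
  rw [dd_prodMk (hy.prodMk hs) (ht.prodMk hts), dd_prodMk hy hs, dd_prodMk ht hts,
    dd_deriv_right, dd_deriv_left hy, dd_deriv_left (f := fun t s => deriv (fun s => φ (g t s)) s)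
      hs, dd_deriv_right]

/-- The jet of ∂_t ∂_s g of bidegree (k, k) involves only partial derivatives of g of order at most
k + 1 in each variable, and these are determined by X. Both families are first cut off into one
chart, where coordinates separate points. -/
theorem isSplit_unique [N.I.Boundaryless] {k : ℕ} {X : iterT (k + 1) (iterT (k + 1) N)}
    {Y Y' : iterT k (iterT k N.T.T)} (h : IsSplit k X Y) (h' : IsSplit k X Y') : Y = Y' := by
  obtain ⟨g, hg, rfl, rfl⟩ := h
  obtain ⟨g', hg', hX, rfl⟩ := h'
  simp only [velVel_eq hg, velVel_eq hg']
  have h0 : g' 0 0 = g 0 0 := by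
    have := congrArg (fun X => pt (k + 1) (pt (N := iterT (k + 1) N) (k + 1) X)) hX
    simpa only [pt_jet] using this
  set φ := extChartAt N.I (g 0 0)
  have hL := smoothLeftInv_extChartAt (g 0 0)
  obtain ⟨f, hf, hfO, A, hA, hA0, hfA⟩ := exists_localize₂ hg hL.isOpen_source
    (mem_extChartAt_source _)
  obtain ⟨f', hf', hfO', A', hA', hA0', hfA'⟩ := exists_localize₂ hg' hL.isOpen_source
    (by rw [h0]; exact mem_extChartAt_source _)
  have e : iterLift (iterLift φ (k + 1)) (k + 1)
      (jet (k + 1) (fun t => jet (k + 1) (f' t) 0) 0) =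
      iterLift (iterLift φ (k + 1)) (k + 1) (jet (k + 1) (fun t => jet (k + 1) (f t) 0) 0) := by
    rw [jet_jet_congr hA hA0 hfA, jet_jet_congr hA' hA0' hfA']
    exact congrArg _ hX
  rw [iterLift_jet_jet hL.isOpen_source hL.smooth hf' hfO',
    iterLift_jet_jet hL.isOpen_source hL.smooth hf hfO] at e
  have hdd : ∀ a ≤ k + 1, ∀ b ≤ k + 1, dd a b (fun t s => φ (f' t s)) 0 0 =
      dd a b (fun t s => φ (f t s)) 0 0 := fun a ha b hb => symJet_inj (symJet_inj e ha) hb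
  refine (jet_jet_congr hA hA0 (velVel_congr hA hfA) k k).symm.trans (Eq.trans ?_
    (jet_jet_congr hA' hA0' (velVel_congr hA' hfA') k k))
  obtain ⟨s₁, R₁, h₁⟩ := hL.T.T.iter k
  obtain ⟨s₂, R₂, h₂⟩ := h₁.iter k
  have hO2 : IsOpen (Mfd.base ⁻¹' (Mfd.base ⁻¹' φ.source) : Set N.T.T) := hL.T.T.isOpen_source
  have hm : ∀ f : ℝ → ℝ → N, (∀ t s, f t s ∈ φ.source) →
      jet k (fun t => jet k (velVel f t) 0) 0 ∈
        overSet k (overSet k (Mfd.base ⁻¹' (Mfd.base ⁻¹' φ.source) : Set N.T.T)) := fun f hf =>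
    jet_mem_overSet k (jet_mem_overSet k (hf 0 0))
  refine h₂.inj (hm f hfO) (hm f' hfO') ?_
  rw [iterLift_jet_jet hO2 hL.T.T.smooth (contMDiff_velVel hf) fun t s => hfO t s,
    iterLift_jet_jet hO2 hL.T.T.smooth (contMDiff_velVel hf') fun t s => hfO' t s]
  refine symJet_congr fun a ha => symJet_congr fun b hb => ?_
  rw [dd_vlift_velVel hL.isOpen_source hL.smooth hf hfO,
    dd_vlift_velVel hL.isOpen_source hL.smooth hf' hfO', hdd a (by omega) b (by omega),
    hdd a (by omega) (b + 1) (by omega), hdd (a + 1) (by omega) b (by omega),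
    hdd (a + 1) (by omega) (b + 1) (by omega)]

end Coordinates

section Split

variable {M E D : Mfd.{u}} {σ : VBData M E D} {U : Set M} {F G : Type u} [NormedAddCommGroup F]
    [NormedSpace ℝ F] [NormedAddCommGroup G] [NormedSpace ℝ G]

theorem IsRep.isSplit {k : ℕ} {Φ : iterT (k + 1) (iterT (k + 1) E)} {x : ℝ → M} {g : ℝ → ℝ → E}
    (R : IsRep σ U (k + 1) (k + 1) Φ x g) :
    IsSplit k Φ (jet k (fun t => jet k (velVel g t) 0) 0) :=
  ⟨g, R.smooth_g, R.eq, by simp only [velVel_eq R.smooth_g]⟩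

theorem IsRep.velVel {k l m n : ℕ} {Φ : iterT k (iterT l E)} {x : ℝ → M} {g : ℝ → ℝ → E}
    (R : IsRep σ U k l Φ x g) (hp : ContMDiff E.I M.I ∞ σ.pE) :
    IsRep σ.T.T (Mfd.base ⁻¹' (Mfd.base ⁻¹' U)) m n (jet m (fun t => jet n (velVel g t) 0) 0)
      (vel (vel x)) (velVel g) where
  smooth_x := R.smooth_x.vel.vel
  x_mem t := R.x_mem t
  smooth_g := contMDiff_velVel R.smooth_g
  pE_g t s := by
    have h1 : ContMDiff 𝓘(ℝ, ℝ × ℝ) E.T.I ∞ fun p : ℝ × ℝ => vel (g p.1) p.2 :=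
      contMDiff_vel_family R.smooth_g
    have h2 : ∀ t s, tmap σ.pE (vel (g t) s) = vel x (t + s) := fun t s => by
      rw [← vel_comp s ((hp _).mdifferentiableAt (by simp)) ((family_curve R.smooth_g t).mdiff s)]
      simp only [R.pE_g]
      exact vel_shift R.smooth_x t s
    change tmap (tmap σ.pE) (vel (fun t => vel (g t) s) t) = _
    rw [← vel_comp t ((contMDiff_tmap hp _).mdifferentiableAt (by simp))
      ((family_curve_left (g := fun t s => vel (g t) s) h1 s).mdiff t)]
    simp only [h2, add_comm _ s]
    exact vel_shift R.smooth_x.vel s t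
  eq := rfl

theorem dd_tpoly_tpoly {W : Type*} [NormedAddCommGroup W] [NormedSpace ℝ W] (k l a b : ℕ)
    (ha : a ≤ k) (hb : b ≤ l) (w : ℕ → ℕ → W) :
    dd a b (fun t => tpoly l fun b => tpoly k (fun a => w a b) t) 0 0 = w a b := by
  rw [dd_tpoly l a b hb, iteratedDeriv_tpoly k a ha]

namespace VBChart

variable {hE : FibreChart σ.pE U F} {hD : FibreChart σ.pD U G} {β : G →L[ℝ] F →L[ℝ] ℝ}
  (c : VBChart σ hE hD β) [M.I.Boundaryless] {k : ℕ}

include c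

variable {Φ : iterT (k + 1) (iterT (k + 1) E)} {x : ℝ → M} {g : ℝ → ℝ → E}

/-- Over TTσ, Υ_k yields a vector Z with coordinates w i j = (∂_s - ∂_t)^k ∂_t^i ∂_s^j y over the
second velocity of x. A polynomial of bidegree (1, 1) with these coefficients, placed over x(t + s),
represents Z, so Z is semi-holonomic. Then Υ_1 gives w 0 1 - w 1 0, which is (∂_s - ∂_t)^{k+1} y. -/
theorem upsilon_succ (R : IsRep σ U (k + 1) (k + 1) Φ x g) :
    σ.T.T.upsilon k (jet k (fun t => jet k (velVel g t) 0) 0) ∈ σ.SemiHol 1 1 ∧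
      σ.upsilon (k + 1) Φ =
        σ.upsilon 1 (σ.T.T.upsilon k (jet k (fun t => jet k (velVel g t) 0) 0)) := by
  set y : ℕ → ℕ → F := fun a b => dd a b (fun t s => hE.y (g t s)) 0 0 with hy
  let w : ℕ → ℕ → F := fun i j => upsCoef k fun a b => y (a + i) (b + j)
  have hf : ContDiff ℝ ∞ fun p : ℝ × ℝ =>
      tpoly 1 (fun b => tpoly 1 (fun a => w a b) p.1) p.2 :=
    contDiff_tpoly 1 fun i _ => contDiff_tpoly_const 1 fun a => w a i
  have R₁ := IsRep.of_chart hE R.smooth_x R.x_mem (f := fun t s =>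
    tpoly 1 (fun b => tpoly 1 (fun a => w a b) t) s) hf 1 1
  have RV := R.velVel (m := k) (n := k) hE.smooth_p
  have hu := c.T.T.upsilon_eq RV
  set Z := σ.T.T.upsilon k (jet k (fun t => jet k (velVel g t) 0) 0) with hZ
  have hx : vel (vel x) 0 ∈ (Mfd.base ⁻¹' (Mfd.base ⁻¹' U) : Set M.T.T) := R.x_mem 0
  have hyZ : vlift (vlift hE.y) Z = ((w 0 0, w 0 1), (w 1 0, w 1 1)) := by
    rw [hu]
    refine (hE.T.T.y_s _ hx _).trans ?_
    change upsCoef k (fun a b => dd a b (fun t s => vlift (vlift hE.y) (velVel g t s)) 0 0) = _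
    simp only [dd_vlift_velVel hE.isOpen_total hE.smooth_y R.smooth_g R.g_mem]
    rw [upsCoef_prodMk, upsCoef_prodMk, upsCoef_prodMk]
    rfl
  have hpZ : tmap (tmap σ.pE) Z = vel (vel x) 0 := by
    rw [hu]; exact hE.T.T.p_s _ hx _
  have hb := R₁.base hE.smooth_p
  have hl := R₁.lift_eq hE
  simp only [fun t s => hE.y_s _ (R.x_mem (t + s))] at hl
  have hZe : Z = jet 1 (fun t => jet 1 (fun s => hE.s (x (t + s))
      (tpoly 1 (fun b => tpoly 1 (fun a => w a b) t) s)) 0) 0 := by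
    refine hE.T.T.ext (by rw [hpZ]; exact hx) (hpZ.trans hb.symm) ?_
    refine hyZ.trans (Eq.trans ?_ hl.symm)
    refine Eq.trans ?_ (symJet_congr fun a ha => symJet_congr fun b hb =>
      (dd_tpoly_tpoly 1 1 a b ha hb w).symm)
    rfl
  have R₂ : IsRep σ U 1 1 Z x _ := { R₁ with eq := hZe.symm }
  refine ⟨R₂.mem_semiHol hE.smooth_p, ?_⟩
  rw [c.upsilon_eq R, c.upsilon_eq R₂]
  congr 1
  simp only [fun t s => hE.y_s _ (R.x_mem (t + s))]
  rw [upsCoef_congr (y' := w) fun a ha b hb => dd_tpoly_tpoly 1 1 a b ha hb w, upsCoef_succ,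
    upsCoef_one]
  rfl

end VBChart

end Split

/-! ### Flips -/

section ThreeParameters

variable {N : Mfd.{u}} {g : ℝ → ℝ → ℝ → N}

theorem contMDiff_vel_third
    (hg : ContMDiff 𝓘(ℝ, ℝ × ℝ × ℝ) N.I ∞ fun p : ℝ × ℝ × ℝ => g p.1 p.2.1 p.2.2) :
    ContMDiff 𝓘(ℝ, ℝ × ℝ) N.T.I ∞ fun p : ℝ × ℝ => vel (g p.1 p.2) 0 := by
  have h1 : ContMDiff 𝓘(ℝ, (ℝ × ℝ) × ℝ) N.I ∞ fun p : (ℝ × ℝ) × ℝ => g p.1.1 p.1.2 p.2 :=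
    ContMDiff.comp (f := fun p : (ℝ × ℝ) × ℝ => (p.1.1, p.1.2, p.2)) hg
      (by fun_prop : ContDiff ℝ ∞ fun p : (ℝ × ℝ) × ℝ => (p.1.1, p.1.2, p.2)).contMDiff
  exact contMDiff_jet_param (g := fun p : ℝ × ℝ => g p.1 p.2) h1 1 0

theorem smoothCurve_jet_jet
    (hg : ContMDiff 𝓘(ℝ, ℝ × ℝ × ℝ) N.I ∞ fun p : ℝ × ℝ × ℝ => g p.1 p.2.1 p.2.2) (k l : ℕ) :
    SmoothCurve (iterT k (iterT l N))
      fun r => jet k (fun t => jet l (fun s => g t s r) 0) 0 := by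
  have h1 : ContMDiff 𝓘(ℝ, (ℝ × ℝ) × ℝ) N.I ∞ fun p : (ℝ × ℝ) × ℝ => g p.1.2 p.2 p.1.1 :=
    ContMDiff.comp (f := fun p : (ℝ × ℝ) × ℝ => (p.1.2, p.2, p.1.1)) hg
      (by fun_prop : ContDiff ℝ ∞ fun p : (ℝ × ℝ) × ℝ => (p.1.2, p.2, p.1.1)).contMDiff
  have h2 := contMDiff_jet_param (g := fun (p : ℝ × ℝ) s => g p.2 s p.1) h1 l 0
  exact contMDiff_jet_param (g := fun r t => jet l (fun s => g t s r) 0) h2 k 0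

theorem family_third
    (hg : ContMDiff 𝓘(ℝ, ℝ × ℝ × ℝ) N.I ∞ fun p : ℝ × ℝ × ℝ => g p.1 p.2.1 p.2.2) (r : ℝ) :
    ContMDiff 𝓘(ℝ, ℝ × ℝ) N.I ∞ fun p : ℝ × ℝ => g p.1 p.2 r :=
  ContMDiff.comp (f := fun p : ℝ × ℝ => (p.1, p.2, r)) hg
    (by fun_prop : ContDiff ℝ ∞ fun p : ℝ × ℝ => (p.1, p.2, r)).contMDiff

theorem curve_third
    (hg : ContMDiff 𝓘(ℝ, ℝ × ℝ × ℝ) N.I ∞ fun p : ℝ × ℝ × ℝ => g p.1 p.2.1 p.2.2) (t s : ℝ) :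
    SmoothCurve N (g t s) :=
  ContMDiff.comp (f := fun r : ℝ => (t, s, r)) hg
    (by fun_prop : ContDiff ℝ ∞ fun r : ℝ => (t, s, r)).contMDiff

variable {W : Type*} [NormedAddCommGroup W] [NormedSpace ℝ W] {φ : N → W} {O : Set N}

/-- Partial derivatives in t and s commute with ∂_r. The flipped vector thus has a pair of tables as
coordinates, where `iterLift_jet_jet_vel` gives a table of pairs with the same entries. -/
theorem vlift_vel_jet_jet (hO : IsOpen O) (hφ : ContMDiffOn N.I 𝓘(ℝ, W) ∞ φ O)
    (hg : ContMDiff 𝓘(ℝ, ℝ × ℝ × ℝ) N.I ∞ fun p : ℝ × ℝ × ℝ => g p.1 p.2.1 p.2.2)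
    (hgO : ∀ t s r, g t s r ∈ O) (k l : ℕ) :
    vlift (iterLift (iterLift φ l) k)
        (vel (fun r => jet k (fun t => jet l (fun s => g t s r) 0) 0) 0) =
      (symJet k fun a => symJet l fun b => dd a b (fun t s => φ (g t s 0)) 0 0,
        symJet k fun a => symJet l fun b =>
          dd a b (fun t s => deriv (fun r => φ (g t s r)) 0) 0 0) := by
  have hC := smoothCurve_jet_jet hg k l
  have hLs := contMDiffOn_iterLift (isOpen_overSet hO l) (contMDiffOn_iterLift hO hφ l) k
  have hL : ∀ r, iterLift (iterLift φ l) k (jet k (fun t => jet l (fun s => g t s r) 0) 0) =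
      symJet k fun a => symJet l fun b => dd a b (fun t s => φ (g t s r)) 0 0 := fun r =>
    iterLift_jet_jet hO hφ (g := fun t s => g t s r) (family_third hg r) (fun t s => hgO t s r) k l
  have hy : ContDiff ℝ ∞ fun p : ℝ × ℝ × ℝ => φ (g p.1 p.2.1 p.2.2) :=
    contDiff_comp_family hφ hg fun p => hgO _ _ _
  refine (vlift_vel ?_ (hC.mdiff 0)).trans (Prod.ext (hL 0) ?_)
  · exact mdifferentiableAt_of_smoothOn (isOpen_overSet (isOpen_overSet hO l) k) hLs
      (jet_mem_overSet k (jet_mem_overSet l (hgO 0 0 0)))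
  rw [funext hL]
  exact (hasDerivAt_symJet k fun a _ => hasDerivAt_symJet l fun b _ =>
    hasDerivAt_dd3 (f := fun t s r => φ (g t s r)) hy a b 0 0 0).deriv

theorem iterLift_jet_jet_vel (hO : IsOpen O) (hφ : ContMDiffOn N.I 𝓘(ℝ, W) ∞ φ O)
    (hg : ContMDiff 𝓘(ℝ, ℝ × ℝ × ℝ) N.I ∞ fun p : ℝ × ℝ × ℝ => g p.1 p.2.1 p.2.2)
    (hgO : ∀ t s r, g t s r ∈ O) (k l : ℕ) :
    iterLift (iterLift (vlift φ) l) k (jet k (fun t => jet l (fun s => vel (g t s) 0) 0) 0) =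
      symJet k fun a => symJet l fun b => (dd a b (fun t s => φ (g t s 0)) 0 0,
        dd a b (fun t s => deriv (fun r => φ (g t s r)) 0) 0 0) := by
  have hy : ContDiff ℝ ∞ fun p : ℝ × ℝ × ℝ => φ (g p.1 p.2.1 p.2.2) :=
    contDiff_comp_family hφ hg fun p => hgO _ _ _
  have h0 : ContDiff ℝ ∞ fun p : ℝ × ℝ => φ (g p.1 p.2 0) :=
    hy.comp (f := fun p : ℝ × ℝ => (p.1, p.2, (0 : ℝ))) (by fun_prop)
  have h1 : ContDiff ℝ ∞ fun p : ℝ × ℝ => deriv (fun r => φ (g p.1 p.2 r)) 0 :=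
    (contDiff_deriv_third (f := fun t s r => φ (g t s r)) hy).comp
      (f := fun p : ℝ × ℝ => (p.1, p.2, (0 : ℝ))) (by fun_prop)
  rw [iterLift_jet_jet (N := N.T) (O := Mfd.base ⁻¹' O) (hO.preimage contMDiff_base.continuous)
    (contMDiffOn_vlift hO hφ) (g := fun t s => vel (g t s) 0) (contMDiff_vel_third hg)
    fun t s => hgO t s 0]
  refine symJet_congr fun a _ => symJet_congr fun b _ => ?_
  have h2 : ∀ t s, vlift φ (vel (g t s) 0) = (φ (g t s 0), deriv (fun r => φ (g t s r)) 0) :=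
    fun t s => vlift_vel (mdifferentiableAt_of_smoothOn hO hφ (hgO t s 0))
      ((curve_third hg t s).mdiff 0)
  simp only [h2]
  exact dd_prodMk h0 h1 a b 0 0

/-- In one chart X and Y carry the same partial derivatives, only arranged differently, so X
determines Y. -/
theorem isFlip₂_unique [N.I.Boundaryless] {k l : ℕ} {X : iterT k (iterT l N.T)}
    {Y Y' : (iterT k (iterT l N)).T} (h : IsFlip₂ k l X Y) (h' : IsFlip₂ k l X Y') : Y = Y' := by
  obtain ⟨g, hg, rfl, rfl⟩ := h
  obtain ⟨g', hg', hX, rfl⟩ := h'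
  have h0 : g' 0 0 0 = g 0 0 0 := by
    have := congrArg (fun X => Mfd.base (pt l (pt (N := iterT l N.T) k X))) hX
    simpa only [pt_jet, base_vel] using this
  set φ := extChartAt N.I (g 0 0 0)
  have hL := smoothLeftInv_extChartAt (g 0 0 0)
  obtain ⟨f, hf, hfO, A, hA, hA0, hfA⟩ := exists_localize₃ hg hL.isOpen_source
    (mem_extChartAt_source _)
  obtain ⟨f', hf', hfO', A', hA', hA0', hfA'⟩ := exists_localize₃ hg' hL.isOpen_source
    (by rw [h0]; exact mem_extChartAt_source _)
  have hYX : ∀ (g f : ℝ → ℝ → ℝ → N) (A : Set ℝ), IsOpen A → (0 : ℝ) ∈ A →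
      (∀ t ∈ A, ∀ s ∈ A, ∀ r ∈ A, f t s r = g t s r) →
      jet k (fun t => jet l (fun s => vel (f t s) 0) 0) 0 =
        jet k (fun t => jet l (fun s => vel (g t s) 0) 0) 0 ∧
      vel (fun r => jet k (fun t => jet l (fun s => f t s r) 0) 0) 0 =
        vel (fun r => jet k (fun t => jet l (fun s => g t s r) 0) 0) 0 := by
    intro g f A hA hA0 hfA
    refine ⟨jet_jet_congr (g := fun t s => vel (g t s) 0) (g' := fun t s => vel (f t s) 0) hA hA0
      (fun t ht s hs => vel_congr ?_) k l, vel_congr ?_⟩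
    · filter_upwards [hA.mem_nhds hA0] with r hr using hfA t ht s hs r hr
    · filter_upwards [hA.mem_nhds hA0] with r hr
      exact jet_jet_congr (g := fun t s => g t s r) (g' := fun t s => f t s r) hA hA0
        (fun t ht s hs => hfA t ht s hs r hr) k l
  obtain ⟨e1, e2⟩ := hYX g f A hA hA0 hfA
  obtain ⟨e1', e2'⟩ := hYX g' f' A' hA' hA0' hfA'
  have e : iterLift (iterLift (vlift φ) l) k
      (jet k (fun t => jet l (fun s => vel (f' t s) 0) 0) 0) =
      iterLift (iterLift (vlift φ) l) k (jet k (fun t => jet l (fun s => vel (f t s) 0) 0) 0) := by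
    rw [e1, e1']; exact congrArg _ hX
  rw [iterLift_jet_jet_vel hL.isOpen_source hL.smooth hf hfO,
    iterLift_jet_jet_vel hL.isOpen_source hL.smooth hf' hfO'] at e
  refine e2.symm.trans (Eq.trans ?_ e2')
  obtain ⟨s₁, R₁, h₁⟩ := hL.iter l
  obtain ⟨s₂, R₂, h₂⟩ := h₁.iter k
  refine h₂.T.inj (jet_mem_overSet k (jet_mem_overSet l (hfO 0 0 0)))
    (jet_mem_overSet k (jet_mem_overSet l (hfO' 0 0 0))) ?_
  rw [vlift_vel_jet_jet hL.isOpen_source hL.smooth hf hfO,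
    vlift_vel_jet_jet hL.isOpen_source hL.smooth hf' hfO']
  have hdd : ∀ a ≤ k, ∀ b ≤ l, _ := fun a ha b hb => symJet_inj (symJet_inj e ha) hb
  exact Prod.ext
    (symJet_congr fun a ha => symJet_congr fun b hb => (congrArg Prod.fst (hdd a ha b hb)).symm)
    (symJet_congr fun a ha => symJet_congr fun b hb => (congrArg Prod.snd (hdd a ha b hb)).symm)

end ThreeParameters

section Line

variable {F F' : Type*} [NormedAddCommGroup F] [NormedSpace ℝ F] [NormedAddCommGroup F']
    [NormedSpace ℝ F']

theorem projCoef_prodMk (k : ℕ) (c : ℕ → ℝ) (y : ℕ → ℕ → F) (y' : ℕ → ℕ → F') (i : ℕ) :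
    projCoef k c (fun a b => (y a b, y' a b)) i = (projCoef k c y i, projCoef k c y' i) := by
  refine Prod.ext ?_ ?_
  · simp only [projCoef, Prod.fst_sum, Prod.smul_fst]
  · simp only [projCoef, Prod.snd_sum, Prod.smul_snd]

theorem tpoly_prodMk (k : ℕ) (y : ℕ → F) (y' : ℕ → F') (t : ℝ) :
    tpoly k (fun i => (y i, y' i)) t = (tpoly k y t, tpoly k y' t) := by
  refine Prod.ext ?_ ?_
  · simp only [tpoly, Prod.fst_sum, Prod.smul_fst]
  · simp only [tpoly, Prod.snd_sum, Prod.smul_snd]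

theorem tpoly_line (k : ℕ) (r : ℝ) (y y' : ℕ → F) (t : ℝ) :
    tpoly k (fun i => y i + r • y' i) t = tpoly k y t + r • tpoly k y' t := by
  simp only [tpoly, smul_add, Finset.sum_add_distrib, Finset.smul_sum, smul_comm r]

theorem dd_line {u v : ℝ → ℝ → F} (hu : ContDiff ℝ ∞ fun p : ℝ × ℝ => u p.1 p.2)
    (hv : ContDiff ℝ ∞ fun p : ℝ × ℝ => v p.1 p.2) (r : ℝ) (a b : ℕ) (t s : ℝ) :
    dd a b (fun t s => u t s + r • v t s) t s = dd a b u t s + r • dd a b v t s := by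
  rw [dd_add (g := fun t s => r • v t s) hu (hv.const_smul r), dd_smul r hv]

end Line

section Flip

variable {M E D : Mfd.{u}} {σ : VBData M E D} {U : Set M} {F G : Type u} [NormedAddCommGroup F]
    [NormedSpace ℝ F] [NormedAddCommGroup G] [NormedSpace ℝ G]

theorem FibreChart.vel_line {p : E → M} (h : FibreChart p U F) {x : ℝ → M} (hx : SmoothCurve M x)
    (hxU : ∀ t, x t ∈ U) (a b : F) :
    vel (fun r => h.s (x r) (a + r • b)) 0 = h.T.s (vel x 0) (a, b) := by
  have hc := h.smoothCurve_s hx hxU (f := fun r => a + r • b) (by fun_prop)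
  have hp : ∀ r v, p (h.s (x r) v) = x r := fun r v => h.p_s _ (hxU r) v
  have hx0 : vel x 0 ∈ Mfd.base ⁻¹' U := hxU 0
  have hv : tmap p (vel (fun r => h.s (x r) (a + r • b)) 0) = vel x 0 := by
    rw [← vel_comp 0 (h.mdiff_p _) (hc.mdiff 0)]; simp only [hp]
  refine h.T.ext (by rw [hv]; exact hx0) (hv.trans (h.T.p_s _ hx0 _).symm) ?_
  rw [h.T.y_s _ hx0]
  change vlift h.y _ = _
  rw [vlift_vel (h.mdiff_y (by rw [hp]; exact hxU 0)) (hc.mdiff 0)]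
  simp only [fun r v => h.y_s _ (hxU r) v]
  refine Prod.ext (by simp) ?_
  simpa using (((hasDerivAt_id (0 : ℝ)).smul_const b).const_add a).deriv

/-- Choose a base family x(t, r) with ∂_r x(t, 0) equal near t = 0 to the base curve of Φ, and over
it the lines u + r v in the fibre. `upsCoef` and `projCoef` are linear, so Υ and Π along r are given
by fibre coordinates affine in r. Their r-derivatives at 0 are the chart formulas for Tσ, whose
fibre F × F contains the pair (u, v). -/
theorem VBChart.exists_flip {hE : FibreChart σ.pE U F} {hD : FibreChart σ.pD U G}
    {β : G →L[ℝ] F →L[ℝ] ℝ} (c : VBChart σ hE hD β) [M.I.Boundaryless] {k : ℕ}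
    {Φ : iterT k (iterT k E.T)} (hΦ : Φ ∈ σ.T.SemiHol k k)
    (hU : σ.T.pE (pt k (pt (N := iterT k E.T) k Φ)) ∈ Mfd.base ⁻¹' U) :
    ∃ Y, IsFlip₂ k k Φ Y ∧ Y ∈ Vel 1 (σ.SemiHol k k) ∧
      tmapOn (σ.SemiHol k k) (σ.upsilon k) Y = σ.T.upsilon k Φ ∧
      IsFlip k (σ.T.momentum k Φ) (tmapOn (σ.SemiHol k k) (σ.momentum k) Y) := by
  obtain ⟨X, f₀, -, R₀⟩ := IsRep.exists_of_mem hE.T hΦ hU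
  obtain ⟨x, hx, hxU, hxX⟩ := exists_family_vel_eq R₀.smooth_x hE.isOpen (R₀.x_mem 0)
  have hXs : SmoothCurve M.T fun t => vel (x t) 0 := family_jet_smooth hx 1
  -- The family for Φ is chosen anew over ∂_r x(·, 0), which has the same jets at 0 as the original
  -- base curve X.
  obtain ⟨f, hf, R⟩ := IsRep.exists_over hE.T hΦ.1 hXs (fun t => hxU t 0)
    ((R₀.base hE.T.smooth_p).trans (jet_congr_at k (jet_congr k hxX)).symm)
  set u : ℝ → ℝ → F := fun t s => (f t s).1
  set v : ℝ → ℝ → F := fun t s => (f t s).2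
  have hu : ContDiff ℝ ∞ fun p : ℝ × ℝ => u p.1 p.2 := hf.fst
  have hv : ContDiff ℝ ∞ fun p : ℝ × ℝ => v p.1 p.2 := hf.snd
  have hxr : ∀ r, SmoothCurve M fun t => x t r := family_curve_left hx
  set γ : ℝ → ℝ → ℝ → E := fun t s r => hE.s (x (t + s) r) (u t s + r • v t s) with hγ
  have hγs : ContMDiff 𝓘(ℝ, ℝ × ℝ × ℝ) E.I ∞ fun p : ℝ × ℝ × ℝ => γ p.1 p.2.1 p.2.2 := by
    refine hE.contMDiff_s (x := fun p : ℝ × ℝ × ℝ => x (p.1 + p.2.1) p.2.2) ?_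
      (fun p => hxU _ _) ?_
    · exact ContMDiff.comp (f := fun p : ℝ × ℝ × ℝ => (p.1 + p.2.1, p.2.2)) hx
        (by fun_prop : ContDiff ℝ ∞ fun p : ℝ × ℝ × ℝ => (p.1 + p.2.1, p.2.2)).contMDiff
    · have h1 : ContDiff ℝ ∞ fun p : ℝ × ℝ × ℝ => (p.1, p.2.1) := by fun_prop
      exact (hu.comp h1).add
        ((contDiff_snd.comp contDiff_snd : ContDiff ℝ ∞ fun p : ℝ × ℝ × ℝ => p.2.2).smul
          (hv.comp h1))
  set C : ℝ → iterT k (iterT k E) := fun r => jet k (fun t => jet k (fun s => γ t s r) 0) 0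
  have hCs : SmoothCurve _ C := smoothCurve_jet_jet hγs k k
  have RC : ∀ r, IsRep σ U k k (C r) (fun t => x t r) (fun t s => γ t s r) := fun r =>
    IsRep.of_chart hE (hxr r) (fun t => hxU t r) (f := fun t s => u t s + r • v t s)
      (hu.add (hv.const_smul r)) k k
  have hCS : ∀ r, C r ∈ σ.SemiHol k k := fun r => (RC r).mem_semiHol hE.smooth_p
  have hCU : σ.pE (pt k (pt (N := iterT k E) k (C 0))) ∈ U := by
    change σ.pE (pt k (pt k (jet k _ 0))) ∈ U
    rw [pt_jet, pt_jet]; exact (RC 0).g_mem 0 0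
  have hγy : ∀ r t s, hE.y (γ t s r) = u t s + r • v t s := fun r t s => hE.y_s _ (hxU _ _) _
  have hγv : ∀ t s, vel (γ t s) 0 = hE.T.s (vel (x (t + s)) 0) (f t s) := fun t s =>
    hE.vel_line (family_curve hx (t + s)) (hxU (t + s)) (u t s) (v t s)
  have hRy : ∀ t s, hE.T.y (hE.T.s (vel (x (t + s)) 0) (f t s)) = f t s := fun t s =>
    hE.T.y_s _ (R.x_mem (t + s)) _
  have hdf : ∀ a b, dd a b f 0 0 = (dd a b u 0 0, dd a b v 0 0) := fun a b =>
    dd_prodMk hu hv a b 0 0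
  refine ⟨vel C 0, ⟨γ, hγs, ?_, rfl⟩, ⟨C, hCs, hCS, rfl⟩, ?_, ?_⟩
  · simp only [hγv]; exact R.eq
  · rw [c.tmapOn_upsilon hCs hCS hCU]
    have h1 : ∀ r, σ.upsilon k (C r) = hE.s (x 0 r) ((upsCoef k fun a b => dd a b u 0 0) +
        r • upsCoef k fun a b => dd a b v 0 0) := fun r => by
      rw [c.upsilon_eq (RC r)]
      simp only [hγy, dd_line hu hv]
      rw [upsCoef_add, upsCoef_smul]
    rw [funext h1, hE.vel_line (family_curve hx 0) (hxU 0), c.T.upsilon_eq R]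
    simp only [hRy, hdf]
    rw [upsCoef_prodMk]
  · rw [c.tmapOn_momentum hCs hCS hCU]
    set zu := projCoef k (hatCoef k) fun a b => dd a b u 0 0 with hzu
    set zv := projCoef k (hatCoef k) fun a b => dd a b v 0 0 with hzv
    have h1 : ∀ r, σ.momentum k (C r) = jet k (fun t =>
        hE.s (x t r) (tpoly k zu t + r • tpoly k zv t)) 0 := fun r => by
      rw [c.momentum_eq (RC r)]
      simp only [hγy, dd_line hu hv]
      have : projCoef k (hatCoef k) (fun a b => dd a b u 0 0 + r • dd a b v 0 0) =
          fun i => zu i + r • zv i := funext fun i => by rw [projCoef_add, projCoef_smul]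
      simp only [this, tpoly_line]
    -- One family in (t, r) exhibits the flip: its k-jets in t are the values of Π for σ, and its
    -- r-velocities at 0 form the curve whose k-jet is Π for Tσ.
    refine ⟨fun t r => hE.s (x t r) (tpoly k zu t + r • tpoly k zv t), ?_, ?_, ?_⟩
    · refine hE.contMDiff_s (x := fun p : ℝ × ℝ => x p.1 p.2) hx (fun p => hxU _ _) ?_
      exact ((contDiff_tpoly_const k zu).comp contDiff_fst).add
        (contDiff_snd.smul ((contDiff_tpoly_const k zv).comp contDiff_fst))
    · rw [c.T.momentum_eq R]
      simp only [hRy, hdf]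
      have : projCoef k (hatCoef k) (fun a b => (dd a b u 0 0, dd a b v 0 0)) =
          fun i => (zu i, zv i) := funext fun i => projCoef_prodMk _ _ _ _ i
      simp only [this, tpoly_prodMk]
      simp only [fun t => hE.vel_line (family_curve hx t) (hxU t)]
    · rw [funext h1]

end Flip

/-! ### Charts of a vector bundle and its dual -/

section OfBundle

variable {V : Type u} [NormedAddCommGroup V] [NormedSpace ℝ V] {H : Type u} [TopologicalSpace H]
  (I : ModelWithCorners ℝ V H) {B : Type u} [TopologicalSpace B] [ChartedSpace H B]
  [IsManifold I ∞ B] {F : Type u} [NormedAddCommGroup F] [NormedSpace ℝ F] {Q : B → Type u}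
  [∀ x, AddCommGroup (Q x)] [∀ x, Module ℝ (Q x)] [∀ x, TopologicalSpace (Q x)]
  [TopologicalSpace (TotalSpace F Q)] [FiberBundle F Q] [VectorBundle ℝ F Q]
  [ContMDiffVectorBundle ∞ F Q I]

/-- The fibre chart of a trivialization of a smooth vector bundle. -/
def Bundle.Trivialization.fibreChart (e : Trivialization F (π F Q)) [MemTrivializationAtlas e]
    {U : Set B} (hU : e.baseSet = U) :
    FibreChart (M := Mfd.of I B) (E := Mfd.total I F Q) (fun p : TotalSpace F Q => p.proj) U F where
  y := fun p : TotalSpace F Q => (e p).2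
  s := fun (b : B) (f : F) => e.toOpenPartialHomeomorph.symm (b, f)
  isOpen := hU ▸ e.open_baseSet
  smooth_p := by
    have h : ContMDiff (I.prod 𝓘(ℝ, F)) I ∞ (π F Q) := Bundle.contMDiff_proj Q
    exact h
  smooth_y := by
    have h : ContMDiffOn (I.prod 𝓘(ℝ, F)) 𝓘(ℝ, F) ∞ (fun p : TotalSpace F Q => (e p).2)
        e.source := contMDiff_snd.comp_contMDiffOn (e.contMDiffOn (IB := I) (n := ∞))
    rw [e.source_eq, hU] at h
    exact h
  smooth_s := by
    have h := e.contMDiffOn_symm (IB := I) (n := ∞)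
    rw [e.target_eq, hU] at h
    exact h
  p_s x hx f := e.proj_symm_apply' (by rw [hU]; exact hx)
  y_s := by
    have h : ∀ x ∈ U, ∀ f : F, (e (e.toOpenPartialHomeomorph.symm (x, f))).2 = f :=
      fun x hx f => by rw [e.apply_symm_apply' (by rw [hU]; exact hx)]
    exact h
  s_y a ha := e.symm_apply_mk_proj (e.mem_source.2 (by rw [hU]; exact ha))

instance Bundle.Trivial.memTrivializationAtlas :
    MemTrivializationAtlas (Bundle.Trivial.trivialization B ℝ) := ⟨rfl⟩

/-- The trivialization of the dual bundle. -/
abbrev Bundle.Trivialization.dual (e : Trivialization F (π F Q)) [MemTrivializationAtlas e] :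
    Trivialization (F →L[ℝ] ℝ)
      (π (F →L[ℝ] ℝ) (fun x => Q x →L[ℝ] Bundle.Trivial B ℝ x)) :=
  e.continuousLinearMap (RingHom.id ℝ) (Bundle.Trivial.trivialization B ℝ)

/-- A trivialization of the bundle induces one of the dual in which the pairing is evaluation of
functionals, so the bilinear form is the identity of the dual of F. It is nondegenerate because
continuous functionals separate points. -/
theorem VBData.ofBundle_hasCharts :
    (VBData.ofBundle I F Q).HasCharts F (F →L[ℝ] ℝ) := by
  intro (x : B)
  let e := trivializationAt F Q x
  refine ⟨e.baseSet, FiberBundle.mem_baseSet_trivializationAt' x, e.fibreChart I rfl,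
    e.dual.fibreChart I (inter_univ _), ContinuousLinearMap.id ℝ (F →L[ℝ] ℝ), ?_, ?_, ?_, ?_, ?_, ?_⟩
  · rintro ⟨b, v⟩ ⟨b', w⟩ hb h
    obtain rfl : b = b' := h
    exact congrArg TotalSpace.proj (dif_pos rfl)
  · rintro ⟨b, v⟩ ⟨b', w⟩ hb h
    obtain rfl : b = b' := h
    have hb' : b ∈ e.baseSet := hb
    exact (congrArg (fun a : TotalSpace F Q => (e a).2) (dif_pos rfl)).trans
      ((e.linear ℝ hb').map_add v w)
  · intro r a _; rfl
  · rintro r ⟨b, v⟩ hb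
    have hb' : b ∈ e.baseSet := hb
    exact (e.linear ℝ hb').map_smul r v
  · rintro ⟨b, φ⟩ ⟨b', v⟩ hb h
    obtain rfl : b = b' := h
    have hb' : b ∈ e.baseSet := hb
    have h1 : e.symmL ℝ b (e ⟨b, v⟩).2 = v := by
      rw [e.symmL_apply (hb := hb'), e.symm_apply_apply_mk hb']
    -- The dual trivialization sends φ to its composition with the inverse of e on the fibre, and
    -- that inverse cancels e.
    have h2 : (e.dual ⟨b, φ⟩).2 (e ⟨b, v⟩).2 = φ v := by
      rw [Trivialization.dual, Trivialization.continuousLinearMap_apply]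
      change (Bundle.Trivial.trivialization B ℝ).continuousLinearMapAt ℝ b
        (φ (e.symmL ℝ b (e ⟨b, v⟩).2)) = φ v
      rw [h1, Bundle.Trivial.continuousLinearMapAt_trivialization]
      rfl
    exact (dif_pos rfl).trans h2.symm
  · intro f hf
    exact SeparatingDual.eq_zero_of_forall_dual_eq_zero (R := ℝ) hf

end OfBundle

/-! ### Recurrences and naturality for a bundle with charts -/

namespace VBData.HasCharts

variable {M E D : Mfd.{u}} {σ : VBData M E D} {F G : Type u} [NormedAddCommGroup F]
    [NormedSpace ℝ F] [NormedAddCommGroup G] [NormedSpace ℝ G] (h : σ.HasCharts F G)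
    [M.I.Boundaryless]

include h

theorem upsilon_coord {k : ℕ} {O : Set M} {y : E → ℝ} (hO : IsOpen O)
    (hy : σ.IsFibreLinear O y) {Φ : iterT k (iterT k E)} (hΦ : Φ ∈ σ.SemiHol k k)
    (hx : σ.basePt k Φ ∈ O) :
    y (σ.upsilon k Φ) = ∑ α ∈ Finset.range (k + 1),
      (-1) ^ α * (k.choose α : ℝ) * liftFun₂ y k k α (k - α) Φ := by
  rw [basePt_eq_pt] at hx
  obtain ⟨U, hU, hE, hD, β, c⟩ := h (σ.pE (pt k (pt (N := iterT k E) k Φ)))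
  exact c.upsilon_coord hO hy hΦ hU hx

theorem isNu_upsilon {Φ : iterT 1 (iterT 1 E)} (hΦ : Φ ∈ σ.SemiHol 1 1) :
    σ.IsNu (σ.T.add (Mfd.base (N := E.T) Φ) (σ.T.smul (-1) (tmap (Mfd.base (N := E)) Φ)))
      (σ.upsilon 1 Φ) := by
  obtain ⟨U, hU, hE, hD, β, c⟩ := h (σ.pE (pt 1 (pt (N := iterT 1 E) 1 Φ)))
  exact c.isNu_upsilon hΦ hU

theorem upsilon_succ [E.I.Boundaryless] {k : ℕ} {Φ : iterT (k + 1) (iterT (k + 1) E)}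
    (hΦ : Φ ∈ σ.SemiHol (k + 1) (k + 1)) :
    (∃! X, IsSplit k Φ X) ∧
      ∀ X, IsSplit k Φ X → X ∈ σ.T.T.SemiHol k k ∧ σ.T.T.upsilon k X ∈ σ.SemiHol 1 1 ∧
        σ.upsilon (k + 1) Φ = σ.upsilon 1 (σ.T.T.upsilon k X) := by
  obtain ⟨U, hU, hE, hD, β, c⟩ := h (σ.pE (pt (k + 1) (pt (N := iterT (k + 1) E) (k + 1) Φ)))
  obtain ⟨x, f, -, R⟩ := IsRep.exists_of_mem hE hΦ hU
  refine ⟨⟨_, R.isSplit, fun X hX => isSplit_unique hX R.isSplit⟩, fun X hX => ?_⟩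
  rw [isSplit_unique hX R.isSplit]
  exact ⟨(R.velVel hE.smooth_p).mem_semiHol hE.T.T.smooth_p, c.upsilon_succ R⟩

theorem momentum_zero (Φ : iterT 0 (iterT 0 E)) : σ.momentum 0 Φ = Φ := by
  obtain ⟨U, hU, hE, hD, β, c⟩ := h (σ.pE Φ)
  exact c.momentum_zero Φ hU

theorem momentum_succ {k : ℕ} {Φ : iterT (k + 1) (iterT (k + 1) E)}
    (hΦ : Φ ∈ σ.SemiHol (k + 1) (k + 1)) {Φ' : iterT k (iterT k E.T)}
    (hΦ' : Φ' = Mfd.cast (congrArg (iterT k) (iterT_iterT E rfl).symm)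
      (trunc₂ k (k + 1) (Nat.le_succ k) le_rfl Φ)) :
    Φ' ∈ σ.T.SemiHol k k ∧
      ∀ Ψ ∈ σ.dualVel (k + 1) (σ.baseVel (k + 1) Φ),
        (σ.iter (k + 1)).pair Ψ (σ.momentum (k + 1) Φ) =
          σ.pair (pt (k + 1) Ψ) (σ.upsilon (k + 1) Φ) +
          (σ.iter (k + 1)).pair Ψ (merge (n := 1) (N := E) rfl (σ.T.momentum k Φ')) := by
  obtain ⟨U, hU, hE, hD, β, c⟩ := h (σ.pE (pt (k + 1) (pt (N := iterT (k + 1) E) (k + 1) Φ)))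
  obtain ⟨x, f, -, R⟩ := IsRep.exists_of_mem hE hΦ hU
  have e := cast_trunc₂_jet_jet (g := fun t s => hE.s (x (t + s)) (f t s)) R.smooth_g k
  rw [R.eq] at e
  rw [hΦ'.trans e]
  exact ⟨((R.of_le (m := k) (n := k + 1)).vel_right hE.smooth_p).mem_semiHol hE.T.smooth_p,
    fun Ψ hΨ => c.momentum_succ R hΨ⟩

theorem integration_by_parts {k : ℕ} {Φ : iterT (k + 1) (iterT (k + 1) E)}
    (hΦ : Φ ∈ σ.SemiHol (k + 1) (k + 1)) :
    trunc₂ (k + 1) k le_rfl (Nat.le_succ k) Φ ∈ Vel 1 (σ.SemiHol k k) ∧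
      ∀ Ψ ∈ σ.dualVel (k + 1) (σ.baseVel (k + 1) Φ),
        (σ.iter (k + 1)).pair Ψ
            (part Φ 0 (k + 1) (k + 1) (Nat.zero_le _) le_rfl (Nat.zero_add _)) =
          σ.pair (pt (k + 1) Ψ) (σ.upsilon (k + 1) Φ) +
          (σ.iter (k + 1)).pair Ψ
            (tmapOn (σ.SemiHol k k) (σ.momentum k)
              (trunc₂ (k + 1) k le_rfl (Nat.le_succ k) Φ)) := by
  obtain ⟨U, hU, hE, hD, β, c⟩ := h (σ.pE (pt (k + 1) (pt (N := iterT (k + 1) E) (k + 1) Φ)))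
  obtain ⟨x, f, -, R⟩ := IsRep.exists_of_mem hE hΦ hU
  have e := trunc₂_jet_jet (g := fun t s => hE.s (x (t + s)) (f t s)) R.smooth_g
    (k + 1) k le_rfl (Nat.le_succ k)
  rw [R.eq] at e
  rw [e]
  exact ⟨⟨_, (family_jet_smooth R.smooth_g k).jet k,
    fun r => ((R.of_le (m := k) (n := k)).shift k r).mem_semiHol hE.smooth_p, rfl⟩,
    fun Ψ hΨ => c.integration_by_parts R hΨ⟩

theorem flip [E.I.Boundaryless] {k : ℕ} {Φ : iterT k (iterT k E.T)}
    (hΦ : Φ ∈ σ.T.SemiHol k k) :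
    (∃! Y, IsFlip₂ k k Φ Y) ∧
      ∀ Y, IsFlip₂ k k Φ Y → Y ∈ Vel 1 (σ.SemiHol k k) ∧
        tmapOn (σ.SemiHol k k) (σ.upsilon k) Y = σ.T.upsilon k Φ ∧
        IsFlip k (σ.T.momentum k Φ) (tmapOn (σ.SemiHol k k) (σ.momentum k) Y) := by
  obtain ⟨U, hU, hE, hD, β, c⟩ := h (Mfd.base (σ.T.pE (pt k (pt (N := iterT k E.T) k Φ))))
  obtain ⟨Y, hY, hY'⟩ := c.exists_flip hΦ hU
  exact ⟨⟨Y, hY, fun Z hZ => isFlip₂_unique hZ hY⟩,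
    fun Z hZ => isFlip₂_unique hZ hY ▸ hY'⟩

end VBData.HasCharts

end

theorem mainTheorem1 {V : Type u} [NormedAddCommGroup V] [NormedSpace ℝ V] [FiniteDimensional ℝ V]
    {H : Type u} [TopologicalSpace H] (I : ModelWithCorners ℝ V H) [I.Boundaryless]
    {B : Type u} [TopologicalSpace B] [ChartedSpace H B] [IsManifold I ∞ B]
    (F : Type u) [NormedAddCommGroup F] [NormedSpace ℝ F] [FiniteDimensional ℝ F]
    (Q : B → Type u) [∀ x, AddCommGroup (Q x)] [∀ x, Module ℝ (Q x)]
    [∀ x, TopologicalSpace (Q x)] [TopologicalSpace (TotalSpace F Q)] [FiberBundle F Q]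
    [VectorBundle ℝ F Q] [ContMDiffVectorBundle ∞ F Q I] (k : ℕ) :
    let σ := VBData.ofBundle I F Q
    -- the pairing depends only on the base point `ξ` of the `k`-velocity
    (∀ Φ ∈ σ.SemiHol k k, ∀ Ψ₁ ∈ σ.dualVel k (σ.baseVel k Φ),
      ∀ Ψ₂ ∈ σ.dualVel k (σ.baseVel k Φ), pt k Ψ₁ = pt k Ψ₂ →
        (σ.iter k).pair Ψ₁ (σ.tilde k Φ) = (σ.iter k).pair Ψ₂ (σ.tilde k Φ)) ∧
    -- it defines the map `Υ`, a vector bundle morphism covering `τ^{2k}`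
    (∀ Φ ∈ σ.SemiHol k k, ∀ u, σ.IsUpsilon k Φ u ↔ u = σ.upsilon k Φ) ∧
    ((σ.iter k).iter k).IsMorphismOn (σ.SemiHol k k) σ (σ.upsilon k)
      (fun v => pt k (pt (N := iterT k (Mfd.of I B)) k v)) ∧
    -- the momentum map is well defined as well
    (∀ Φ ∈ σ.SemiHol k k, ∀ Y, σ.IsP k (σ.hat k Φ) Y ↔ Y = σ.momentum k Φ) ∧
    ((σ.iter k).iter k).IsMorphismOn (σ.SemiHol k k) (σ.iter k) (σ.momentum k)
      (fun v => pt (N := iterT k (Mfd.of I B)) k v) ∧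
    -- `Υ` in coordinates, for any fibre coordinate `y` (its base coordinates are given by `covers`)
    (∀ (U : Set (Mfd.of I B)) (y : Mfd.total I F Q → ℝ), IsOpen U → σ.IsFibreLinear U y →
      ∀ Φ ∈ σ.SemiHol k k, σ.basePt k Φ ∈ U →
        y (σ.upsilon k Φ) = ∑ α ∈ Finset.range (k + 1),
          (-1) ^ α * (k.choose α : ℝ) * liftFun₂ y k k α (k - α) Φ) ∧
    -- recurrence for `Υ`
    (∀ Φ ∈ σ.SemiHol 1 1,
      σ.IsNu (σ.T.add (Mfd.base (N := (Mfd.total I F Q).T) Φ)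
        (σ.T.smul (-1) (tmap (Mfd.base (N := Mfd.total I F Q)) Φ))) (σ.upsilon 1 Φ)) ∧
    (∀ Φ ∈ σ.SemiHol (k + 1) (k + 1),
      (∃! X, IsSplit k Φ X) ∧
      ∀ X, IsSplit k Φ X → X ∈ σ.T.T.SemiHol k k ∧ σ.T.T.upsilon k X ∈ σ.SemiHol 1 1 ∧
        σ.upsilon (k + 1) Φ = σ.upsilon 1 (σ.T.T.upsilon k X)) ∧
    -- recurrence for `Π`
    (∀ Φ : iterT 0 (iterT 0 (Mfd.total I F Q)), σ.momentum 0 Φ = Φ) ∧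
    (∀ Φ ∈ σ.SemiHol (k + 1) (k + 1),
      ∀ Φ' : iterT k (iterT k (Mfd.total I F Q).T),
        Φ' = Mfd.cast (congrArg (iterT k) (iterT_iterT (Mfd.total I F Q) rfl).symm)
          (trunc₂ k (k + 1) (Nat.le_succ k) le_rfl Φ) →
        Φ' ∈ σ.T.SemiHol k k ∧
        ∀ Ψ ∈ σ.dualVel (k + 1) (σ.baseVel (k + 1) Φ),
          (σ.iter (k + 1)).pair Ψ (σ.momentum (k + 1) Φ) =
            σ.pair (pt (k + 1) Ψ) (σ.upsilon (k + 1) Φ) +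
            (σ.iter (k + 1)).pair Ψ
              (merge (n := 1) (N := Mfd.total I F Q) rfl (σ.T.momentum k Φ'))) ∧
    -- the integration-by-parts formula
    (∀ Φ ∈ σ.SemiHol (k + 1) (k + 1),
      trunc₂ (k + 1) k le_rfl (Nat.le_succ k) Φ ∈ Vel 1 (σ.SemiHol k k) ∧
      ∀ Ψ ∈ σ.dualVel (k + 1) (σ.baseVel (k + 1) Φ),
        (σ.iter (k + 1)).pair Ψ
            (part Φ 0 (k + 1) (k + 1) (Nat.zero_le _) le_rfl (Nat.zero_add _)) =
          σ.pair (pt (k + 1) Ψ) (σ.upsilon (k + 1) Φ) +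
          (σ.iter (k + 1)).pair Ψ
            (tmapOn (σ.SemiHol k k) (σ.momentum k)
              (trunc₂ (k + 1) k le_rfl (Nat.le_succ k) Φ))) ∧
    -- `Υ` and `Π` commute with the tangent functor
    (∀ Φ ∈ σ.T.SemiHol k k,
      (∃! Y, IsFlip₂ k k Φ Y) ∧
      ∀ Y, IsFlip₂ k k Φ Y → Y ∈ Vel 1 (σ.SemiHol k k) ∧
        tmapOn (σ.SemiHol k k) (σ.upsilon k) Y = σ.T.upsilon k Φ ∧
        IsFlip k (σ.T.momentum k Φ) (tmapOn (σ.SemiHol k k) (σ.momentum k) Y)) := by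
  intro σ
  have : (Mfd.of I B).I.Boundaryless := inferInstanceAs I.Boundaryless
  have : (Mfd.total I F Q).I.Boundaryless := inferInstanceAs (I.prod 𝓘(ℝ, F)).Boundaryless
  have h : σ.HasCharts F (F →L[ℝ] ℝ) := VBData.ofBundle_hasCharts I
  exact ⟨fun Φ hΦ _ h₁ _ h₂ hpt => h.tilde_pair_eq hΦ h₁ h₂ hpt,
    fun Φ hΦ u => h.isUpsilon_iff hΦ u, h.upsilon_isMorphismOn k,
    fun Φ hΦ Y => h.isP_iff hΦ Y, h.momentum_isMorphismOn k,
    fun U y hU hy Φ hΦ hx => h.upsilon_coord hU hy hΦ hx,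
    fun Φ hΦ => h.isNu_upsilon hΦ, fun Φ hΦ => h.upsilon_succ hΦ, h.momentum_zero,
    fun Φ hΦ Φ' hΦ' => h.momentum_succ hΦ hΦ', fun Φ hΦ => h.integration_by_parts hΦ,
    fun Φ hΦ => h.flip hΦ⟩
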